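/- Let $p,N,m\ge 1$ and $n\neq 0$ be integers with $n,m$ coprime, and assume $m>1$ if $n>0$. Let $\beta_i^k\in\mathbb C$ ($1\le i\le N$, $1\le k\le p$) satisfy $\beta_i^k-\beta_i^{k+1}=n/m$ for all $i$ and $1\le k\le p-1$. For $a=(a_1,\dots,a_N)\in\mathbb C^N$ with pairwise distinct entries let $X_a$ be the compact Riemann surface of the curve $w^m=(z-a_1)\cdots(z-a_N)$, that is, the smooth affine curve completed by $\gcd(m,N)$ points at infinity, and put $$\Omega_i^{(j)}(a)=\frac{w^{jn}\,dz}{z-a_i},\qquad 1\le i\le N,\quad j\ge 1 .$$ Let $Y_a$ be (a) $X_a$, if $n>0$ and $m,N$ are coprime; (b) $X_a\setminus\{\text{points at infinity}\}$, if $n>0$ and $m,N$ are not coprime; (c) $X_a\setminus\{(a_1,0),\dots,(a_N,0)\}$, if $n<0$. Then the following holds. 1. For every such $a$ and all $i$, $j$, the integral $\oint_\gamma\Omega_i^{(j)}(a)$ over a class $\gamma\in H_1(Y_a,\mathbb Z)$ is well defined, as the integral over any cycle that represents $\gamma$ and avoids the poles of $\Omega_i^{(j)}(a)$. 2. Call a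 family of classes $\gamma(a)\in H_1(Y_a,\mathbb Z)$, $a\in D$, independent of $a$ if near every point of $D$ it is represented by cycles $\sum_r c_r\sigma_r(a)$ with constant $c_r\in\mathbb Z$ and with paths $\sigma_r(a)$ in $Y_a$ that depend continuously on $a$. Every $a^0$ with pairwise distinct entries is the centre of a (poly)disc $D\subset\mathbb C^N\setminus\bigcup_{i\ne j}\{a_i=a_j\}$ such that every class in $H_1(Y_{a^0},\mathbb Z)$ is the value at $a^0$ of a family over $D$ that is independent of $a$. 3. Let $D\subset\mathbb C^N\setminus\bigcup_{i\neq j}\{a_i=a_j\}$ be open, and let $\gamma_1,\dots,\gamma_{p-1}$ be arbitrary families of classes $\gamma_j(a)\in H_1(Y_a,\mathbb Z)$, $a\in D$, that are independent of $a$. Then the upper triangular $p\times p$ matrices $B^{(i)}(a)=(b_i^{kl}(a))$, $1\le i\le N$, with $$b_i^{kk}=\beta_i^k,\qquad b_i^{kl}=0\ \ (k>l),\qquad b_i^{kl}(a)=\oint_{\gamma_{l-k}(a)}\Omega_i^{(l-k)}(a)\ \ (k<l)$$ are holomorphic in $D$ and satisfy the Schlesinger system $$\frac{\partial B^{(i)}}{\partial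 a_j}=\frac{[B^{(i)},B^{(j)}]}{a_i-a_j}\ \ (i\ne j),\qquad \frac{\partial B^{(i)}}{\partial a_i}=-\sum_{j\ne i}\frac{[B^{(i)},B^{(j)}]}{a_i-a_j}.$$ -/

import Mathlib

open Filter Topology CategoryTheory

noncomputable section

namespace Superelliptic

/-- The points `(a, z, w)` with `w ^ m = (z - a_1) ⋯ (z - a_N)`: the family, over the parameter
`a`, of the affine curves. It carries the subspace topology of `ℂ^N × ℂ × ℂ`. -/
abbrev AffineFamily (m N : ℕ) : Type :=
  {x : (Fin N → ℂ) × ℂ × ℂ // x.2.2 ^ m = ∏ i, (x.2.1 - x.1 i)}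

/-- The family of compact Riemann surfaces `X_a`. With `s = gcd(m, N)`, `m = s m₁`, `N = s N₁`,
the surface `X_a` has exactly `s` points over the point(s) at infinity of the affine curve. On the
affine curve `(w ^ m₁ / z ^ N₁) ^ s = ∏ (1 - a_i / z)` tends to `1` as `z → ∞`, and the branches
at infinity are told apart by the limit `ζ` of `w ^ m₁ / z ^ N₁`, an `s`-th root of unity. -/
inductive Family (m N : ℕ) : Type
  | aff (x : AffineFamily m N) : Family m N
  | inf (a : Fin N → ℂ) (ζ : {ζ : ℂ // ζ ^ Nat.gcd m N = 1}) : Family m N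

namespace Family

variable {m N : ℕ}

/-- The parameter `a` of the surface `X_a` on which the point lies. -/
def base : Family m N → (Fin N → ℂ)
  | aff x => x.1.1
  | inf a _ => a

/-- The function `z` (its value at the points at infinity is irrelevant). -/
def z : Family m N → ℂ
  | aff x => x.1.2.1
  | inf _ _ => 0

/-- The function `w` (its value at the points at infinity is irrelevant). -/
def w : Family m N → ℂ
  | aff x => x.1.2.2
  | inf _ _ => 0

/-- The points at infinity. -/
def IsInfinite (P : Family m N) : Prop := ∃ a ζ, P = inf a ζ

/-- The points `(a_i, 0)`, that is, the points of the affine curve with `w = 0`. -/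
def IsBranch (P : Family m N) : Prop := ∃ x : AffineFamily m N, P = aff x ∧ x.1.2.2 = 0

/-- The basic neighbourhood of the point at infinity `(a, ζ)`: the parameter is `ε`-close to `a`,
and the point is either the point at infinity with the same `ζ`, or an affine point with
`|z| > 1 / ε` and `w ^ m₁ / z ^ N₁` at distance less than `ε` from `ζ`. -/
def nhdInf (a : Fin N → ℂ) (ζ : {ζ : ℂ // ζ ^ Nat.gcd m N = 1}) (ε : ℝ) : Set (Family m N) :=
  {P | dist P.base a < ε ∧
    ((∃ b, P = inf b ζ) ∨
      ∃ x : AffineFamily m N, P = aff x ∧ 1 / ε < ‖x.1.2.1‖ ∧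
        ‖x.1.2.2 ^ (m / Nat.gcd m N) / x.1.2.1 ^ (N / Nat.gcd m N) - (ζ : ℂ)‖ < ε)}

theorem nhdInf_mono (a : Fin N → ℂ) (ζ : {ζ : ℂ // ζ ^ Nat.gcd m N = 1}) {ε δ : ℝ}
    (hε : 0 < ε) (h : ε ≤ δ) : nhdInf a ζ ε ⊆ nhdInf a ζ δ := by
  rintro P ⟨h1, h2⟩
  refine ⟨h1.trans_le h, h2.imp id ?_⟩
  rintro ⟨x, hx, hz, hw⟩
  exact ⟨x, hx, (one_div_le_one_div_of_le hε h).trans_lt hz, hw.trans_le h⟩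

/-- The affine family is open with its usual topology, and the sets `nhdInf a ζ ε` with `ε > 0`
form a neighbourhood basis of the point at infinity `(a, ζ)`. -/
instance : TopologicalSpace (Family m N) where
  IsOpen U := IsOpen (aff ⁻¹' U : Set (AffineFamily m N)) ∧
    ∀ a ζ, inf a ζ ∈ U → ∃ ε : ℝ, 0 < ε ∧ nhdInf a ζ ε ⊆ U
  isOpen_univ := ⟨isOpen_univ, fun _ _ _ => ⟨1, one_pos, Set.subset_univ _⟩⟩
  isOpen_inter := by
    rintro U V ⟨hU, hU'⟩ ⟨hV, hV'⟩
    refine ⟨hU.inter hV, fun a ζ h => ?_⟩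
    obtain ⟨ε, hε, hεU⟩ := hU' a ζ h.1
    obtain ⟨δ, hδ, hδV⟩ := hV' a ζ h.2
    have hm : 0 < min ε δ := lt_min hε hδ
    exact ⟨min ε δ, hm, Set.subset_inter
      ((nhdInf_mono a ζ hm (min_le_left _ _)).trans hεU)
      ((nhdInf_mono a ζ hm (min_le_right _ _)).trans hδV)⟩
  isOpen_sUnion := by
    intro S hS
    refine ⟨?_, ?_⟩
    · rw [Set.preimage_sUnion]
      exact isOpen_biUnion fun U hU => (hS U hU).1
    · rintro a ζ ⟨U, hU, h⟩
      obtain ⟨ε, hε, hεU⟩ := (hS U hU).2 a ζ h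
      exact ⟨ε, hε, hεU.trans (Set.subset_sUnion_of_mem hU)⟩

end Family

/-- The compact Riemann surface `X_a` of the curve `w ^ m = (z - a_1) ⋯ (z - a_N)`, for pairwise
distinct `a_1, …, a_N`. Only its topology is recorded as an instance; its complex structure is the
one for which `z` is a local coordinate at the affine points with `w ≠ 0`. -/
abbrev Surface (m : ℕ) {N : ℕ} (a : Fin N → ℂ) : Type :=
  {P : Family m N // P.base = a}

/-- The part of the surfaces in which the cycles of integration lie:
the complement of the points `(a_i, 0)` if `n < 0`;
everything if `n > 0` and `m`, `N` are coprime;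
the complement of the points at infinity if `n > 0` and `m`, `N` are not coprime. -/
def cycleDomain (m N : ℕ) (n : ℤ) : Set (Family m N) :=
  if n < 0 then {P | ¬ P.IsBranch}
  else if Nat.Coprime m N then Set.univ
  else {P | ¬ P.IsInfinite}

/-- The possibly punctured surface `X_a`, `X_a ∖ {points at infinity}` or
`X_a ∖ {(a_1, 0), …, (a_N, 0)}`, according to the three cases of `cycleDomain`. -/
abbrev CycleSurface (m : ℕ) {N : ℕ} (n : ℤ) (a : Fin N → ℂ) : Type :=
  {P : Surface m a // P.1 ∈ cycleDomain m N n}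

/-- The singular chain complex of a space, with integer coefficients. -/
abbrev singularChains (Y : Type) [TopologicalSpace Y] : ChainComplex (ModuleCat.{0} ℤ) ℕ :=
  ((AlgebraicTopology.singularChainComplexFunctor (ModuleCat.{0} ℤ)).obj
    (ModuleCat.of ℤ ℤ)).obj (TopCat.of Y)

/-- The first singular homology group `H_1(Y, ℤ)`. -/
abbrev H1 (Y : Type) [TopologicalSpace Y] : ModuleCat.{0} ℤ :=
  ((AlgebraicTopology.singularHomologyFunctor (ModuleCat.{0} ℤ) 1).obj
    (ModuleCat.of ℤ ℤ)).obj (TopCat.of Y)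

/-- A path, as a singular `1`-simplex and hence as a singular `1`-chain. -/
def pathChain {Y : Type} [TopologicalSpace Y] (σ : C(unitInterval, Y)) : (singularChains Y).X 1 :=
  ((TopCat.toSSet.obj (TopCat.of Y)).ιChainComplex (R := ModuleCat.of ℤ ℤ)
    ((TopCat.toSSetObjEquiv (TopCat.of Y) (.op (SimplexCategory.mk 1))).symm
      (σ.comp (stdSimplexHomeomorphUnitInterval : C(stdSimplex ℝ (Fin 2), unitInterval))))).hom
    (1 : ℤ)

/-- The chain `∑ c_r σ_r` is a cycle, and its homology class is `γ`. -/
def Represents {Y : Type} [TopologicalSpace Y] {R : ℕ} (c : Fin R → ℤ)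
    (σ : Fin R → C(unitInterval, Y)) (γ : H1 Y) : Prop :=
  ∃ x : (singularChains Y).cycles 1,
    ((singularChains Y).iCycles 1).hom x = ∑ r, c r • pathChain (σ r) ∧
    ((singularChains Y).homologyπ 1).hom x = γ

section Integration

variable {m N : ℕ} {a : Fin N → ℂ}

/-- On the open set `U ⊆ X_a`, the function `h` is a holomorphic primitive of the differential
`w ^ q dz / (z - a_i)`: it is continuous, and `dh / dz = w ^ q / (z - a_i)` at the points of `U`
where `z` is a local coordinate. (At the remaining points, which are isolated, a continuous
function that is holomorphic nearby is holomorphic.) -/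
def IsPrimitive (i : Fin N) (q : ℤ) (U : Set (Surface m a)) (h : Surface m a → ℂ) : Prop :=
  ContinuousOn h U ∧
    ∀ P ∈ U, ¬ P.1.IsInfinite → ¬ P.1.IsBranch →
      Tendsto (fun Q : Surface m a => (h Q - h P) / (Q.1.z - P.1.z)) (𝓝[≠] P)
        (𝓝 (P.1.w ^ q / (P.1.z - a i)))

/-- The integral of `w ^ q dz / (z - a_i)` along the continuous path `σ` exists and is `v`: along
`σ` there is a function `F` that is locally the restriction of a holomorphic primitive, and
`v = F(1) - F(0)`. In particular `σ` avoids the points where the differential has no holomorphic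
primitive, that is, its poles. -/
def IsPathIntegral (i : Fin N) (q : ℤ) (σ : C(unitInterval, Surface m a)) (v : ℂ) : Prop :=
  ∃ F : unitInterval → ℂ,
    (∀ t₀, ∃ (U : Set (Surface m a)) (h : Surface m a → ℂ), IsOpen U ∧ σ t₀ ∈ U ∧
      IsPrimitive i q U h ∧ ∀ᶠ t in 𝓝 t₀, F t = h (σ t)) ∧
    v = F 1 - F 0

/-- `v` is the integral of the differential `Ω_i^{(j)} = w ^ (j n) dz / (z - a_i)` over the
homology class `γ`: it is the integral over some cycle that represents `γ` and avoids the poles. -/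
def IsPeriod (n : ℤ) (i : Fin N) (j : ℕ) (γ : H1 (CycleSurface m n a)) (v : ℂ) : Prop :=
  ∃ (R : ℕ) (c : Fin R → ℤ) (σ : Fin R → C(unitInterval, CycleSurface m n a)) (u : Fin R → ℂ),
    Represents c σ γ ∧
    (∀ r, IsPathIntegral i ((j : ℤ) * n)
      ((ContinuousMap.mk Subtype.val continuous_subtype_val).comp (σ r)) (u r)) ∧
    v = ∑ r, (c r : ℂ) * u r

end Integration

/-- The family of homology classes `γ a` does not depend on `a ∈ D`, as a family in the varying
surfaces: near every point of `D` it is represented by a cycle `∑ c_r σ_r(a)` with constant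
coefficients whose paths `σ_r(a)` in the surface with parameter `a` vary continuously with `a`. -/
def IsFlat {m N : ℕ} {n : ℤ} (D : Set (Fin N → ℂ))
    (γ : ∀ a : Fin N → ℂ, H1 (CycleSurface m n a)) : Prop :=
  ∀ a₀ ∈ D, ∃ V ∈ 𝓝 a₀, ∃ (R : ℕ) (c : Fin R → ℤ)
    (σ : Fin R → ∀ a : Fin N → ℂ, C(unitInterval, CycleSurface m n a)),
    (∀ r, ContinuousOn (fun x : (Fin N → ℂ) × unitInterval => (σ r x.1 x.2).1.1)
      ((V ∩ D) ×ˢ Set.univ)) ∧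
    ∀ a ∈ V ∩ D, Represents c (fun r => σ r a) (γ a)

/-- The matrix functions `B^{(1)}, …, B^{(N)}` are holomorphic on `D` and satisfy there the
Schlesinger system
`∂B^{(i)}/∂a_j = [B^{(i)}, B^{(j)}] / (a_i - a_j)` for `i ≠ j`, and
`∂B^{(i)}/∂a_i = - ∑_{j ≠ i} [B^{(i)}, B^{(j)}] / (a_i - a_j)`. -/
def SolvesSchlesinger {p N : ℕ} (D : Set (Fin N → ℂ))
    (B : Fin N → (Fin N → ℂ) → Matrix (Fin p) (Fin p) ℂ) : Prop :=
  ∀ a ∈ D,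
    (∀ i k l, DifferentiableAt ℂ (fun x => B i x k l) a) ∧
    (∀ i j, i ≠ j → ∀ k l, fderiv ℂ (fun x => B i x k l) a (Pi.single j 1) =
      (B i a * B j a - B j a * B i a) k l / (a i - a j)) ∧
    (∀ i k l, fderiv ℂ (fun x => B i x k l) a (Pi.single i 1) =
      - ∑ j ∈ Finset.univ.erase i, (B i a * B j a - B j a * B i a) k l / (a i - a j))

end Superelliptic

end

open Superelliptic

/-! The periods are well defined because the forms have no residues on `Y_a`. In a local coordinate
`u` the form `w ^ q dz / (z - a_i)`, `q = j n`, is holomorphic at every point of `Y_a`, except that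
for `n > 0` and `m`, `N` coprime it has a pole at the single point at infinity. There it reads `φ(u
^ m) u ^ (-N q - 1) du`: if `m` does not divide `q`, no exponent of `u` equals `-1`; if `m` divides
`q`, the form is a polynomial in `z` times `dz`, hence exact (`exists_primitive_punctured`,
`exists_isPrimitive_punctured`). So `Y_a` is covered by open sets with single-valued primitives off
the poles, any two of which differ by local constants. Such data (`LocalPrimitives`) define a
covering space with fibre `ℂ`. Lifting paths, triangles and squares to it gives an integral along
every path, even through poles; it vanishes on boundaries and is constant along homotopies of
cycles. Moreover every class is represented by paths that avoid infinity and the branch points and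
along which `z` is affine (`exists_represents_segments`).

When the branch points move from `b` to a nearby `a`, the surface with parameter `b` is mapped to
the one with parameter `a`: `z` is translated near each branch point, with a cut-off, and `w` is
multiplied by a product of principal `m`-th roots (`transport`). This pushes a class to the
neighbouring surfaces (`exists_isFlat`). It also brings the nearby members of any family that is
independent of `a` into one surface, where they are homotopic cycles (`eventually_sum_integral_eq`).
Hence near `b` the period of such a family is the integral over the transport of one fixed cycle of
segments. With a small enough cut-off, `z` stays fixed on this cycle and only `w` changes, by the
factor `∏ ((z - a_k) / (z - b_k)) ^ (1 / m)` (`exists_segmentCycle`).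

Now differentiate under the integral sign. By partial fractions, `∂Ω_i/∂a_j = (q / m) (Ω_j - Ω_i) /
(a_i - a_j)` for `i ≠ j`. The sum of all partial derivatives of `Ω_i` is `-d(w ^ q / (z - a_i))`,
which integrates to zero over a cycle. On the matrix side, the parts of `B^{(i)}` and `B^{(j)}`
above the diagonal are constant along diagonals and commute. Only the products with the diagonal
survive, so the entry `(k, l)` of `[B^{(i)}, B^{(j)}]` is `(l - k) (n / m)` times the difference of
the two entries (`commutator_apply`). With `q = (l - k) n` the two computations agree. -/

noncomputable section

namespace Superelliptic

/-! ### Singular 1-chains, cycles and homology classes in terms of paths -/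

section SingularChains

variable {Y Z : Type} [TopologicalSpace Y] [TopologicalSpace Z]

/-- The singular `n`-simplices of `Y`. -/
abbrev Simplex (Y : Type) [TopologicalSpace Y] (n : ℕ) : Type :=
  (TopCat.toSSet.obj (TopCat.of Y)).obj (.op (SimplexCategory.mk n))

/-- A singular simplex, as a singular chain. -/
def simplexChain {n : ℕ} (s : Simplex Y n) : (singularChains Y).X n :=
  ((TopCat.toSSet.obj (TopCat.of Y)).ιChainComplex (R := ModuleCat.of ℤ ℤ) s).hom (1 : ℤ)

/-- The chain group is a coproduct of copies of `ℤ` indexed by the simplices, so a homomorphism can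
be prescribed freely on them. -/
theorem exists_addHom_simplexChain {n : ℕ} {A : Type} [AddCommGroup A] (f : Simplex Y n → A) :
    ∃ L : (singularChains Y).X n →+ A, ∀ s, L (simplexChain s) = f s := by
  let g : (s : Simplex Y n) → (ModuleCat.of ℤ ℤ ⟶ ModuleCat.of ℤ A) := fun s =>
    ModuleCat.ofHom (LinearMap.toSpanSingleton ℤ A (f s))
  let L := Limits.Cofan.IsColimit.desc
    ((TopCat.toSSet.obj (TopCat.of Y)).isColimitChainComplexXCofan (ModuleCat.of ℤ ℤ) n) g
  refine ⟨L.hom.toAddMonoidHom, fun s => ?_⟩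
  have h : (TopCat.toSSet.obj (TopCat.of Y)).ιChainComplex s ≫ L = g s :=
    Limits.Cofan.IsColimit.fac
    ((TopCat.toSSet.obj (TopCat.of Y)).isColimitChainComplexXCofan (ModuleCat.of ℤ ℤ) n) g s
  have h2 := congrArg (fun φ => ModuleCat.Hom.hom φ (1 : ℤ)) h
  exact h2.trans (by simp [g])

theorem addHom_ext_simplexChain {n : ℕ} {A : Type} [AddCommGroup A]
    {L L' : (singularChains Y).X n →+ A}
    (h : ∀ s : Simplex Y n, L (simplexChain s) = L' (simplexChain s)) : L = L' := by
  let lin : ((singularChains Y).X n →+ A) → ((singularChains Y).X n →ₗ[ℤ] A) := fun L =>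
    { toFun := L, map_add' := L.map_add, map_smul' := fun c x => map_intCast_smul L ℤ ℤ c x }
  have : (ModuleCat.ofHom (lin L) : (singularChains Y).X n ⟶ ModuleCat.of ℤ A)
      = ModuleCat.ofHom (lin L') := by
    refine SSet.chainComplex_hom_ext (X := TopCat.toSSet.obj (TopCat.of Y)) fun s => ?_
    ext
    exact h s
  ext x
  exact congrArg (fun φ => φ.hom x) this

/-- The projection onto the quotient by the closure vanishes on every simplex, hence is zero. -/
theorem closure_range_simplexChain {n : ℕ} :
    AddSubgroup.closure (Set.range (simplexChain (Y := Y) (n := n))) = ⊤ := by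
  set S := AddSubgroup.closure (Set.range (simplexChain (Y := Y) (n := n)))
  have : QuotientAddGroup.mk' S = 0 :=
    addHom_ext_simplexChain fun s =>
      (QuotientAddGroup.eq_zero_iff _).2 (AddSubgroup.subset_closure ⟨s, rfl⟩)
  rw [← QuotientAddGroup.ker_mk' S, this]
  exact AddMonoidHom.ker_zero

theorem d_simplexChain {n : ℕ} (s : Simplex Y (n + 1)) :
    ((singularChains Y).d (n + 1) n).hom (simplexChain s) =
      ∑ i : Fin (n + 2), ((-1) ^ (i : ℕ) : ℤ) •
        simplexChain ((TopCat.toSSet.obj (TopCat.of Y)).δ i s) := by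
  have h := congrArg (fun φ => φ.hom (1 : ℤ))
    (SSet.ιChainComplex_d (R := ModuleCat.of ℤ ℤ) (TopCat.toSSet.obj (TopCat.of Y)) s)
  refine h.trans ?_
  simp only [ModuleCat.hom_sum, LinearMap.sum_apply]
  refine Finset.sum_congr rfl fun i _ => ?_
  rw [ModuleCat.hom_zsmul]
  rfl

/-- A continuous map from the standard simplex, as a singular simplex. -/
def simplexOfMap {n : ℕ} (f : C(stdSimplex ℝ (Fin (n + 1)), Y)) : Simplex Y n :=
  (TopCat.toSSetObjEquiv (TopCat.of Y) (.op (SimplexCategory.mk n))).symm f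

/-- The continuous map underlying a singular simplex. -/
def Simplex.toMap {n : ℕ} (s : Simplex Y n) : C(stdSimplex ℝ (Fin (n + 1)), Y) :=
  TopCat.toSSetObjEquiv (TopCat.of Y) (.op (SimplexCategory.mk n)) s

theorem simplexOfMap_toMap {n : ℕ} (s : Simplex Y n) : simplexOfMap (Simplex.toMap s) = s :=
  Equiv.symm_apply_apply _ _

theorem toMap_simplexOfMap {n : ℕ} (f : C(stdSimplex ℝ (Fin (n + 1)), Y)) :
    Simplex.toMap (simplexOfMap f) = f :=
  Equiv.apply_symm_apply _ _

theorem toMap_face {n : ℕ} (s : Simplex Y (n + 1)) (i : Fin (n + 2))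
    (x : stdSimplex ℝ (Fin (n + 1))) :
    Simplex.toMap ((TopCat.toSSet.obj (TopCat.of Y)).δ i s) x =
      Simplex.toMap s (stdSimplex.map (Fin.succAbove i) x) := rfl

theorem pathChain_eq (σ : C(unitInterval, Y)) :
    pathChain σ = simplexChain (simplexOfMap (n := 1)
      (σ.comp (stdSimplexHomeomorphUnitInterval : C(stdSimplex ℝ (Fin 2), unitInterval)))) := rfl

theorem pathChain_surj_simplexChain (s : Simplex Y 1) : ∃ σ : C(unitInterval, Y),
    pathChain σ = simplexChain s := by
  refine ⟨(Simplex.toMap s).comp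
    (stdSimplexHomeomorphUnitInterval.symm : C(unitInterval, stdSimplex ℝ (Fin 2))), ?_⟩
  rw [pathChain_eq, ContinuousMap.comp_assoc]
  have : ((stdSimplexHomeomorphUnitInterval.symm : C(unitInterval, stdSimplex ℝ (Fin 2))).comp
    (stdSimplexHomeomorphUnitInterval : C(stdSimplex ℝ (Fin 2), unitInterval))) = .id _ := by
    ext1 x; simp
  rw [this, ContinuousMap.comp_id, simplexOfMap_toMap]

theorem closure_range_pathChain :
    AddSubgroup.closure (Set.range (pathChain (Y := Y))) = ⊤ := by
  rw [← closure_range_simplexChain]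
  congr 1
  ext x
  constructor
  · rintro ⟨σ, rfl⟩
    exact ⟨_, (pathChain_eq σ).symm⟩
  · rintro ⟨s, rfl⟩
    exact pathChain_surj_simplexChain s

theorem exists_addHom_pathChain {A : Type} [AddCommGroup A] (f : C(unitInterval, Y) → A) :
    ∃ L : (singularChains Y).X 1 →+ A, ∀ σ, L (pathChain σ) = f σ := by
  obtain ⟨L, hL⟩ := exists_addHom_simplexChain (Y := Y) (n := 1) (A := A) fun s =>
    f ((Simplex.toMap s).comp
      (stdSimplexHomeomorphUnitInterval.symm : C(unitInterval, stdSimplex ℝ (Fin 2))))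
  refine ⟨L, fun σ => ?_⟩
  rw [pathChain_eq, hL, toMap_simplexOfMap]
  congr 1

/-- The affine map from the unit interval onto the edge of a standard simplex from the vertex `v`
to the vertex `v'`. -/
def edge {n : ℕ} (v v' : Fin (n + 1)) : C(unitInterval, stdSimplex ℝ (Fin (n + 1))) where
  toFun t := ⟨fun k => (1 - t : ℝ) * (Pi.single v 1 : Fin (n + 1) → ℝ) k
    + t * (Pi.single v' 1 : Fin (n + 1) → ℝ) k,
    (convex_stdSimplex ℝ (Fin (n + 1))) (single_mem_stdSimplex ℝ v) (single_mem_stdSimplex ℝ v')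
      (unitInterval.one_minus_nonneg t) t.2.1 (by ring)⟩
  continuous_toFun := by
    refine Continuous.subtype_mk (continuous_pi fun k => ?_) _
    fun_prop

theorem simplexChain_face (T : C(stdSimplex ℝ (Fin 3), Y)) (i : Fin 3) :
    simplexChain ((TopCat.toSSet.obj (TopCat.of Y)).δ i (simplexOfMap (n := 2) T)) =
      pathChain (T.comp (edge (n := 2) (i.succAbove 0) (i.succAbove 1))) := by
  rw [pathChain_eq]
  congr 1
  rw [← simplexOfMap_toMap ((TopCat.toSSet.obj (TopCat.of Y)).δ i (simplexOfMap (n := 2) T))]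
  congr 1
  ext1 x
  rw [toMap_face, toMap_simplexOfMap]
  simp only [ContinuousMap.comp_apply]
  congr 1
  have hx : (x : Fin 2 → ℝ) = (1 - x 1) • Pi.single 0 1 + (x 1) • Pi.single 1 1 := by
    have h := x.2.2
    rw [Fin.sum_univ_two] at h
    funext k
    fin_cases k
    · have h' : x 0 = 1 - x 1 := eq_sub_of_add_eq h
      simpa using h'
    · simp
  apply Subtype.ext
  show FunOnFinite.linearMap ℝ ℝ _ (x : Fin 2 → ℝ) = _
  conv_lhs => rw [hx]
  simp only [map_add, map_smul, FunOnFinite.linearMap_piSingle]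
  rfl

/-- A continuous map from the standard triangle, as a singular `2`-chain. -/
def triangleChain (T : C(stdSimplex ℝ (Fin 3), Y)) : (singularChains Y).X 2 :=
  simplexChain (simplexOfMap (n := 2) T)

theorem d_triangleChain (T : C(stdSimplex ℝ (Fin 3), Y)) :
    ((singularChains Y).d 2 1).hom (triangleChain T) =
      pathChain (T.comp (edge 1 2)) - pathChain (T.comp (edge 0 2))
        + pathChain (T.comp (edge 0 1)) := by
  refine (d_simplexChain _).trans ((Fin.sum_univ_three _).trans ?_)
  have h (i : Fin 3) := simplexChain_face T i
  have h0 := h 0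
  have h1 := h 1
  have h2 := h 2
  simp only [Fin.isValue, Fin.val_zero, pow_zero, one_smul, Fin.val_one, pow_one,
    Fin.val_two, even_two, Even.neg_pow, one_pow]
  erw [h0, h1, h2]
  rw [sub_eq_add_neg, neg_one_zsmul]
  rfl

/-- Triangles generate the 2-chains, so a homomorphism on 1-chains descends to homology once its
values on the three sides of each triangle cancel. -/
theorem addHom_comp_d_eq_zero {A : Type} [AddCommGroup A]
    (L : (singularChains Y).X 1 →+ A)
    (h : ∀ T : C(stdSimplex ℝ (Fin 3), Y), L (pathChain (T.comp (edge 1 2)))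
      - L (pathChain (T.comp (edge 0 2))) + L (pathChain (T.comp (edge 0 1))) = 0) :
    ∀ b, L (((singularChains Y).d 2 1).hom b) = 0 := by
  suffices L.comp ((singularChains Y).d 2 1).hom.toAddMonoidHom = 0 from
    fun b => congrArg (fun φ => φ b) this
  refine addHom_ext_simplexChain fun s => ?_
  rw [← simplexOfMap_toMap s]
  have := congrArg L (d_triangleChain (Simplex.toMap s))
  rw [map_add, map_sub, h] at this
  exact this

/-- The homomorphism is the additive extension of `f` to 0-chains. It turns the vanishing of the
boundary of a cycle into a cancellation of values of `f` at end points. -/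
theorem exists_addHom_d_pathChain {A : Type} [AddCommGroup A] (f : Y → A) :
    ∃ L : (singularChains Y).X 0 →+ A, ∀ σ,
      L (((singularChains Y).d 1 0).hom (pathChain σ)) = f (σ 1) - f (σ 0) := by
  obtain ⟨L, hL⟩ := exists_addHom_simplexChain (Y := Y) (n := 0) (A := A) fun s =>
    f (Simplex.toMap s (stdSimplex.vertex 0))
  refine ⟨L, fun σ => ?_⟩
  rw [pathChain_eq, (d_simplexChain _).trans (Fin.sum_univ_two _), map_add, map_zsmul, map_zsmul,
    hL, hL]
  simp only [toMap_face, toMap_simplexOfMap, stdSimplex.map_vertex]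
  simp only [Fin.val_zero, pow_zero, one_smul, Fin.val_one, pow_one, neg_smul, ← sub_eq_add_neg]
  rfl

/-- The boundary of a cycle, evaluated on a function on points, vanishes. -/
theorem Represents.sum_zsmul_eq_zero {A : Type} [AddCommGroup A] {R : ℕ} {c : Fin R → ℤ}
    {σ : Fin R → C(unitInterval, Y)} {γ : H1 Y} (h : Represents c σ γ) (f : Y → A) :
    ∑ r, c r • (f (σ r 1) - f (σ r 0)) = 0 := by
  obtain ⟨x, hx, -⟩ := h
  have h : ((singularChains Y).d 1 0).hom (∑ r, c r • pathChain (σ r)) = 0 := by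
    rw [← hx]
    exact congrArg (fun φ => φ.hom x) ((singularChains Y).iCycles_d 1 0)
  obtain ⟨L, hL⟩ := exists_addHom_d_pathChain f
  have := congrArg L h
  simpa only [map_sum, map_zsmul, hL, map_zero] using this

theorem Represents.sum_eq_zero {R : ℕ} {c : Fin R → ℤ} {σ : Fin R → C(unitInterval, Y)}
    {γ : H1 Y} (h : Represents c σ γ) (f : Y → ℂ) :
    ∑ r, (c r : ℂ) * (f (σ r 1) - f (σ r 0)) = 0 := by
  simpa using h.sum_zsmul_eq_zero f

theorem Represents.comp {R : ℕ} {c : Fin R → ℤ} {σ : Fin R → C(unitInterval, Y)}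
    {γ : H1 Y} (h : Represents c σ γ) (φ : C(Y, Z)) :
    Represents c (fun r => φ.comp (σ r))
      ((((AlgebraicTopology.singularHomologyFunctor (ModuleCat.{0} ℤ) 1).obj
        (ModuleCat.of ℤ ℤ)).map (TopCat.ofHom φ)).hom γ) := by
  obtain ⟨x, hx, rfl⟩ := h
  let F := ((AlgebraicTopology.singularChainComplexFunctor (ModuleCat.{0} ℤ)).obj
    (ModuleCat.of ℤ ℤ)).map (TopCat.ofHom φ)
  refine ⟨(HomologicalComplex.cyclesMap F 1).hom x, ?_, ?_⟩
  · have h1 := congrArg (fun φ => φ.hom x) (HomologicalComplex.cyclesMap_i F 1)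
    refine h1.trans ?_
    show (F.f 1).hom (((singularChains Y).iCycles 1).hom x) = _
    rw [hx]
    simp only [map_sum, map_zsmul]
    refine Finset.sum_congr rfl fun r _ => ?_
    congr 1
    have h2 := congrArg (fun φ => ModuleCat.Hom.hom φ (1 : ℤ)) (SSet.ι_chainComplexMap_f _ _ (R
        := ModuleCat.of ℤ ℤ)
      (f := TopCat.toSSet.map (TopCat.ofHom φ)) (simplexOfMap (n := 1)
      ((σ r).comp (stdSimplexHomeomorphUnitInterval : C(stdSimplex ℝ (Fin 2), unitInterval)))))
    exact h2
  · have h1 := congrArg (fun φ => φ.hom x) (HomologicalComplex.homologyπ_naturality F 1)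
    exact h1.symm

/-- Adding a boundary to a cycle changes neither the property of being a cycle nor the class. -/
theorem Represents.of_sub_mem_range {R R' : ℕ} {c : Fin R → ℤ} {σ : Fin R → C(unitInterval, Y)}
    {c' : Fin R' → ℤ} {σ' : Fin R' → C(unitInterval, Y)}
    {γ : H1 Y} (h : Represents c σ γ)
    (hb : ∑ r, c' r • pathChain (σ' r) - ∑ r, c r • pathChain (σ r) ∈
      LinearMap.range ((singularChains Y).d 2 1).hom) : Represents c' σ' γ := by
  obtain ⟨x, hx, rfl⟩ := h
  obtain ⟨b, hb⟩ := hb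
  refine ⟨x + ((singularChains Y).toCycles 2 1).hom b, ?_, ?_⟩
  · have := congrArg (fun φ => φ.hom b) ((singularChains Y).toCycles_i 2 1)
    rw [map_add, hx]
    exact (congrArg (_ + ·) (this.trans hb)).trans (by abel)
  · have := congrArg (fun φ => φ.hom b) ((singularChains Y).toCycles_comp_homologyπ 2 1)
    rw [map_add]
    exact (congrArg (_ + ·) this).trans (add_zero _)

theorem exists_sum_zsmul_of_mem_closure {G ι : Type*} [AddCommGroup G] (f : ι → G) (S : Set ι)
    {x : G} (hx : x ∈ AddSubgroup.closure (f '' S)) :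
    ∃ (R : ℕ) (c : Fin R → ℤ) (σ : Fin R → ι), (∀ r, σ r ∈ S) ∧ x = ∑ r, c r • f (σ r) := by
  induction hx using AddSubgroup.closure_induction with
  | mem x hx =>
    obtain ⟨i, hi, rfl⟩ := hx
    exact ⟨1, fun _ => 1, fun _ => i, fun _ => hi, by simp⟩
  | zero => exact ⟨0, Fin.elim0, Fin.elim0, fun r => r.elim0, by simp⟩
  | add x y _ _ hx hy =>
    obtain ⟨R, c, σ, hσ, rfl⟩ := hx
    obtain ⟨R', c', σ', hσ', rfl⟩ := hy
    refine ⟨R + R', Fin.append c c', Fin.append σ σ', fun r => ?_, ?_⟩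
    · induction r using Fin.addCases with
      | left i => simpa using hσ i
      | right i => simpa using hσ' i
    · simp [Fin.sum_univ_add]
  | neg x _ hx =>
    obtain ⟨R, c, σ, hσ, rfl⟩ := hx
    exact ⟨R, fun r => - c r, σ, hσ, by simp⟩

theorem exists_represents (γ : H1 Y) : ∃ (R : ℕ) (c : Fin R → ℤ)
    (σ : Fin R → C(unitInterval, Y)), Represents c σ γ := by
  obtain ⟨x, hx⟩ := (ModuleCat.epi_iff_surjective ((singularChains Y).homologyπ 1)).1
    inferInstance γ
  have h : ((singularChains Y).iCycles 1).hom x ∈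
      AddSubgroup.closure (pathChain (Y := Y) '' Set.univ) := by
    rw [Set.image_univ, closure_range_pathChain]
    trivial
  obtain ⟨R, c, σ, -, h⟩ := exists_sum_zsmul_of_mem_closure _ _ h
  exact ⟨R, c, σ, x, h, hx⟩

/-- As `L` kills boundaries it factors through chains modulo boundaries, and its restriction to
homology computes both sums. -/
theorem Represents.addHom_eq {A : Type} [AddCommGroup A]
    {L : (singularChains Y).X 1 →+ A}
    (hL : ∀ b, L (((singularChains Y).d 2 1).hom b) = 0) {R R' : ℕ} {c : Fin R → ℤ}
    {σ : Fin R → C(unitInterval, Y)} {c' : Fin R' → ℤ} {σ' : Fin R' → C(unitInterval, Y)}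
    {γ : H1 Y} (h : Represents c σ γ) (h' : Represents c' σ' γ) :
    ∑ r, c r • L (pathChain (σ r)) = ∑ r, c' r • L (pathChain (σ' r)) := by
  let L' : (singularChains Y).X 1 ⟶ ModuleCat.of ℤ A := ModuleCat.ofHom
    { toFun := L, map_add' := L.map_add, map_smul' := fun c x => map_intCast_smul L ℤ ℤ c x }
  have hL' : (singularChains Y).d 2 1 ≫ L' = 0 := by
    ext b
    exact hL b
  let D := (singularChains Y).homologyι 1 ≫ (singularChains Y).descOpcycles L' 2 (by simp) hL'
  have key : (singularChains Y).homologyπ 1 ≫ D = (singularChains Y).iCycles 1 ≫ L' := by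
    simp [D]
  obtain ⟨x, hx, hγ⟩ := h
  obtain ⟨x', hx', hγ'⟩ := h'
  have k (x) : D.hom (((singularChains Y).homologyπ 1).hom x) =
      L (((singularChains Y).iCycles 1).hom x) := congrArg (fun φ => φ.hom x) key
  have k1 := k x
  have k2 := k x'
  rw [hγ, hx] at k1
  rw [hγ', hx'] at k2
  simp only [map_sum, map_zsmul] at k1 k2
  exact k1.symm.trans k2

end SingularChains

/-! ### Integration of local primitives along paths by lifting to a covering space -/

section LocalPrimitives

/-- The complex numbers with the discrete topology. -/
@[ext]
structure DiscreteComplex where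
  /-- The underlying complex number. -/
  val : ℂ

instance : TopologicalSpace DiscreteComplex := ⊥

instance : DiscreteTopology DiscreteComplex := ⟨rfl⟩

/-- Functions on the members of an open cover of `Y` whose differences are locally constant: the
local primitives of a closed differential on `Y`. -/
structure LocalPrimitives (Y : Type) [TopologicalSpace Y] where
  /-- The open neighbourhood of `y` on which `h y` matters. -/
  U : Y → Set Y
  /-- The primitive near `y`. -/
  h : Y → Y → ℂ
  isOpen_U : ∀ y, IsOpen (U y)
  mem_U : ∀ y, y ∈ U y
  eventually_sub_eq : ∀ y y' x, x ∈ U y → x ∈ U y' →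
    ∀ᶠ x' in 𝓝 x, h y x' - h y' x' = h y x - h y' x

namespace LocalPrimitives

variable {Y : Type} [TopologicalSpace Y] (T : LocalPrimitives Y)
variable {X W : Type} [TopologicalSpace X] [TopologicalSpace W]

/-- The function `F` on `X` is, up to locally constant functions, the pull back along `σ` of the
local primitives. -/
def IsAlong (σ : X → Y) (F : X → ℂ) : Prop :=
  ∀ x₀ y, σ x₀ ∈ T.U y → ∀ᶠ x in 𝓝 x₀, F x - T.h y (σ x) = F x₀ - T.h y (σ x₀)

variable {T}

theorem IsAlong.comp {σ : X → Y} {F : X → ℂ} (hF : T.IsAlong σ F) {g : W → X}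
    (hg : Continuous g) : T.IsAlong (σ ∘ g) (F ∘ g) :=
  fun x₀ y hy => hg.continuousAt.eventually (hF (g x₀) y hy)

theorem IsAlong.sub_eq [PreconnectedSpace X] {σ : X → Y} {F F' : X → ℂ}
    (hF : T.IsAlong σ F) (hF' : T.IsAlong σ F') (x x' : X) : F x - F x' = F' x - F' x' := by
  have h : IsLocallyConstant fun x => F x - F' x := by
    rw [IsLocallyConstant.iff_eventually_eq]
    intro x₀
    filter_upwards [hF x₀ _ (T.mem_U _), hF' x₀ _ (T.mem_U _)] with x h1 h2
    linear_combination h1 - h2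
  have := h.apply_eq_of_preconnectedSpace x x'
  linear_combination this

variable (T)

/-- The bundle of primitives, with discrete fibres. -/
def core : FiberBundleCore Y Y DiscreteComplex where
  baseSet := T.U
  isOpen_baseSet := T.isOpen_U
  indexAt := id
  mem_baseSet_at := T.mem_U
  coordChange i j x v := ⟨v.val + T.h i x - T.h j x⟩
  coordChange_self i x _ v := DiscreteComplex.ext (add_sub_cancel_right v.val _)
  continuousOn_coordChange i j := by
    -- The difference of two primitives is locally constant and the fibre is discrete, so the
    -- coordinate change is locally constant.
    rintro ⟨x, v⟩ ⟨⟨hi, hj⟩, -⟩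
    refine ContinuousAt.continuousWithinAt ?_
    refine tendsto_nhds_of_eventually_eq ?_
    rw [nhds_prod_eq, nhds_discrete DiscreteComplex]
    have : ∀ᶠ p in 𝓝 x ×ˢ pure v, (T.h i p.1 - T.h j p.1 = T.h i x - T.h j x) ∧ p.2 = v :=
      (T.eventually_sub_eq i j x hi hj).prod_mk (eventually_pure.2 (rfl : v = v) : ∀ᶠ u in pure
          v, u = v)
    filter_upwards [this] with p hp
    rw [hp.2, add_sub_assoc, hp.1, ← add_sub_assoc]
  coordChange_comp i j k x _ v := by
    ext
    show (v.val + T.h i x - T.h j x) + T.h j x - T.h k x = v.val + T.h i x - T.h k x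
    ring

/-- With discrete fibres the bundle of primitives is a covering, so a map from a simply connected,
locally path connected space lifts to it. The lift chooses a primitive at each point continuously.
-/
theorem exists_isAlong [SimplyConnectedSpace X] [LocallyPathConnectedSpace X] (σ : C(X, Y)) :
    ∃ F, T.IsAlong σ F := by
  have cov : IsCoveringMap (Bundle.TotalSpace.proj : T.core.TotalSpace → Y) :=
    FiberBundle.isCoveringMap
  obtain ⟨x₀⟩ : Nonempty X := inferInstance
  obtain ⟨G, ⟨-, hG⟩, -⟩ := cov.existsUnique_continuousMap_lifts σ x₀
    (⟨σ x₀, (⟨0⟩ : DiscreteComplex)⟩ : T.core.TotalSpace) rfl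
  have hp (x : X) : (G x).proj = σ x := congrFun hG x
  -- A point with coordinate `v` in the trivialization of index `y` stands for the primitive `v + h
  -- y`. The coordinate changes leave its value at the base point unchanged, and here it is read
  -- with the base point as index.
  refine ⟨fun x => DiscreteComplex.val (G x).snd + T.h (G x).proj (G x).proj, fun x₁ y hy => ?_⟩
  have hs : G x₁ ∈ (T.core.localTriv y).source := by
    rw [FiberBundleCore.mem_localTriv_source, ← FiberBundleCore.baseSet_at, hp]
    exact hy
  have hc : ContinuousAt (fun x => (T.core.localTriv y (G x)).2) x₁ :=
    continuous_snd.continuousAt.comp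
      (((T.core.localTriv y).continuousAt hs).comp G.continuous.continuousAt)
  have := hc.eventually (by rw [nhds_discrete]; exact eventually_pure.2 rfl :
    ∀ᶠ v in 𝓝 (T.core.localTriv y (G x₁)).2, v = (T.core.localTriv y (G x₁)).2)
  filter_upwards [this] with x hx
  have hx' : (DiscreteComplex.val (G x).snd + T.h (G x).proj (G x).proj - T.h y (G x).proj : ℂ) =
    DiscreteComplex.val (G x₁).snd + T.h (G x₁).proj (G x₁).proj - T.h y (G x₁).proj :=
    congrArg DiscreteComplex.val hx
  rw [hp, hp] at hx'
  rw [hp, hp]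
  exact hx'

instance : SimplyConnectedSpace unitInterval :=
  haveI : ContractibleSpace unitInterval := (convex_Icc (0 : ℝ) 1).contractibleSpace ⟨0, by simp⟩
  inferInstance

instance : LocallyPathConnectedSpace unitInterval := (convex_Icc (0 : ℝ)
    1).locallyPathConnectedSpace

instance : SimplyConnectedSpace (unitInterval × unitInterval) :=
  haveI : ContractibleSpace unitInterval := (convex_Icc (0 : ℝ) 1).contractibleSpace ⟨0, by simp⟩
  inferInstance

instance : SimplyConnectedSpace (stdSimplex ℝ (Fin 3)) :=
  haveI : ContractibleSpace (stdSimplex ℝ (Fin 3)) :=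
    (convex_stdSimplex ℝ (Fin 3)).contractibleSpace ⟨_, single_mem_stdSimplex ℝ 0⟩
  inferInstance

instance : LocallyPathConnectedSpace (stdSimplex ℝ (Fin 3)) :=
  (convex_stdSimplex ℝ (Fin 3)).locallyPathConnectedSpace

/-- The integral along a path. -/
def integral (σ : C(unitInterval, Y)) : ℂ :=
  (T.exists_isAlong σ).choose 1 - (T.exists_isAlong σ).choose 0

variable {T}

theorem IsAlong.integral_eq {σ : C(unitInterval, Y)} {F : unitInterval → ℂ} (hF : T.IsAlong σ F) :
    T.integral σ = F 1 - F 0 :=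
  (T.exists_isAlong σ).choose_spec.sub_eq hF 1 0

theorem edge_zero {n : ℕ} (v v' : Fin (n + 1)) : edge v v' 0 = stdSimplex.vertex v := by
  apply Subtype.ext
  funext k
  simp [edge]

theorem edge_one {n : ℕ} (v v' : Fin (n + 1)) : edge v v' 1 = stdSimplex.vertex v' := by
  apply Subtype.ext
  funext k
  simp [edge]

-- A primitive along the whole triangle exists, and the three differences of its values at the
-- vertices cancel.
variable (T) in
theorem integral_boundary (S : C(stdSimplex ℝ (Fin 3), Y)) :
    T.integral (S.comp (edge 1 2)) - T.integral (S.comp (edge 0 2))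
      + T.integral (S.comp (edge 0 1)) = 0 := by
  obtain ⟨F, hF⟩ := T.exists_isAlong S
  have h (v v') : T.integral (S.comp (edge v v')) =
      F (stdSimplex.vertex v') - F (stdSimplex.vertex v) := by
    rw [IsAlong.integral_eq (σ := S.comp (edge v v')) (hF.comp (edge v v').continuous)]
    simp [edge_zero, edge_one]
  rw [h, h, h]
  ring

variable (T) in
/-- The integral over a cycle depends only on its homology class. -/
theorem sum_integral_eq {R R' : ℕ} {c : Fin R → ℤ}
    {σ : Fin R → C(unitInterval, Y)} {c' : Fin R' → ℤ} {σ' : Fin R' → C(unitInterval, Y)}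
    {γ : H1 Y} (h : Represents c σ γ) (h' : Represents c' σ' γ) :
    ∑ r, (c r : ℂ) * T.integral (σ r) = ∑ r, (c' r : ℂ) * T.integral (σ' r) := by
  obtain ⟨L, hL⟩ := exists_addHom_pathChain (A := ℂ) T.integral
  have h0 := addHom_comp_d_eq_zero L fun S => by
    rw [hL, hL, hL]
    exact T.integral_boundary S
  simpa [hL] using h.addHom_eq h0 h'

variable (T) in
/-- The integral over a continuously varying cycle is constant. -/
theorem sum_integral_eq_of_homotopy [T2Space Y] {R : ℕ} (c : Fin R → ℤ)
    (K : Fin R → C(unitInterval × unitInterval, Y))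
    (hK : ∀ s, ∀ f : Y → ℂ, ∑ r, (c r : ℂ) * (f (K r (s, 1)) - f (K r (s, 0))) = 0) :
    ∑ r, (c r : ℂ) * T.integral ((K r).comp ⟨fun t => (0, t), by fun_prop⟩) =
    ∑ r, (c r : ℂ) * T.integral ((K r).comp ⟨fun t => (1, t), by fun_prop⟩) := by
  choose F hF using fun r => T.exists_isAlong (K r)
  have h (s r) : T.integral ((K r).comp ⟨fun t => (s, t), by fun_prop⟩) =
      F r (s, 1) - F r (s, 0) :=
    IsAlong.integral_eq (σ := (K r).comp ⟨fun t => (s, t), by fun_prop⟩)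
      ((hF r).comp (g := fun t => (s, t)) (by fun_prop))
  simp only [h]
  have hlc : IsLocallyConstant fun s => ∑ r, (c r : ℂ) * (F r (s, 1) - F r (s, 0)) := by
    rw [IsLocallyConstant.iff_eventually_eq]
    intro s₀
    -- the end points at time `s₀`
    let P : Set Y := Set.range fun e : Fin R × Fin 2 => K e.1 (s₀, if e.2 = 0 then 0 else 1)
    have hPfin : P.Finite := Set.finite_range _
    obtain ⟨V, hV, hVd⟩ := hPfin.t2_separation
    have hend (r : Fin R) (ε : unitInterval) (hε : K r (s₀, ε) ∈ P) :
        ∀ᶠ s in 𝓝 s₀, K r (s, ε) ∈ V (K r (s₀, ε)) ∧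
          F r (s, ε) - T.h (K r (s₀, ε)) (K r (s, ε)) =
            F r (s₀, ε) - T.h (K r (s₀, ε)) (K r (s₀, ε)) := by
      refine Eventually.and ?_ ?_
      · have : ContinuousAt (fun s => K r (s, ε)) s₀ := by fun_prop
        exact this.eventually ((hV _).2.mem_nhds (hV _).1)
      · exact ((hF r).comp (g := fun s => (s, ε)) (by fun_prop)) s₀ _ (T.mem_U _)
    have h0 (r) : K r (s₀, 0) ∈ P := ⟨(r, 0), by simp⟩
    have h1 (r) : K r (s₀, 1) ∈ P := ⟨(r, 1), by simp⟩
    filter_upwards [eventually_all.2 fun r => hend r 0 (h0 r),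
      eventually_all.2 fun r => hend r 1 (h1 r)] with s hs0 hs1
    classical
    -- Disjoint neighbourhoods of the finitely many end points allow the local primitives there to
    -- be combined into one function. Applied to it, the cancellation at end points at the times `s`
    -- and `s₀` shows that the total change of the `F r` is zero.
    let f : Y → ℂ := fun x => if hx : ∃ y ∈ P, x ∈ V y then T.h hx.choose x else 0
    have hf (y) (hy : y ∈ P) (x) (hx : x ∈ V y) : f x = T.h y x := by
      have hex : ∃ y ∈ P, x ∈ V y := ⟨y, hy, hx⟩
      have : hex.choose = y := by
        by_contra hne
        exact Set.disjoint_left.1 (hVd hex.choose_spec.1 hy hne) hex.choose_spec.2 hx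
      simp only [f, dif_pos hex, this]
    have e1 := hK s f
    have e0 := hK s₀ f
    have key (r) : (F r (s, 1) - F r (s, 0)) - (F r (s₀, 1) - F r (s₀, 0)) =
        (f (K r (s, 1)) - f (K r (s, 0))) - (f (K r (s₀, 1)) - f (K r (s₀, 0))) := by
      rw [hf _ (h1 r) _ (hs1 r).1, hf _ (h0 r) _ (hs0 r).1, hf _ (h1 r) _ (hV _).1,
        hf _ (h0 r) _ (hV _).1]
      linear_combination (hs1 r).2 - (hs0 r).2
    rw [← sub_eq_zero, ← Finset.sum_sub_distrib]
    simp only [← mul_sub, key]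
    simp only [mul_sub, Finset.sum_sub_distrib] at e1 e0 ⊢
    linear_combination e1 - e0
  exact hlc.apply_eq_of_preconnectedSpace 0 1

end LocalPrimitives

end LocalPrimitives

/-! ### Homologies between paths, and good representatives of classes -/

section Boundaries

variable {Y : Type} [TopologicalSpace Y]

/-- The group of singular `1`-boundaries. -/
def boundaries (Y : Type) [TopologicalSpace Y] : AddSubgroup ((singularChains Y).X 1) :=
  ((singularChains Y).d 2 1).hom.toAddMonoidHom.range

theorem triangle_mem_boundaries (T : C(stdSimplex ℝ (Fin 3), Y)) :
    pathChain (T.comp (edge 1 2)) - pathChain (T.comp (edge 0 2))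
        + pathChain (T.comp (edge 0 1)) ∈ boundaries Y :=
  ⟨triangleChain T, d_triangleChain T⟩

/-- The boundary of a constant triangle is the constant path minus itself plus itself. -/
theorem pathChain_const_mem_boundaries (y : Y) :
    pathChain (ContinuousMap.const unitInterval y) ∈ boundaries Y := by
  have := triangle_mem_boundaries (ContinuousMap.const _ y)
  simp only [ContinuousMap.const_comp] at this
  simpa using this

/-- Over a square, the two ways around differ by a boundary. -/
theorem square_mem_boundaries (H : C(unitInterval × unitInterval, Y)) :
    pathChain (H.comp ⟨fun t => (0, t), by fun_prop⟩)
      + pathChain (H.comp ⟨fun t => (t, 1), by fun_prop⟩)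
      - pathChain (H.comp ⟨fun t => (1, t), by fun_prop⟩)
      - pathChain (H.comp ⟨fun t => (t, 0), by fun_prop⟩) ∈ boundaries Y := by
  have hsum (x : stdSimplex ℝ (Fin 3)) : x 1 + x 2 ≤ 1 := by
    have h := x.2.2
    rw [Fin.sum_univ_three] at h
    have h0 : 0 ≤ x.1 0 := x.2.1 0
    have : x.1 1 + x.1 2 ≤ 1 := by linarith
    exact this
  have hpos (x : stdSimplex ℝ (Fin 3)) (k) : 0 ≤ x k := x.2.1 k
  -- The maps `(A, B)` and `(B, A)` send the triangle to the two halves of the square. Both send the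
  -- edge from vertex 0 to vertex 2 to the diagonal, which cancels in the difference of the
  -- boundaries.
  let A : C(stdSimplex ℝ (Fin 3), unitInterval) := ⟨fun x => ⟨x 2, hpos x 2, by
    linarith [hsum x, hpos x 1]⟩, by
      exact Continuous.subtype_mk ((continuous_apply 2).comp continuous_subtype_val) _⟩
  let B : C(stdSimplex ℝ (Fin 3), unitInterval) := ⟨fun x => ⟨x 1 + x 2,
    add_nonneg (hpos x 1) (hpos x 2), hsum x⟩, by
      exact Continuous.subtype_mk (((continuous_apply 1).comp continuous_subtype_val).add
        ((continuous_apply 2).comp continuous_subtype_val)) _⟩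
  have hA (v v') (t) : A (edge v v' t) = ((1 - t : ℝ) * (Pi.single v 1 : Fin 3 → ℝ) 2
    + t * (Pi.single v' 1 : Fin 3 → ℝ) 2) := rfl
  have hB (v v') (t) : B (edge v v' t) = ((1 - t : ℝ) * (Pi.single v 1 : Fin 3 → ℝ) 1
    + t * (Pi.single v' 1 : Fin 3 → ℝ) 1) + ((1 - t : ℝ) * (Pi.single v 1 : Fin 3 → ℝ) 2
    + t * (Pi.single v' 1 : Fin 3 → ℝ) 2) := rfl
  have hA01 : A.comp (edge 0 1) = ContinuousMap.const _ 0 := by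
    ext t; simp [hA]
  have hA12 : A.comp (edge 1 2) = ContinuousMap.id _ := by
    ext t; simp [hA]
  have hA02 : A.comp (edge 0 2) = ContinuousMap.id _ := by
    ext t; simp [hA]
  have hB01 : B.comp (edge 0 1) = ContinuousMap.id _ := by
    ext t; simp [hB]
  have hB12 : B.comp (edge 1 2) = ContinuousMap.const _ 1 := by
    ext t; simp [hB]
  have hB02 : B.comp (edge 0 2) = ContinuousMap.id _ := by
    ext t; simp [hB]
  have h1 := triangle_mem_boundaries (H.comp (A.prodMk B))
  have h2 := triangle_mem_boundaries (H.comp (B.prodMk A))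
  have hc (A B : C(stdSimplex ℝ (Fin 3), unitInterval)) (v v') :
      (H.comp (A.prodMk B)).comp (edge v v') =
        H.comp ((A.comp (edge v v')).prodMk (B.comp (edge v v'))) := rfl
  simp only [hc, hA01, hA12, hA02, hB01, hB12, hB02] at h1 h2
  have := sub_mem h1 h2
  convert this using 1
  have e1 : H.comp ⟨fun t => (0, t), by fun_prop⟩ =
    H.comp ((ContinuousMap.const _ 0).prodMk (ContinuousMap.id _)) := rfl
  have e2 : H.comp ⟨fun t => (t, 1), by fun_prop⟩ =
    H.comp ((ContinuousMap.id _).prodMk (ContinuousMap.const _ 1)) := rfl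
  have e3 : H.comp ⟨fun t => (1, t), by fun_prop⟩ =
    H.comp ((ContinuousMap.const _ 1).prodMk (ContinuousMap.id _)) := rfl
  have e4 : H.comp ⟨fun t => (t, 0), by fun_prop⟩ =
    H.comp ((ContinuousMap.id _).prodMk (ContinuousMap.const _ 0)) := rfl
  rw [e1, e2, e3, e4]
  abel

/-- The affine map of the unit interval that sends `0` to `α` and `1` to `β`. -/
def line (α β : unitInterval) : C(unitInterval, unitInterval) where
  toFun t := ⟨(1 - t) * α + t * β, (convex_Icc (0 : ℝ) 1) α.2 β.2
    (unitInterval.one_minus_nonneg t) t.2.1 (by ring)⟩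
  continuous_toFun := by fun_prop

theorem line_zero (α β : unitInterval) : line α β 0 = α := by ext; simp [line]

theorem line_one (α β : unitInterval) : line α β 1 = β := by ext; simp [line]

theorem line_zero_one : line 0 1 = ContinuousMap.id _ := by ext; simp [line]

theorem line_mem_Icc {α β : unitInterval} (h : α ≤ β) (t : unitInterval) :
    line α β t ∈ Set.Icc α β := by
  have h' : (α : ℝ) ≤ β := h
  constructor
  · show (α : ℝ) ≤ (1 - t) * α + t * β
    nlinarith [t.2.1]
  · show (1 - t) * α + t * β ≤ (β : ℝ)
    nlinarith [unitInterval.one_minus_nonneg t]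

/-- The affine map from the triangle to the interval that sends the vertices to the `α k`, in
whatever order these lie, makes the three paths the sides of a singular triangle. -/
theorem line_add_mem_boundaries (σ : C(unitInterval, Y)) (α : Fin 3 → unitInterval) :
    pathChain (σ.comp (line (α 1) (α 2))) - pathChain (σ.comp (line (α 0) (α 2)))
      + pathChain (σ.comp (line (α 0) (α 1))) ∈ boundaries Y := by
  let A : C(stdSimplex ℝ (Fin 3), unitInterval) := ⟨fun x => ⟨∑ k, x.1 k * α k,
    (convex_Icc (0 : ℝ) 1).sum_mem (fun k _ => x.2.1 k) x.2.2 (fun k _ => (α k).2)⟩,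
    Continuous.subtype_mk (continuous_finsetSum _ fun k _ =>
      ((continuous_apply k).comp continuous_subtype_val).mul continuous_const) _⟩
  have hA (v v') (t) : (A (edge v v' t) : ℝ) = ∑ k, ((1 - t : ℝ) * (Pi.single v 1 : Fin 3 → ℝ) k
    + t * (Pi.single v' 1 : Fin 3 → ℝ) k) * α k := rfl
  have hE (v v') : A.comp (edge v v') = line (α v) (α v') := by
    ext t
    rw [ContinuousMap.comp_apply, hA]
    simp [add_mul, Finset.sum_add_distrib, line, Pi.single_apply]
  have := triangle_mem_boundaries (σ.comp A)
  simpa only [ContinuousMap.comp_assoc, hE] using this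

/-- A property of paths that holds locally and is inherited by juxtapositions holds globally. -/
theorem of_local_of_juxtapose (σ : C(unitInterval, Y)) (Q : C(unitInterval, Y) → Prop)
    (hadd : ∀ α₀ α₁ α₂ : unitInterval, Q (σ.comp (line α₀ α₁)) → Q (σ.comp (line α₁ α₂)) →
      Q (σ.comp (line α₀ α₂)))
    (hloc : ∀ t₀, ∃ V : Set unitInterval, IsOpen V ∧ t₀ ∈ V ∧ ∀ α β : unitInterval, α ≤ β →
      Set.Icc α β ⊆ V → Q (σ.comp (line α β))) : Q σ := by
  choose V hV hmem hQ using hloc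
  obtain ⟨t, ht0, hmono, ⟨n, hn⟩, hsub⟩ := exists_monotone_Icc_subset_open_cover_unitInterval
    hV (fun s _ => Set.mem_iUnion.2 ⟨s, hmem s⟩)
  have key : ∀ n, Q (σ.comp (line 0 (t n))) := by
    intro n
    induction n with
    | zero =>
      refine hQ 0 0 (t 0) (by simp) ?_
      rw [ht0]
      simpa using hmem 0
    | succ n ih =>
      obtain ⟨i, hi⟩ := hsub n
      exact hadd _ _ _ ih (hQ i _ _ (hmono (Nat.le_succ n)) hi)
  have := key n
  rw [hn n le_rfl, line_zero_one] at this
  simpa using this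

/-! ### Homologies inside a convex set -/

section Convex

variable {D : Set ℂ} (hD : Convex ℝ D)

/-- The straight path between two points of a convex set. -/
def segmentPath (u v : D) : C(unitInterval, D) where
  toFun t := ⟨(1 - t : ℝ) • (u : ℂ) + (t : ℝ) • (v : ℂ),
    hD u.2 v.2 (unitInterval.one_minus_nonneg t) t.2.1 (by ring)⟩
  continuous_toFun := by fun_prop

theorem segmentPath_self (u : D) : segmentPath hD u u = ContinuousMap.const _ u := by
  ext t
  simp [segmentPath]
  ring

/-- In a convex set, a path is homologous to the straight path with the same end points. -/
theorem mk_pathChain_comp_eq (κ : C(D, Y)) (p : C(unitInterval, D)) :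
    (QuotientAddGroup.mk (pathChain (κ.comp p)) : _ ⧸ boundaries Y) =
      QuotientAddGroup.mk (pathChain (κ.comp (segmentPath hD (p 0) (p 1)))) := by
  -- The straight-line homotopy keeps the end points fixed, so two sides of its square are constant
  -- paths, which are boundaries.
  let H : C(unitInterval × unitInterval, D) :=
    ⟨fun x => ⟨(1 - x.1 : ℝ) • (p x.2 : ℂ) + (x.1 : ℝ) • (segmentPath hD (p 0) (p 1) x.2 : ℂ),
      hD (p x.2).2 (segmentPath hD (p 0) (p 1) x.2).2 (unitInterval.one_minus_nonneg x.1) x.1.2.1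
        (by ring)⟩, by fun_prop⟩
  have h := square_mem_boundaries (κ.comp H)
  have e0 : H.comp ⟨fun t => (0, t), by fun_prop⟩ = p := by
    ext t; simp [H]
  have e1 : H.comp ⟨fun t => (1, t), by fun_prop⟩ = segmentPath hD (p 0) (p 1) := by
    ext t; simp [H]
  have e2 : H.comp ⟨fun t => (t, 1), by fun_prop⟩ = ContinuousMap.const _ (p 1) := by
    ext t; simp [H, segmentPath]; ring
  have e3 : H.comp ⟨fun t => (t, 0), by fun_prop⟩ = ContinuousMap.const _ (p 0) := by
    ext t; simp [H, segmentPath]; ring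
  simp only [ContinuousMap.comp_assoc, e0, e1, e2, e3, ContinuousMap.comp_const] at h
  rw [eq_comm, QuotientAddGroup.eq]
  have h' := add_mem (sub_mem h (pathChain_const_mem_boundaries (κ (p 1))))
    (pathChain_const_mem_boundaries (κ (p 0)))
  convert h' using 1
  abel

/-- The three segments bound the affine triangle spanned by `u`, `v`, `w`, which lies in the convex
set. -/
theorem mk_segmentPath_add (κ : C(D, Y)) (u v w : D) :
    (QuotientAddGroup.mk (pathChain (κ.comp (segmentPath hD u v))) : _ ⧸ boundaries Y) +
      QuotientAddGroup.mk (pathChain (κ.comp (segmentPath hD v w))) =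
      QuotientAddGroup.mk (pathChain (κ.comp (segmentPath hD u w))) := by
  let y : Fin 3 → D := ![u, v, w]
  let A : C(stdSimplex ℝ (Fin 3), D) := ⟨fun x => ⟨∑ k, x.1 k • (y k : ℂ),
    hD.sum_mem (fun k _ => x.2.1 k) x.2.2 (fun k _ => (y k).2)⟩,
    Continuous.subtype_mk (continuous_finsetSum _ fun k _ =>
      ((continuous_apply k).comp continuous_subtype_val).smul continuous_const) _⟩
  have hA (v v') (t) : (A (edge v v' t) : ℂ) = ∑ k, ((1 - t : ℝ) * (Pi.single v 1 : Fin 3 → ℝ) k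
    + t * (Pi.single v' 1 : Fin 3 → ℝ) k) • (y k : ℂ) := rfl
  have hE (v v') : A.comp (edge v v') = segmentPath hD (y v) (y v') := by
    ext t
    rw [ContinuousMap.comp_apply, hA]
    simp [add_smul, -Complex.real_smul, Finset.sum_add_distrib, segmentPath, Pi.single_apply]
  have h := triangle_mem_boundaries (κ.comp A)
  simp only [ContinuousMap.comp_assoc, hE] at h
  rw [eq_comm, ← QuotientAddGroup.mk_add, QuotientAddGroup.eq]
  convert h using 1
  simp only [y, Matrix.cons_val_zero, Matrix.cons_val_one, Matrix.cons_val]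
  abel

end Convex

/-! ### Moving cycles off isolated points and straightening them -/

section GoodPaths

/-- A path in the target of a chart, as a path in its source. -/
theorem exists_comp_eq_of_mem_target (e : OpenPartialHomeomorph ℂ Y) (σ : C(unitInterval, Y))
    (hσ : ∀ t, σ t ∈ e.target) :
    ∃ (p : C(unitInterval, e.source)),
      σ = ContinuousMap.comp ⟨fun u : e.source => e u, e.continuousOn.domRestrict⟩ p := by
  refine ⟨⟨fun t => ⟨e.symm (σ t), e.map_target (hσ t)⟩, ?_⟩, ?_⟩
  · refine Continuous.subtype_mk ?_ _
    exact e.continuousOn_symm.comp_continuous σ.continuous hσ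
  · ext t
    exact (e.right_inv (hσ t)).symm

/-- In a punctured disc any two points are joined by a path. -/
theorem exists_path_punctured_ball {ε : ℝ} (u v : ℂ) (hu : u ∈ Metric.ball 0 ε)
    (hv : v ∈ Metric.ball 0 ε) (hu0 : u ≠ 0) (hv0 : v ≠ 0) :
    ∃ p : C(unitInterval, Metric.ball (0 : ℂ) ε), (p 0 : ℂ) = u ∧ (p 1 : ℂ) = v ∧
      ∀ t, (p t : ℂ) ≠ 0 := by
  rw [mem_ball_zero_iff] at hu hv
  -- Interpolating logarithms gives a path whose modulus is a weighted geometric mean of the two end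
  -- moduli, hence less than `ε`; an exponential is never zero.
  have hmem (t : unitInterval) :
      Complex.exp ((1 - t : ℝ) * Complex.log u + (t : ℝ) * Complex.log v) ∈ Metric.ball 0 ε := by
    rw [mem_ball_zero_iff, Complex.norm_exp]
    have hε : 0 < ε := (norm_nonneg u).trans_lt hu
    rw [← Real.lt_log_iff_exp_lt hε]
    have h1 := Real.log_lt_log (norm_pos_iff.2 hu0) hu
    have h2 := Real.log_lt_log (norm_pos_iff.2 hv0) hv
    have : (((1 - t : ℝ) : ℂ) * Complex.log u + ((t : ℝ) : ℂ) * Complex.log v).re =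
        (1 - t) * Real.log ‖u‖ + t * Real.log ‖v‖ := by
      simp [Complex.log_re, -Complex.ofReal_sub]
    rw [this]
    exact (convex_Iio (Real.log ε)) h1 h2 (unitInterval.one_minus_nonneg t) t.2.1 (by ring)
  refine ⟨⟨fun t => ⟨_, hmem t⟩, Continuous.subtype_mk (by fun_prop) _⟩, ?_, ?_,
    fun t => Complex.exp_ne_zero _⟩
  · simp [Complex.exp_log hu0]
  · simp [Complex.exp_log hv0]

/-- If the points outside `good` are isolated centres of discs, then every homology class is
represented by paths in `good`. -/
theorem exists_represents_good (good : Set Y)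
    (hchart : ∀ P : Y, ∃ ε > 0, ∃ e : OpenPartialHomeomorph ℂ Y, e.source = Metric.ball 0 ε ∧
      e 0 = P ∧ ∀ u ∈ Metric.ball 0 ε, u ≠ 0 → e u ∈ good) (γ : H1 Y) :
    ∃ (R : ℕ) (c : Fin R → ℤ) (σ : Fin R → C(unitInterval, Y)),
      (∀ r t, σ r t ∈ good) ∧ Represents c σ γ := by
  classical
  choose ε hε e hsource he0 hgood using hchart
  have hD (P : Y) : Convex ℝ (e P).source := by rw [hsource]; exact convex_ball _ _
  have h0 (P : Y) : (0 : ℂ) ∈ (e P).source := by rw [hsource]; simpa using hε P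
  have h2 (P : Y) : ((ε P / 2 : ℝ) : ℂ) ∈ (e P).source := by
    rw [hsource, mem_ball_zero_iff, Complex.norm_real, Real.norm_of_nonneg (half_pos (hε P)).le]
    exact half_lt_self (hε P)
  have h2' (P : Y) : ((ε P / 2 : ℝ) : ℂ) ≠ 0 := Complex.ofReal_ne_zero.2 (half_pos (hε P)).ne'
  let κ (P : Y) : C((e P).source, Y) := ⟨fun u => e P u, (e P).continuousOn.domRestrict⟩
  -- A tail for each bad point: a path from it to a nearby good point, the choice `ε P / 2` being an
  -- arbitrary nonzero parameter. Good points need no tail.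
  let τ (P : Y) : (singularChains Y).X 1 := if P ∈ good then 0 else
    pathChain ((κ P).comp (segmentPath (hD P) ⟨0, h0 P⟩ ⟨_, h2 P⟩))
  let S : AddSubgroup ((singularChains Y).X 1) :=
    AddSubgroup.closure (pathChain '' {σ : C(unitInterval, Y) | ∀ t, σ t ∈ good}) ⊔ boundaries Y
  have hBS {x : (singularChains Y).X 1} (hx : x ∈ boundaries Y) : x ∈ S :=
    AddSubgroup.mem_sup_right hx
  have hGS {σ : C(unitInterval, Y)} (hσ : ∀ t, σ t ∈ good) : pathChain σ ∈ S :=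
    AddSubgroup.mem_sup_left (AddSubgroup.subset_closure ⟨σ, hσ, rfl⟩)
  -- A path corrected by the tails at its ends is homologous to a chain of good paths. This is
  -- additive under juxtaposition, as the tails at a common end cancel, so it may be checked on
  -- short pieces inside one chart.
  have key (σ : C(unitInterval, Y)) : pathChain σ + τ (σ 1) - τ (σ 0) ∈ S := by
    refine of_local_of_juxtapose σ (fun σ => pathChain σ + τ (σ 1) - τ (σ 0) ∈ S) ?_ ?_
    · intro α₀ α₁ α₂ h h'
      simp only [ContinuousMap.comp_apply, line_zero, line_one] at h h' ⊢
      have hb := hBS (line_add_mem_boundaries σ ![α₀, α₁, α₂])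
      simp only [Matrix.cons_val_zero, Matrix.cons_val_one, Matrix.cons_val] at hb
      have := sub_mem (add_mem h h') hb
      convert this using 1
      abel
    · intro t₀
      refine ⟨σ ⁻¹' (e (σ t₀)).target, (e (σ t₀)).open_target.preimage σ.continuous, ?_, ?_⟩
      · have := (e (σ t₀)).map_source (h0 _)
        rwa [he0] at this
      intro α β hαβ hsub
      set P := σ t₀
      obtain ⟨p, hp⟩ := exists_comp_eq_of_mem_target (e P) (σ.comp (line α β))
        fun t => hsub (line_mem_Icc hαβ t)
      by_cases hP : P ∈ good
      · have hg (u : (e P).source) : e P u ∈ good := by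
          by_cases hu : (u : ℂ) = 0
          · rw [hu, he0]; exact hP
          · exact hgood P u (hsource P ▸ u.2) hu
        have hσg (t) : (σ.comp (line α β)) t ∈ good := by
          rw [hp]; exact hg _
        have := hGS hσg
        simp only [τ, if_pos (hσg 1), if_pos (hσg 0)]
        simpa using this
      -- The piece may pass through the bad centre. Its ends are pushed off the centre along the
      -- tails and joined by a path in the punctured disc; in the full disc, which is convex, the
      -- two routes are homologous.
      · let star (u : (e P).source) : (e P).source := if (u : ℂ) = 0 then ⟨_, h2 P⟩ else u
        have hstar (u) : (star u : ℂ) ≠ 0 := by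
          by_cases hu : (u : ℂ) = 0
          · simpa only [star, if_pos hu] using h2' P
          · simpa only [star, if_neg hu] using hu
        have hτ (u : (e P).source) : (QuotientAddGroup.mk (τ (e P u)) : _ ⧸ boundaries Y) =
            QuotientAddGroup.mk (pathChain ((κ P).comp (segmentPath (hD P) u (star u)))) := by
          by_cases hu : (u : ℂ) = 0
          · have hu' : u = ⟨0, h0 P⟩ := Subtype.ext hu
            have : e P u = P := by rw [hu, he0]
            rw [this]
            simp only [τ, if_neg hP, star, if_pos hu]
            rw [hu']
          · have : e P u ∈ good := hgood P u (hsource P ▸ u.2) hu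
            simp only [τ, if_pos this, star, if_neg hu]
            rw [segmentPath_self, ContinuousMap.comp_const]
            rw [eq_comm, QuotientAddGroup.mk_zero, QuotientAddGroup.eq_zero_iff]
            exact pathChain_const_mem_boundaries _
        obtain ⟨g, hg0, hg1, hg⟩ := exists_path_punctured_ball (ε := ε P) (star (p 0)) (star (p 1))
          (hsource P ▸ (star (p 0)).2) (hsource P ▸ (star (p 1)).2) (hstar _) (hstar _)
        let g' : C(unitInterval, (e P).source) :=
          ⟨fun t => ⟨g t, by rw [hsource]; exact (g t).2⟩, by fun_prop⟩
        have hg'0 : g' 0 = star (p 0) := Subtype.ext hg0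
        have hg'1 : g' 1 = star (p 1) := Subtype.ext hg1
        have hgS : pathChain ((κ P).comp g') ∈ S :=
          hGS fun t => hgood P _ (g t).2 (hg t)
        have e1 := mk_pathChain_comp_eq (hD P) (κ P) g'
        have e2 := mk_pathChain_comp_eq (hD P) (κ P) p
        rw [hg'0, hg'1] at e1
        have e3 := hτ (p 0)
        have e4 := hτ (p 1)
        have e5 := mk_segmentPath_add (hD P) (κ P) (p 0) (star (p 0)) (star (p 1))
        have e6 := mk_segmentPath_add (hD P) (κ P) (p 0) (p 1) (star (p 1))
        have : (QuotientAddGroup.mk (pathChain ((κ P).comp p) + τ (e P (p 1)) - τ (e P (p 0))) :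
            _ ⧸ boundaries Y) = QuotientAddGroup.mk (pathChain ((κ P).comp g')) := by
          rw [QuotientAddGroup.mk_sub, QuotientAddGroup.mk_add, e2, e3, e4, e1, e6, ← e5]
          abel
        rw [QuotientAddGroup.eq] at this
        have := sub_mem hgS (hBS this)
        rw [hp]
        convert this using 1
        simp only [ContinuousMap.comp_apply, κ]
        abel
  obtain ⟨R, c, σ, hσ⟩ := exists_represents γ
  have hmem : ∑ r, c r • pathChain (σ r) ∈ S := by
    have h1 : ∑ r, c r • (pathChain (σ r) + τ (σ r 1) - τ (σ r 0)) ∈ S :=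
      sum_mem fun r _ => zsmul_mem (key (σ r)) _
    -- The tails contribute the value of a function on points along the boundary of the cycle, hence
    -- nothing in total.
    have h2 := hσ.sum_zsmul_eq_zero τ
    convert h1 using 1
    rw [← add_zero (∑ r, c r • pathChain (σ r)), ← h2, ← Finset.sum_add_distrib]
    refine Finset.sum_congr rfl fun r _ => ?_
    rw [add_sub_assoc, zsmul_add]
  obtain ⟨g, hg, b, hb, hsum⟩ := AddSubgroup.mem_sup.1 hmem
  obtain ⟨R', c', σ', hσ', rfl⟩ := exists_sum_zsmul_of_mem_closure _ _ hg
  refine ⟨R', c', σ', hσ', hσ.of_sub_mem_range ?_⟩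
  rw [← hsum, sub_add_cancel_left]
  exact (boundaries Y).neg_mem hb

/-- If moreover `z` is a coordinate on `good`, then every homology class is represented by paths in
`good` along which `z` is affine and not constant. -/
theorem exists_represents_affine (good : Set Y) (z : Y → ℂ)
    (hchart : ∀ P : Y, ∃ ε > 0, ∃ e : OpenPartialHomeomorph ℂ Y, e.source = Metric.ball 0 ε ∧
      e 0 = P ∧ ∀ u ∈ Metric.ball 0 ε, u ≠ 0 → e u ∈ good)
    (hz : ∀ P ∈ good, ∃ ε > 0, ∃ e : OpenPartialHomeomorph ℂ Y, e.source = Metric.ball 0 ε ∧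
      e 0 = P ∧ ∀ u ∈ Metric.ball 0 ε, e u ∈ good ∧ z (e u) = z P + u) (γ : H1 Y) :
    ∃ (R : ℕ) (c : Fin R → ℤ) (σ : Fin R → C(unitInterval, Y)),
      (∀ r, (∀ t, σ r t ∈ good) ∧ ∃ δ ≠ 0, ∀ t : unitInterval, z (σ r t) = z (σ r 0) + t * δ) ∧
        Represents c σ γ := by
  obtain ⟨R, c, σ, hgood, hσ⟩ := exists_represents_good good hchart γ
  let S : AddSubgroup ((singularChains Y).X 1) :=
    AddSubgroup.closure (pathChain '' {σ : C(unitInterval, Y) | (∀ t, σ t ∈ good) ∧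
      ∃ δ ≠ 0, ∀ t : unitInterval, z (σ t) = z (σ 0) + t * δ}) ⊔ boundaries Y
  have hBS {x : (singularChains Y).X 1} (hx : x ∈ boundaries Y) : x ∈ S :=
    AddSubgroup.mem_sup_right hx
  have key (σ : C(unitInterval, Y)) (hσ : ∀ t, σ t ∈ good) : pathChain σ ∈ S := by
    refine of_local_of_juxtapose σ (fun σ => pathChain σ ∈ S) ?_ ?_
    · intro α₀ α₁ α₂ h h'
      have hb := hBS (line_add_mem_boundaries σ ![α₀, α₁, α₂])
      simp only [Matrix.cons_val_zero, Matrix.cons_val_one, Matrix.cons_val] at hb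
      have := sub_mem (add_mem h h') hb
      convert this using 1
      abel
    · intro t₀
      obtain ⟨ε, hε, e, hsource, he0, he⟩ := hz (σ t₀) (hσ t₀)
      have hD : Convex ℝ e.source := by rw [hsource]; exact convex_ball _ _
      refine ⟨σ ⁻¹' e.target, e.open_target.preimage σ.continuous, ?_, ?_⟩
      · have := e.map_source (x := 0) (by rw [hsource]; simpa using hε)
        rwa [he0] at this
      intro α β hαβ hsub
      obtain ⟨p, hp⟩ := exists_comp_eq_of_mem_target e (σ.comp (line α β))
        fun t => hsub (line_mem_Icc hαβ t)
      have e1 := mk_pathChain_comp_eq hD ⟨fun u => e u, e.continuousOn.domRestrict⟩ p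
      rw [QuotientAddGroup.eq] at e1
      rw [hp]
      suffices h : pathChain (ContinuousMap.comp ⟨fun u : e.source => e u,
          e.continuousOn.domRestrict⟩
          (segmentPath hD (p 0) (p 1))) ∈ S by
        have := sub_mem h (hBS e1)
        convert this using 1
        abel
      -- A constant segment is a boundary and can be dropped; this is what allows `δ ≠ 0`.
      by_cases h01 : p 0 = p 1
      · rw [h01, segmentPath_self, ContinuousMap.comp_const]
        exact hBS (pathChain_const_mem_boundaries _)
      · have hmem (u : e.source) := he u (hsource ▸ u.2)
        refine AddSubgroup.mem_sup_left (AddSubgroup.subset_closure ⟨_, ⟨fun t => ?_, ?_⟩, rfl⟩)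
        · exact (hmem _).1
        · refine ⟨(p 1 : ℂ) - p 0, sub_ne_zero.2 fun h => h01 (Subtype.ext h.symm), fun t => ?_⟩
          show z (e (segmentPath hD (p 0) (p 1) t)) =
            z (e (segmentPath hD (p 0) (p 1) 0)) + t * ((p 1 : ℂ) - p 0)
          rw [(hmem _).2, (hmem _).2]
          simp [segmentPath]
          ring
  have hmem : ∑ r, c r • pathChain (σ r) ∈ S :=
    sum_mem fun r _ => zsmul_mem (key (σ r) (hgood r)) _
  obtain ⟨g, hg, b, hb, hsum⟩ := AddSubgroup.mem_sup.1 hmem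
  obtain ⟨R', c', σ', hσ', rfl⟩ := exists_sum_zsmul_of_mem_closure _ _ hg
  refine ⟨R', c', σ', hσ', hσ.of_sub_mem_range ?_⟩
  rw [← hsum, sub_add_cancel_left]
  exact (boundaries Y).neg_mem hb

end GoodPaths

end Boundaries

/-! ### Topology of the family of surfaces -/

namespace Family

variable {m N : ℕ}

theorem isOpen_iff {U : Set (Family m N)} : IsOpen U ↔
    IsOpen (aff ⁻¹' U : Set (AffineFamily m N)) ∧
      ∀ a ζ, inf a ζ ∈ U → ∃ ε : ℝ, 0 < ε ∧ nhdInf a ζ ε ⊆ U := Iff.rfl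

theorem aff_injective : Function.Injective (aff : AffineFamily m N → Family m N) :=
  fun _ _ h => Family.aff.inj h

theorem isOpenEmbedding_aff : IsOpenEmbedding (aff : AffineFamily m N → Family m N) := by
  refine IsOpenEmbedding.of_continuous_injective_isOpenMap ?_ aff_injective ?_
  · exact continuous_def.2 fun U hU => (isOpen_iff.1 hU).1
  · intro W hW
    refine isOpen_iff.2 ⟨?_, ?_⟩
    · rwa [Set.preimage_image_eq _ aff_injective]
    · rintro a ζ ⟨x, -, hx⟩
      cases hx

theorem inf_mem_nhdInf (a : Fin N → ℂ) (ζ : {ζ : ℂ // ζ ^ Nat.gcd m N = 1}) {ε : ℝ} (hε : 0 < ε) :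
    inf a ζ ∈ nhdInf a ζ ε :=
  ⟨by simpa [base] using hε, Or.inl ⟨a, rfl⟩⟩

theorem inf_mem_nhdInf_iff {a b : Fin N → ℂ} {ζ ξ : {ζ : ℂ // ζ ^ Nat.gcd m N = 1}} {ε : ℝ} :
    inf b ξ ∈ nhdInf a ζ ε ↔ dist b a < ε ∧ ξ = ζ := by
  simp [nhdInf, base]

theorem aff_mem_nhdInf_iff {a : Fin N → ℂ} {x : AffineFamily m N}
    {ζ : {ζ : ℂ // ζ ^ Nat.gcd m N = 1}} {ε : ℝ} :
    aff x ∈ nhdInf a ζ ε ↔ dist x.1.1 a < ε ∧ 1 / ε < ‖x.1.2.1‖ ∧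
        ‖x.1.2.2 ^ (m / Nat.gcd m N) / x.1.2.1 ^ (N / Nat.gcd m N) - (ζ : ℂ)‖ < ε := by
  refine and_congr Iff.rfl ⟨?_, fun h => Or.inr ⟨x, rfl, h⟩⟩
  rintro (⟨b, hb⟩ | ⟨y, hy, h⟩)
  · cases hb
  · cases aff_injective hy
    exact h

theorem isOpen_nhdInf (a : Fin N → ℂ) (ζ : {ζ : ℂ // ζ ^ Nat.gcd m N = 1}) {ε : ℝ} (hε : 0 < ε) :
    IsOpen (nhdInf a ζ ε) := by
  refine isOpen_iff.2 ⟨?_, ?_⟩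
  · have : (aff ⁻¹' nhdInf a ζ ε : Set (AffineFamily m N)) = {x | dist x.1.1 a < ε} ∩
        ({x | 1 / ε < ‖x.1.2.1‖} ∩
        (fun x => ‖x.1.2.2 ^ (m / Nat.gcd m N) / x.1.2.1 ^ (N / Nat.gcd m N) - (ζ : ℂ)‖) ⁻¹'
          Set.Iio ε) := by
      ext x
      exact aff_mem_nhdInf_iff
    rw [this]
    refine (isOpen_lt (by fun_prop) continuous_const).inter ?_
    refine ContinuousOn.isOpen_inter_preimage ?_ (isOpen_lt continuous_const (by fun_prop))
        isOpen_Iio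
    intro x hx
    have hx' : x.1.2.1 ≠ 0 := by
      rw [← norm_pos_iff]
      exact (one_div_pos.2 hε).trans hx
    refine ContinuousAt.continuousWithinAt ?_
    fun_prop (disch := exact pow_ne_zero _ hx')
  · intro b ξ h
    obtain ⟨h1, rfl⟩ := inf_mem_nhdInf_iff.1 h
    have hpos : 0 < ε - dist b a := sub_pos.2 h1
    refine ⟨ε - dist b a, hpos, ?_⟩
    have hle : ε - dist b a ≤ ε := sub_le_self _ dist_nonneg
    rintro P ⟨h2, h3⟩
    refine ⟨?_, (nhdInf_mono b ξ hpos hle ⟨h2, h3⟩).2⟩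
    linarith [dist_triangle P.base b a]

theorem nhds_inf_hasBasis (a : Fin N → ℂ) (ζ : {ζ : ℂ // ζ ^ Nat.gcd m N = 1}) :
    (𝓝 (inf a ζ : Family m N)).HasBasis (fun ε : ℝ => 0 < ε) (nhdInf a ζ) := by
  refine ⟨fun U => ⟨fun hU => ?_, fun ⟨ε, hε, h⟩ => ?_⟩⟩
  · obtain ⟨V, hVU, hV, hmem⟩ := mem_nhds_iff.1 hU
    obtain ⟨ε, hε, h⟩ := (isOpen_iff.1 hV).2 a ζ hmem
    exact ⟨ε, hε, h.trans hVU⟩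
  · exact mem_of_superset ((isOpen_nhdInf a ζ hε).mem_nhds (inf_mem_nhdInf a ζ hε)) h

theorem continuous_base : Continuous (base : Family m N → Fin N → ℂ) := by
  rw [continuous_iff_continuousAt]
  rintro (x | ⟨a, ζ⟩)
  · rw [isOpenEmbedding_aff.continuousAt_iff.symm]
    have : Continuous fun x : AffineFamily m N => x.1.1 := by fun_prop
    exact this.continuousAt
  · rw [ContinuousAt, ((nhds_inf_hasBasis a ζ).tendsto_iff Metric.nhds_basis_ball)]
    exact fun ε hε => ⟨ε, hε, fun P hP => hP.1⟩

/-- Over one parameter, affine points are separated from infinity by the size of `z`, and two points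
at infinity by the limits of `w ^ m₁ / z ^ N₁`. The Hausdorff property is needed to separate end
points of paths when cycles are deformed. -/
instance : T2Space (Family m N) := by
  refine ⟨fun P Q hPQ => ?_⟩
  by_cases hb : P.base = Q.base
  swap
  · obtain ⟨U, V, hU, hV, hPU, hQV, hd⟩ := t2_separation hb
    exact ⟨_, _, hU.preimage continuous_base, hV.preimage continuous_base, hPU, hQV,
      hd.preimage _⟩
  have key (x : AffineFamily m N) (a ζ) : ∃ U V : Set (Family m N), IsOpen U ∧ IsOpen V ∧
      aff x ∈ U ∧ inf a ζ ∈ V ∧ Disjoint U V := by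
    have hC : 0 < ‖x.1.2.1‖ + 1 := by positivity
    refine ⟨aff '' {y | ‖y.1.2.1‖ < ‖x.1.2.1‖ + 1}, nhdInf a ζ (1 / (‖x.1.2.1‖ + 1)), ?_,
      isOpen_nhdInf _ _ (by positivity), ⟨x, by simp, rfl⟩, inf_mem_nhdInf _ _ (by positivity), ?_⟩
    · exact isOpenEmbedding_aff.isOpenMap _ (isOpen_lt (by fun_prop) continuous_const)
    · rw [Set.disjoint_left]
      rintro _ ⟨y, hy, rfl⟩ h
      have := (aff_mem_nhdInf_iff.1 h).2.1
      rw [one_div_one_div] at this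
      exact lt_asymm this hy
  rcases P with x | ⟨a, ζ⟩ <;> rcases Q with y | ⟨b, ξ⟩
  · have hxy : x ≠ y := fun h => hPQ (congrArg _ h)
    obtain ⟨U, V, hU, hV, hPU, hQV, hd⟩ := t2_separation hxy
    refine ⟨aff '' U, aff '' V, isOpenEmbedding_aff.isOpenMap _ hU,
      isOpenEmbedding_aff.isOpenMap _ hV, ⟨x, hPU, rfl⟩, ⟨y, hQV, rfl⟩, ?_⟩
    exact (Set.disjoint_image_iff aff_injective).2 hd
  · exact key x b ξ
  · obtain ⟨U, V, hU, hV, h1, h2, h3⟩ := key y a ζ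
    exact ⟨V, U, hV, hU, h2, h1, h3.symm⟩
  · have hζ : ζ ≠ ξ := by
      rintro rfl
      exact hPQ (congrArg (inf · ζ) hb)
    have hd : 0 < ‖(ζ : ℂ) - ξ‖ / 2 :=
      half_pos (norm_pos_iff.2 (sub_ne_zero.2 fun h => hζ (Subtype.ext h)))
    refine ⟨_, _, isOpen_nhdInf a ζ hd, isOpen_nhdInf b ξ hd, inf_mem_nhdInf _ _ hd,
      inf_mem_nhdInf _ _ hd, ?_⟩
    rw [Set.disjoint_left]
    rintro (y | ⟨c, η⟩) h1 h2
    · have h1 := (aff_mem_nhdInf_iff.1 h1).2.2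
      have h2 := (aff_mem_nhdInf_iff.1 h2).2.2
      set q := y.1.2.2 ^ (m / Nat.gcd m N) / y.1.2.1 ^ (N / Nat.gcd m N)
      have := norm_sub_le (q - (ξ : ℂ)) (q - (ζ : ℂ))
      rw [sub_sub_sub_cancel_left] at this
      linarith
    · exact hζ ((inf_mem_nhdInf_iff.1 h1).2.symm.trans (inf_mem_nhdInf_iff.1 h2).2)

end Family

/-! ### Transport between the surfaces of nearby parameters -/

section Transport

variable {m N : ℕ}

/-- A cut-off function: `1` for `x ≤ δ`, `0` for `2 δ ≤ x`. -/
def cutoff (δ x : ℝ) : ℝ := max 0 (min 1 (2 - x / δ))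

theorem cutoff_of_le {δ x : ℝ} (hδ : 0 < δ) (h : x ≤ δ) : cutoff δ x = 1 := by
  have : x / δ ≤ 1 := (div_le_one hδ).2 h
  rw [cutoff, min_eq_left (by linarith), max_eq_right zero_le_one]

theorem cutoff_of_ge {δ x : ℝ} (hδ : 0 < δ) (h : 2 * δ ≤ x) : cutoff δ x = 0 := by
  have : 2 ≤ x / δ := (le_div_iff₀ hδ).2 h
  rw [cutoff, max_eq_left ((min_le_right _ _).trans (by linarith))]

theorem abs_cutoff_le (δ x : ℝ) : |cutoff δ x| ≤ 1 := by
  rw [abs_of_nonneg (le_max_left _ _)]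
  exact max_le zero_le_one (min_le_left _ _)

theorem continuous_cutoff (δ : ℝ) : Continuous (cutoff δ) := by
  unfold cutoff
  fun_prop

/-- The displacement of the point `z` when the branch points `b` move to `a`. -/
def displacement (δ : ℝ) (b a : Fin N → ℂ) (z : ℂ) : ℂ :=
  ∑ k, (a k - b k) * (cutoff δ ‖z - b k‖ : ℂ)

/-- The quotient `(z' - a_i) / (z - b_i)` where `z'` is the displaced point. -/
def ratio (δ : ℝ) (i : Fin N) (b a : Fin N → ℂ) (z : ℂ) : ℂ :=
  1 + (displacement δ b a z - (a i - b i)) / (z - b i)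

/-- The factor by which `w` changes when the branch points `b` move to `a`. -/
def rootFactor (m : ℕ) (δ : ℝ) (b a : Fin N → ℂ) (z : ℂ) : ℂ :=
  ∏ i, ratio δ i b a z ^ ((m : ℂ)⁻¹)

/-- The radius `r` is so small, in comparison to `δ` and to the distances between the entries of
`a₁`, that branch points can be moved within the ball of radius `r`. -/
structure Admissible (a₁ : Fin N → ℂ) (δ r : ℝ) : Prop where
  pos_δ : 0 < δ
  pos_r : 0 < r
  sep : ∀ i k, i ≠ k → 8 * δ ≤ ‖a₁ i - a₁ k‖
  le : 8 * (N + 1) * r ≤ δ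

theorem exists_admissible (a₁ : Fin N → ℂ) (h : Function.Injective a₁) {δ₀ : ℝ} (hδ₀ : 0 < δ₀) :
    ∃ δ r, δ ≤ δ₀ ∧ Admissible a₁ δ r := by
  obtain ⟨η, hη, hsep⟩ : ∃ η > 0, ∀ i k, i ≠ k → η ≤ ‖a₁ i - a₁ k‖ := by
    classical
    have hfin : (Set.range fun e : {e : Fin N × Fin N // e.1 ≠ e.2} =>
      ‖a₁ e.1.1 - a₁ e.1.2‖).Finite := Set.finite_range _
    have hpos : ∀ᶠ η in 𝓝[>] (0 : ℝ), ∀ e : {e : Fin N × Fin N // e.1 ≠ e.2},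
        η ≤ ‖a₁ e.1.1 - a₁ e.1.2‖ := by
      refine eventually_all.2 fun e => ?_
      have : 0 < ‖a₁ e.1.1 - a₁ e.1.2‖ := norm_pos_iff.2 (sub_ne_zero.2 (h.ne e.2))
      exact mem_nhdsWithin_of_mem_nhds (Iic_mem_nhds this)
    obtain ⟨η, h1, h2⟩ := (hpos.and self_mem_nhdsWithin).exists
    exact ⟨η, h2, fun i k hik => h1 ⟨(i, k), hik⟩⟩
  have hδ : 0 < min δ₀ (η / 8) := lt_min hδ₀ (by positivity)
  refine ⟨min δ₀ (η / 8), min δ₀ (η / 8) / (8 * (N + 1)), min_le_left _ _, hδ, by positivity, ?_,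
      ?_⟩
  · intro i k hik
    linarith [hsep i k hik, min_le_right δ₀ (η / 8)]
  · rw [mul_div_cancel₀ _ (by positivity)]

namespace Admissible

variable {a₁ : Fin N → ℂ} {δ r : ℝ} (hadm : Admissible a₁ δ r) {b a : Fin N → ℂ}
  (hb : b ∈ Metric.ball a₁ r) (ha : a ∈ Metric.ball a₁ r)

include hb

theorem norm_sub_center_lt (k : Fin N) : ‖b k - a₁ k‖ < r :=
  (norm_le_pi_norm (b - a₁) k).trans_lt (mem_ball_iff_norm.1 hb)

include hadm

theorem sep_of_mem {i k : Fin N} (hik : i ≠ k) : 7 * δ ≤ ‖b i - b k‖ := by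
  have h1 := norm_sub_center_lt hb i
  have h2 := norm_sub_center_lt hb k
  have h3 := hadm.sep i k hik
  have h4 : ‖a₁ i - a₁ k‖ ≤ ‖b i - b k‖ + ‖b i - a₁ i‖ + ‖b k - a₁ k‖ := by
    have : a₁ i - a₁ k = (b i - b k) - (b i - a₁ i) + (b k - a₁ k) := by ring
    rw [this]
    exact (norm_add_le _ _).trans (by gcongr; exact norm_sub_le _ _)
  have h5 : 2 * r ≤ δ := by
    have := hadm.le
    have hN : (0 : ℝ) ≤ N := Nat.cast_nonneg N
    nlinarith [hadm.pos_r]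
  linarith

theorem injective : Function.Injective b := by
  intro i k h
  by_contra hik
  have := hadm.sep_of_mem hb hik
  rw [h, sub_self, norm_zero] at this
  linarith [hadm.pos_δ]

/-- Within `δ` of `b i` only the cut-off of index `i` is active, because the other branch points are
at least `7 δ` away from `b i`. So each branch point is carried with a small disc by a rigid
translation. -/
theorem displacement_eq {i : Fin N} {z : ℂ} (hz : ‖z - b i‖ ≤ δ) :
    displacement δ b a z = a i - b i := by
  rw [displacement, Finset.sum_eq_single i]
  · rw [cutoff_of_le hadm.pos_δ hz]
    simp
  · intro k _ hk
    rw [cutoff_of_ge hadm.pos_δ]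
    · simp
    · have h1 := hadm.sep_of_mem hb hk
      have h2 : ‖b k - b i‖ ≤ ‖z - b i‖ + ‖z - b k‖ := by
        have : b k - b i = (z - b i) - (z - b k) := by ring
        rw [this]
        exact norm_sub_le _ _
      linarith [hadm.pos_δ]
  · simp

omit hadm hb in
theorem displacement_eq_zero {z : ℂ} (hδ : 0 < δ) (hz : ∀ k, 2 * δ ≤ ‖z - b k‖) :
    displacement δ b a z = 0 :=
  Finset.sum_eq_zero fun k _ => by rw [cutoff_of_ge hδ (hz k)]; simp

theorem ratio_eq_one {i : Fin N} {z : ℂ} (hz : ‖z - b i‖ ≤ δ) : ratio δ i b a z = 1 := by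
  rw [ratio, hadm.displacement_eq hb hz]
  simp

/-- At `z = b i` the quotient is meaningless, but both sides vanish because the displacement there
is `a i - b i`. -/
theorem sub_mul_ratio (i : Fin N) (z : ℂ) :
    (z - b i) * ratio δ i b a z = z + displacement δ b a z - a i := by
  by_cases hz : z - b i = 0
  · rw [hadm.displacement_eq hb (i := i) (by rw [hz, norm_zero]; exact hadm.pos_δ.le)]
    linear_combination (ratio δ i b a z - 1) * hz
  · rw [ratio, mul_add, mul_div_cancel₀ _ hz]
    ring

include ha

/-- Each of the at most `N + 1` translations involved has length at most `2 r`; the choice of `r`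
makes the total at most `δ / 2`. Divided by `‖z - b i‖ > δ`, this keeps `ratio` within `1 / 2` of
`1`. -/
theorem norm_displacement_sub_le (i : Fin N) (z : ℂ) :
    ‖displacement δ b a z - (a i - b i)‖ ≤ δ / 2 := by
  have h1 (k) : ‖a k - b k‖ ≤ 2 * r := by
    have h1 := norm_sub_center_lt hb k
    have h2 := norm_sub_center_lt ha k
    have : a k - b k = (a k - a₁ k) - (b k - a₁ k) := by ring
    rw [this]
    exact (norm_sub_le _ _).trans (by linarith)
  have h2 : ‖displacement δ b a z‖ ≤ N * (2 * r) := by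
    refine (norm_sum_le _ _).trans ?_
    have : ∀ k ∈ Finset.univ, ‖(a k - b k) * (cutoff δ ‖z - b k‖ : ℂ)‖ ≤ 2 * r := by
      intro k _
      rw [norm_mul, Complex.norm_real, Real.norm_eq_abs]
      exact (mul_le_of_le_one_right (norm_nonneg _) (abs_cutoff_le _ _)).trans (h1 k)
    exact (Finset.sum_le_sum this).trans (by simp)
  have h3 := norm_sub_le (displacement δ b a z) (a i - b i)
  have h4 := h1 i
  have := hadm.le
  have := hadm.pos_δ
  nlinarith [hadm.pos_r]

theorem norm_ratio_sub_one_le (i : Fin N) (z : ℂ) : ‖ratio δ i b a z - 1‖ ≤ 1 / 2 := by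
  by_cases hz : ‖z - b i‖ ≤ δ
  · rw [hadm.ratio_eq_one hb hz]
    norm_num
  · push Not at hz
    rw [ratio, add_sub_cancel_left, norm_div, div_le_iff₀ (hadm.pos_δ.trans hz)]
    linarith [hadm.norm_displacement_sub_le hb ha i z]

/-- This makes the principal `m`-th root in `rootFactor` continuous, so that one sheet is followed
without monodromy. -/
theorem ratio_mem_slitPlane (i : Fin N) (z : ℂ) : ratio δ i b a z ∈ Complex.slitPlane := by
  left
  have h1 := (Complex.abs_re_le_norm _).trans (hadm.norm_ratio_sub_one_le hb ha i z)
  rw [abs_le, Complex.sub_re, Complex.one_re] at h1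
  linarith [h1.1]

theorem rootFactor_ne_zero (z : ℂ) : rootFactor m δ b a z ≠ 0 :=
  Finset.prod_ne_zero_iff.2 fun i _ => by
    rw [Ne, Complex.cpow_eq_zero_iff]
    exact fun h => Complex.slitPlane_ne_zero (hadm.ratio_mem_slitPlane hb ha i z) h.1

omit hadm hb ha in
theorem rootFactor_pow (hm : 0 < m) (z : ℂ) :
    rootFactor m δ b a z ^ m = ∏ i, ratio δ i b a z := by
  rw [rootFactor, ← Finset.prod_pow]
  exact Finset.prod_congr rfl fun i _ => Complex.cpow_nat_inv_pow _ hm.ne'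

-- Multiplying the equation of the curve by the factors `ratio` turns each `z - b i` into the
-- displaced `z` minus `a i`, so the displaced point lies on the new curve.
omit ha in
theorem mul_rootFactor_pow (hm : 0 < m) {z w : ℂ} (h : w ^ m = ∏ i, (z - b i)) :
    (w * rootFactor m δ b a z) ^ m = ∏ i, (z + displacement δ b a z - a i) := by
  rw [mul_pow, rootFactor_pow hm, h, ← Finset.prod_mul_distrib]
  exact Finset.prod_congr rfl fun i _ => hadm.sub_mul_ratio hb i z

-- Near `z = b i` the quotient is an indeterminate `0 / 0`, but `ratio` is identically `1` there,
-- also for nearby parameters.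
omit ha in
theorem continuousAt_ratio (i : Fin N) (z : ℂ) :
    ContinuousAt (fun x : (Fin N → ℂ) × (Fin N → ℂ) × ℂ => ratio δ i x.1 x.2.1 x.2.2)
      (b, a, z) := by
  by_cases hz : z - b i = 0
  · have h1 : ∀ᶠ x : (Fin N → ℂ) × (Fin N → ℂ) × ℂ in 𝓝 (b, a, z), ‖x.2.2 - x.1 i‖ < δ := by
      have : ContinuousAt (fun x : (Fin N → ℂ) × (Fin N → ℂ) × ℂ => ‖x.2.2 - x.1 i‖) (b, a, z) := by
        fun_prop
      refine this.eventually (Iio_mem_nhds ?_)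
      simpa [hz] using hadm.pos_δ
    have h2 : ∀ᶠ x : (Fin N → ℂ) × (Fin N → ℂ) × ℂ in 𝓝 (b, a, z), x.1 ∈ Metric.ball a₁ r :=
      continuous_fst.continuousAt.eventually (Metric.isOpen_ball.mem_nhds hb)
    refine continuousAt_const.congr (f := fun _ => (1 : ℂ)) ?_
    filter_upwards [h1, h2] with x hx1 hx2
    exact (hadm.ratio_eq_one hx2 hx1.le).symm
  · unfold ratio displacement
    have := continuous_cutoff δ
    fun_prop (disch := exact hz)

theorem continuousAt_rootFactor (z : ℂ) :
    ContinuousAt (fun x : (Fin N → ℂ) × (Fin N → ℂ) × ℂ => rootFactor m δ x.1 x.2.1 x.2.2)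
      (b, a, z) := by
  unfold rootFactor
  refine tendsto_finsetProd _ fun i _ => ?_
  exact ContinuousAt.cpow (hadm.continuousAt_ratio hb i z) continuousAt_const
      (hadm.ratio_mem_slitPlane hb ha i z)

omit hadm hb ha in
theorem rootFactor_self (z : ℂ) : rootFactor m δ b b z = 1 := by
  simp [rootFactor, ratio, displacement]

omit hb ha in
/-- Near infinity nothing is displaced, and the root factor tends to `1`. -/
theorem exists_forall_far (M : ℕ) {η : ℝ} (hη : 0 < η) : ∃ C, ∀ z : ℂ, C < ‖z‖ →
    ∀ b ∈ Metric.ball a₁ r, ∀ a ∈ Metric.ball a₁ r,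
      displacement δ b a z = 0 ∧ ‖rootFactor m δ b a z ^ M - 1‖ < η := by
  have hc : ContinuousAt (fun x : Fin N → ℂ => (∏ i, (1 + x i) ^ ((m : ℂ)⁻¹)) ^ M) 0 := by
    refine ContinuousAt.pow (tendsto_finsetProd _ fun i _ => ?_) M
    exact ContinuousAt.cpow (continuous_const.add (continuous_apply i)).continuousAt
      continuousAt_const (by simp)
  obtain ⟨ρ, hρ, h⟩ := Metric.continuousAt_iff.1 hc η hη
  -- This bound puts `z` at distance more than `2 δ + δ / ρ` from every branch point: the first
  -- summand switches off all cut-offs, the second makes the quotients in `ratio` smaller than `ρ`.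
  refine ⟨‖a₁‖ + r + 2 * δ + δ / ρ, fun z hz b hb a ha => ?_⟩
  have hk (k) : 2 * δ + δ / ρ < ‖z - b k‖ := by
    have h1 := norm_sub_center_lt hb k
    have h2 := norm_le_pi_norm a₁ k
    have h3 : ‖z‖ ≤ ‖z - b k‖ + ‖b k - a₁ k‖ + ‖a₁ k‖ := by
      have : z = (z - b k) + (b k - a₁ k) + a₁ k := by ring
      conv_lhs => rw [this]
      exact (norm_add_le _ _).trans (by gcongr; exact norm_add_le _ _)
    linarith
  have hδρ : 0 < δ / ρ := div_pos hadm.pos_δ hρ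
  refine ⟨displacement_eq_zero hadm.pos_δ fun k => by linarith [hk k], ?_⟩
  have := h (x := fun i => (displacement δ b a z - (a i - b i)) / (z - b i)) ?_
  · simpa [dist_eq_norm, rootFactor, ratio] using this
  · rw [dist_zero_right, pi_norm_lt_iff hρ]
    intro i
    have hpos : 0 < ‖z - b i‖ := by linarith [hk i, hadm.pos_δ]
    rw [norm_div, div_lt_iff₀ hpos]
    have h1 := hadm.norm_displacement_sub_le hb ha i z
    have h2 : δ < ρ * ‖z - b i‖ := by
      rw [← div_lt_iff₀' hρ]
      linarith [hk i, hadm.pos_δ]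
    linarith [hadm.pos_δ]

end Admissible

open Classical in
/-- The point of the surface with parameter `a` to which a point moves when the parameter is moved
to `a`. -/
def transport (δ : ℝ) (a : Fin N → ℂ) : Family m N → Family m N
  | .aff x =>
    if h : (x.1.2.2 * rootFactor m δ x.1.1 a x.1.2.1) ^ m =
        ∏ i, (x.1.2.1 + displacement δ x.1.1 a x.1.2.1 - a i) then
      .aff ⟨(a, x.1.2.1 + displacement δ x.1.1 a x.1.2.1,
        x.1.2.2 * rootFactor m δ x.1.1 a x.1.2.1), h⟩
    -- A default value: the equation above holds as soon as the parameter of the point lies in an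
    -- admissible ball.
    else .inf a ⟨1, one_pow _⟩
  | .inf _ ζ => .inf a ζ

theorem base_transport (δ : ℝ) (a : Fin N → ℂ) (P : Family m N) : (transport δ a P).base = a := by
  rcases P with x | ⟨b, ζ⟩
  · rw [transport]
    split_ifs <;> rfl
  · rfl

namespace Admissible

variable {a₁ : Fin N → ℂ} {δ r : ℝ} (hadm : Admissible a₁ δ r) (hm : 0 < m)
include hadm hm

theorem transport_aff (x : AffineFamily m N) (hx : x.1.1 ∈ Metric.ball a₁ r) (a : Fin N → ℂ) :
    transport δ a (.aff x) = .aff ⟨(a, x.1.2.1 + displacement δ x.1.1 a x.1.2.1,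
        x.1.2.2 * rootFactor m δ x.1.1 a x.1.2.1), hadm.mul_rootFactor_pow hx hm x.2⟩ := by
  rw [transport, dif_pos]

theorem transport_self (P : Family m N) (hP : P.base ∈ Metric.ball a₁ r) :
    transport δ P.base P = P := by
  rcases P with x | ⟨b, ζ⟩
  · rw [hadm.transport_aff hm x hP]
    congr 1
    apply Subtype.ext
    simp only [Family.base]
    simp [displacement, rootFactor_self]
  · rfl

theorem isInfinite_transport_iff (P : Family m N) (hP : P.base ∈ Metric.ball a₁ r)
    (a : Fin N → ℂ) : (transport δ a P).IsInfinite ↔ P.IsInfinite := by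
  rcases P with x | ⟨b, ζ⟩
  · rw [hadm.transport_aff hm x hP]
    simp [Family.IsInfinite]
  · simp [Family.IsInfinite, transport]

theorem isBranch_transport_iff (P : Family m N) (hP : P.base ∈ Metric.ball a₁ r)
    (a : Fin N → ℂ) (ha : a ∈ Metric.ball a₁ r) : (transport δ a P).IsBranch ↔ P.IsBranch := by
  rcases P with x | ⟨b, ζ⟩
  · rw [hadm.transport_aff hm x hP]
    have h (y : AffineFamily m N) : (Family.aff y).IsBranch ↔ y.1.2.2 = 0 := by
      constructor
      · rintro ⟨y', h, h'⟩
        cases Family.aff_injective h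
        exact h'
      · exact fun h => ⟨y, rfl, h⟩
    rw [h, h]
    have := hadm.rootFactor_ne_zero (m := m) hP ha x.1.2.1
    simp only [Family.base] at this
    simp [this]
  · simp [Family.IsBranch, transport]

theorem transport_mem_cycleDomain {n : ℤ} {P : Family m N} (hP : P.base ∈ Metric.ball a₁ r)
    {a : Fin N → ℂ} (ha : a ∈ Metric.ball a₁ r) (h : P ∈ cycleDomain m N n) :
    transport δ a P ∈ cycleDomain m N n := by
  unfold cycleDomain at h ⊢
  split_ifs at h ⊢
  · exact fun h' => h ((hadm.isBranch_transport_iff hm P hP a ha).1 h')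
  · trivial
  · exact fun h' => h ((hadm.isInfinite_transport_iff hm P hP a).1 h')

/-- At affine points transport is an explicit continuous formula. Near infinity `z` is not moved and
`w` is multiplied by a factor whose power `m / gcd(m, N)` is close to `1`, so the label `ζ` is kept.
-/
theorem continuousAt_transport (P : Family m N) (hP : P.base ∈ Metric.ball a₁ r) (a : Fin N → ℂ)
    (ha : a ∈ Metric.ball a₁ r) :
    ContinuousAt (fun x : Family m N × (Fin N → ℂ) => transport δ x.2 x.1) (P, a) := by
  rcases P with x | ⟨b, ζ⟩
  · have hemb : IsOpenEmbedding (Prod.map (Family.aff : AffineFamily m N → _)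
        (id : (Fin N → ℂ) → _)) := Family.isOpenEmbedding_aff.prodMap .id
    have : (Family.aff x, a) = Prod.map (Family.aff : AffineFamily m N → _) id (x, a) := rfl
    rw [this, ← hemb.continuousAt_iff]
    let S : Set (AffineFamily m N × (Fin N → ℂ)) :=
      {y | y.1.1.1 ∈ Metric.ball a₁ r ∧ y.2 ∈ Metric.ball a₁ r}
    have hS : IsOpen S := (Metric.isOpen_ball.preimage (by fun_prop)).inter
      (Metric.isOpen_ball.preimage (by fun_prop))
    refine ContinuousOn.continuousAt (s := S) ?_ (hS.mem_nhds ⟨hP, ha⟩)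
    rw [continuousOn_iff_continuous_domRestrict]
    have e : S.domRestrict ((fun x : Family m N × (Fin N → ℂ) => transport δ x.2 x.1) ∘
        Prod.map Family.aff id) = Family.aff ∘ fun y : S => ⟨(y.1.2,
          y.1.1.1.2.1 + displacement δ y.1.1.1.1 y.1.2 y.1.1.1.2.1,
          y.1.1.1.2.2 * rootFactor m δ y.1.1.1.1 y.1.2 y.1.1.1.2.1),
          hadm.mul_rootFactor_pow y.2.1 hm y.1.1.2⟩ := by
      funext y
      exact hadm.transport_aff hm y.1.1 y.2.1 y.1.2
    rw [e]
    refine Family.isOpenEmbedding_aff.continuous.comp (Continuous.subtype_mk ?_ _)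
    have h1 : Continuous fun y : S => rootFactor m δ y.1.1.1.1 y.1.2 y.1.1.1.2.1 := by
      rw [continuous_iff_continuousAt]
      intro y
      exact ContinuousAt.comp (f := fun y : S => (y.1.1.1.1, y.1.2, y.1.1.1.2.1))
        (hadm.continuousAt_rootFactor y.2.1 y.2.2 y.1.1.1.2.1) (by fun_prop)
    have h2 : Continuous fun y : S => displacement δ y.1.1.1.1 y.1.2 y.1.1.1.2.1 := by
      unfold displacement
      have := continuous_cutoff δ
      fun_prop
    fun_prop
  · have h0 : transport δ a (Family.inf b ζ) = Family.inf a ζ := rfl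
    rw [ContinuousAt, nhds_prod_eq, h0]
    rw [((Family.nhds_inf_hasBasis b ζ).prod Metric.nhds_basis_ball).tendsto_iff
      (Family.nhds_inf_hasBasis a ζ)]
    intro ε hε
    obtain ⟨C, hC⟩ := hadm.exists_forall_far (m := m) (m / Nat.gcd m N)
      (show 0 < ε / 8 by positivity)
    obtain ⟨r', hr', hball⟩ := Metric.isOpen_iff.1 Metric.isOpen_ball b hP
    obtain ⟨r'', hr'', hball'⟩ := Metric.isOpen_iff.1 Metric.isOpen_ball a ha
    have hCpos : 0 < |C| + 1 := by positivity
    -- The bound `r'` keeps the parameter in the ball, `1 / (|C| + 1)` forces `‖z‖ > C`, and `1` and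
    -- `ε / 2` serve the final estimate.
    set ρ := min (min r' (ε / 2)) (min 1 (1 / (|C| + 1)))
    have hρ : 0 < ρ := lt_min (lt_min hr' (by positivity)) (lt_min one_pos (by positivity))
    have hρ1 : ρ ≤ r' := (min_le_left _ _).trans (min_le_left _ _)
    have hρ2 : ρ ≤ ε / 2 := (min_le_left _ _).trans (min_le_right _ _)
    have hρ3 : ρ ≤ 1 := (min_le_right _ _).trans (min_le_left _ _)
    have hρ4 : ρ ≤ 1 / (|C| + 1) := (min_le_right _ _).trans (min_le_right _ _)
    refine ⟨(ρ, min ε r''), ⟨hρ, lt_min hε hr''⟩, ?_⟩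
    rintro ⟨Q, c⟩ ⟨hQ, hc⟩
    have hcε : dist c a < ε := (Metric.mem_ball.1 hc).trans_le (min_le_left _ _)
    have hcV : c ∈ Metric.ball a₁ r :=
      hball' ((Metric.mem_ball.1 hc).trans_le (min_le_right _ _))
    rcases Q with y | ⟨d, ξ⟩
    · have hQ' := Family.aff_mem_nhdInf_iff.1 hQ
      have hyV : y.1.1 ∈ Metric.ball a₁ r := hball (hQ'.1.trans_le hρ1)
      show transport δ c (Family.aff y) ∈ _
      rw [hadm.transport_aff hm y hyV, Family.aff_mem_nhdInf_iff]
      have hz : |C| + 1 < ‖y.1.2.1‖ := by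
        refine lt_of_le_of_lt ?_ hQ'.2.1
        rw [le_div_iff₀ hρ, ← le_div_iff₀' hCpos]
        exact hρ4
      obtain ⟨hd, hroot⟩ := hC y.1.2.1 (by linarith [le_abs_self C]) _ hyV _ hcV
      simp only [hd, add_zero]
      refine ⟨hcε, ?_, ?_⟩
      · refine lt_of_le_of_lt ?_ hQ'.2.1
        exact one_div_le_one_div_of_le hρ (by linarith)
      · set q := y.1.2.2 ^ (m / Nat.gcd m N) / y.1.2.1 ^ (N / Nat.gcd m N) with hq
        set R := rootFactor m δ y.1.1 c y.1.2.1
        -- The three terms are bounded by `ε / 2`, `ε / 8` and `ε / 8`.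
        have e : (y.1.2.2 * R) ^ (m / Nat.gcd m N) / y.1.2.1 ^ (N / Nat.gcd m N) - (ζ : ℂ) =
            (q - ζ) + (q - ζ) * (R ^ (m / Nat.gcd m N) - 1)
              + ζ * (R ^ (m / Nat.gcd m N) - 1) := by
          rw [hq, mul_pow]
          ring
        have hζ : ‖(ζ : ℂ)‖ = 1 := Complex.norm_eq_one_of_pow_eq_one ζ.2
          (Nat.gcd_pos_of_pos_left _ hm).ne'
        rw [e]
        have n1 := norm_add_le ((q - ζ) + (q - ζ) * (R ^ (m / Nat.gcd m N) - 1))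
          (ζ * (R ^ (m / Nat.gcd m N) - 1))
        have n2 := norm_add_le (q - ζ) ((q - ζ) * (R ^ (m / Nat.gcd m N) - 1))
        rw [norm_mul, hζ, one_mul] at n1
        rw [norm_mul] at n2
        have n3 : ‖q - ζ‖ < ρ := hQ'.2.2
        have n4 : ‖q - ζ‖ * ‖R ^ (m / Nat.gcd m N) - 1‖ ≤ ‖R ^ (m / Nat.gcd m N) - 1‖ :=
          mul_le_of_le_one_left (norm_nonneg _) (by linarith)
        linarith
    · obtain ⟨-, rfl⟩ := Family.inf_mem_nhdInf_iff.1 hQ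
      exact Family.inf_mem_nhdInf_iff.2 ⟨hcε, rfl⟩

/-- The transport map between the surfaces with parameters `b` and `a`. -/
def transportMap (n : ℤ) {b a : Fin N → ℂ} (hb : b ∈ Metric.ball a₁ r)
    (ha : a ∈ Metric.ball a₁ r) : C(CycleSurface m n b, CycleSurface m n a) where
  toFun P := ⟨⟨transport δ a P.1.1, base_transport _ _ _⟩,
    hadm.transport_mem_cycleDomain hm (by rw [P.1.2]; exact hb) ha P.2⟩
  continuous_toFun := by
    refine Continuous.subtype_mk (Continuous.subtype_mk ?_ _) _
    rw [continuous_iff_continuousAt]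
    intro P
    exact ContinuousAt.comp (f := fun P : CycleSurface m n b => (P.1.1, a))
      (hadm.continuousAt_transport hm P.1.1 (by rw [P.1.2]; exact hb) a ha) (by fun_prop)

end Admissible

end Transport

/-! ### Extension of a homology class to nearby surfaces -/

section Flat

variable {m N : ℕ}

theorem Family.isBranch_aff_iff {x : AffineFamily m N} :
    (Family.aff x).IsBranch ↔ x.1.2.2 = 0 := by
  constructor
  · rintro ⟨y, h, h'⟩
    cases Family.aff_injective h
    exact h'
  · exact fun h => ⟨x, rfl, h⟩

theorem Family.not_isInfinite_aff (x : AffineFamily m N) : ¬ (Family.aff x).IsInfinite := by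
  rintro ⟨_, _, h⟩
  cases h

theorem mem_cycleDomain {P : Family m N} (n : ℤ) (h : ¬ P.IsInfinite) (h' : ¬ P.IsBranch) :
    P ∈ cycleDomain m N n := by
  unfold cycleDomain
  split_ifs
  exacts [h', trivial, h]

/-- This supplies constant paths as default values for parameters outside the ball on which
transport is used. -/
theorem nonempty_cycleSurface (hm : 0 < m) (n : ℤ) (a : Fin N → ℂ) :
    Nonempty (CycleSurface m n a) := by
  obtain ⟨z, hz⟩ := (Set.finite_range a).exists_notMem
  obtain ⟨w, hw⟩ := IsAlgClosed.exists_pow_nat_eq (∏ i, (z - a i)) hm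
  have hw0 : w ≠ 0 := by
    rintro rfl
    rw [zero_pow hm.ne', eq_comm, Finset.prod_eq_zero_iff] at hw
    obtain ⟨i, -, hi⟩ := hw
    exact hz ⟨i, (sub_eq_zero.1 hi).symm⟩
  exact ⟨⟨⟨.aff ⟨(a, z, w), hw⟩, rfl⟩, mem_cycleDomain n (Family.not_isInfinite_aff _)
    fun h => hw0 (Family.isBranch_aff_iff.1 h)⟩⟩

theorem Admissible.transportMap_self {a₁ : Fin N → ℂ} {δ r : ℝ} (hadm : Admissible a₁ δ r)
    (hm : 0 < m) (n : ℤ) {b : Fin N → ℂ} (hb : b ∈ Metric.ball a₁ r) :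
    hadm.transportMap hm n hb hb = ContinuousMap.id _ := by
  ext P
  show transport δ b P.1.1 = P.1.1
  obtain ⟨⟨P, rfl⟩, hP⟩ := P
  exact hadm.transport_self hm P hb

theorem Admissible.continuousOn_transport {a₁ : Fin N → ℂ} {δ r : ℝ} (hadm : Admissible a₁ δ r)
    (hm : 0 < m) : ContinuousOn (fun x : Family m N × (Fin N → ℂ) => transport δ x.2 x.1)
      {x | x.1.base ∈ Metric.ball a₁ r ∧ x.2 ∈ Metric.ball a₁ r} :=
  fun x hx => (hadm.continuousAt_transport hm x.1 hx.1 x.2 hx.2).continuousWithinAt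

/-- Every homology class of one surface belongs to a family of classes of the nearby surfaces that
does not depend on the parameter. -/
theorem exists_isFlat (hm : 0 < m) (n : ℤ) (a₀ : Fin N → ℂ) (ha₀ : Function.Injective a₀) :
    ∃ r > 0, (∀ a ∈ Metric.ball a₀ r, Function.Injective a) ∧
      ∀ γ₀ : H1 (CycleSurface m n a₀), ∃ γ : ∀ a : Fin N → ℂ, H1 (CycleSurface m n a),
        γ a₀ = γ₀ ∧ IsFlat (Metric.ball a₀ r) γ := by
  classical
  obtain ⟨δ, r, -, hadm⟩ := exists_admissible a₀ ha₀ one_pos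
  have h0 : a₀ ∈ Metric.ball a₀ r := Metric.mem_ball_self hadm.pos_r
  refine ⟨r, hadm.pos_r, fun a ha => hadm.injective ha, fun γ₀ => ?_⟩
  -- The class over `a` is the push-forward of `γ₀` under transport; transport from `a₀` to itself
  -- is the identity. Outside the ball the value is immaterial.
  refine ⟨fun a => if ha : a ∈ Metric.ball a₀ r then
    (((AlgebraicTopology.singularHomologyFunctor (ModuleCat.{0} ℤ) 1).obj
        (ModuleCat.of ℤ ℤ)).map (TopCat.ofHom (hadm.transportMap hm n h0 ha))).hom γ₀ else 0, ?_,
            ?_⟩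
  · simp only [dif_pos h0, hadm.transportMap_self hm n h0]
    rw [TopCat.ofHom_id, CategoryTheory.Functor.map_id]
    rfl
  · intro a₁ ha₁
    obtain ⟨R, c, σ, hσ⟩ := exists_represents γ₀
    refine ⟨Metric.ball a₀ r, Metric.isOpen_ball.mem_nhds ha₁, R, c, fun s a =>
      if ha : a ∈ Metric.ball a₀ r then (hadm.transportMap hm n h0 ha).comp (σ s)
      else ContinuousMap.const _ (nonempty_cycleSurface hm n a).some, fun s => ?_, fun a ha => ?_⟩
    · rw [Set.inter_self]
      refine ContinuousOn.congr (f := fun x : (Fin N → ℂ) × unitInterval =>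
        transport δ x.1 (σ s x.2).1.1) ?_ ?_
      · refine (hadm.continuousOn_transport hm).comp
          (f := fun x : (Fin N → ℂ) × unitInterval => ((σ s x.2).1.1, x.1)) (by fun_prop) ?_
        intro x hx
        exact ⟨by rw [(σ s x.2).1.2]; exact h0, hx.1⟩
      · intro x hx
        simp only [dif_pos hx.1]
        rfl
    · rw [Set.inter_self] at ha
      simp only [dif_pos ha]
      exact hσ.comp _

end Flat

/-! ### Primitives in a holomorphic chart: chain rule, uniqueness, behaviour at poles -/

section Charts

variable {m N : ℕ} {a : Fin N → ℂ}

/-- A holomorphic chart of the surface centred at `P`: a disc is mapped homeomorphically onto a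
neighbourhood of `P`, all points other than `P` are affine and not branch points, and `Z`, `W` are
the functions `z`, `w` in the chart. -/
structure PointChart (P : Surface m a) where
  /-- The radius of the disc. -/
  ε : ℝ
  /-- The homeomorphism. -/
  e : OpenPartialHomeomorph ℂ (Surface m a)
  /-- The function `z` in the chart. -/
  Z : ℂ → ℂ
  /-- The function `w` in the chart. -/
  W : ℂ → ℂ
  /-- The derivative of `Z`. -/
  Z' : ℂ → ℂ
  pos : 0 < ε
  source_eq : e.source = Metric.ball 0 ε
  map_zero : e 0 = P
  good : ∀ u ∈ Metric.ball 0 ε, u ≠ 0 → ¬ (e u).1.IsInfinite ∧ ¬ (e u).1.IsBranch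
  z_eq : ∀ u ∈ Metric.ball 0 ε, ¬ (e u).1.IsInfinite → (e u).1.z = Z u
  w_eq : ∀ u ∈ Metric.ball 0 ε, ¬ (e u).1.IsInfinite → (e u).1.w = W u
  deriv : ∀ u ∈ Metric.ball 0 ε, ¬ (e u).1.IsInfinite → ¬ (e u).1.IsBranch →
    HasDerivAt Z (Z' u) u ∧ Z' u ≠ 0

namespace PointChart

variable {P : Surface m a} (c : PointChart P) (i : Fin N) (q : ℤ)

/-- The differential `w ^ q dz / (z - a_i)` in the chart. -/
def form (u : ℂ) : ℂ := c.W u ^ q / (c.Z u - a i) * c.Z' u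

variable {i q}

theorem zero_mem : (0 : ℂ) ∈ Metric.ball 0 c.ε := Metric.mem_ball_self c.pos

theorem mem_target : P ∈ c.e.target := by
  have := c.e.map_source (x := 0) (by rw [c.source_eq]; exact c.zero_mem)
  rwa [c.map_zero] at this

theorem symm_self : c.e.symm P = 0 := by
  have := c.e.left_inv (x := 0) (by rw [c.source_eq]; exact c.zero_mem)
  rwa [c.map_zero] at this

theorem symm_mem {Q : Surface m a} (hQ : Q ∈ c.e.target) : c.e.symm Q ∈ Metric.ball 0 c.ε := by
  have := c.e.map_target hQ
  rwa [c.source_eq] at this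

theorem good_of_mem {Q : Surface m a} (hQ : Q ∈ c.e.target) (hne : Q ≠ P) :
    ¬ Q.1.IsInfinite ∧ ¬ Q.1.IsBranch := by
  have h := c.good _ (c.symm_mem hQ) fun h => hne (by
    rw [← c.e.right_inv hQ, h, c.map_zero])
  rwa [c.e.right_inv hQ] at h

/-- The chain rule `dh/du = (dh/dz) (dz/du)` at the level of difference quotients. The increment of
`Z` can be cancelled because `Z'` is nonzero at `u`. -/
theorem hasDerivAt_comp {U : Set (Surface m a)} {h : Surface m a → ℂ} (hh : IsPrimitive i q U h)
    {u : ℂ} (hu : u ∈ Metric.ball 0 c.ε) (hU : c.e u ∈ U) (h1 : ¬ (c.e u).1.IsInfinite)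
    (h2 : ¬ (c.e u).1.IsBranch) : HasDerivAt (fun u => h (c.e u)) (c.form i q u) u := by
  have hsrc : u ∈ c.e.source := by rwa [c.source_eq]
  have hlim := hh.2 _ hU h1 h2
  rw [c.z_eq u hu h1, c.w_eq u hu h1] at hlim
  obtain ⟨hZ, hZ0⟩ := c.deriv u hu h1 h2
  have hev : ∀ᶠ u' in 𝓝 u, u' ∈ c.e.source := c.e.open_source.mem_nhds hsrc
  have he : Tendsto c.e (𝓝[≠] u) (𝓝[≠] (c.e u)) := by
    refine tendsto_nhdsWithin_iff.2
      ⟨(c.e.continuousAt hsrc).tendsto.mono_left nhdsWithin_le_nhds, ?_⟩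
    filter_upwards [nhdsWithin_le_nhds hev, self_mem_nhdsWithin] with u' hu' hne
    exact fun h => hne (c.e.injOn hu' hsrc h)
  have hfin : ∀ᶠ u' in 𝓝[≠] u, ¬ (c.e u').1.IsInfinite ∧ u' ∈ Metric.ball 0 c.ε := by
    by_cases hu0 : u = 0
    · filter_upwards [nhdsWithin_le_nhds hev, self_mem_nhdsWithin] with u' hu' hne
      rw [c.source_eq] at hu'
      exact ⟨(c.good u' hu' (by rw [← hu0]; exact hne)).1, hu'⟩
    · filter_upwards [nhdsWithin_le_nhds hev, nhdsWithin_le_nhds (isOpen_ne.mem_nhds hu0)]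
        with u' hu' hne
      rw [c.source_eq] at hu'
      exact ⟨(c.good u' hu' hne).1, hu'⟩
  have h3 := (hlim.comp he).mul (hasDerivAt_iff_tendsto_slope.1 hZ)
  rw [hasDerivAt_iff_tendsto_slope]
  refine h3.congr' ?_
  filter_upwards [hZ.eventually_ne (c := c.Z u) hZ0, hfin, self_mem_nhdsWithin] with u' hne hfin
      hne'
  simp only [Function.comp_apply, slope_def_field, c.z_eq u' hfin.2 hfin.1]
  have h4 : c.Z u' - c.Z u ≠ 0 := sub_ne_zero.2 hne
  have h5 : u' - u ≠ 0 := sub_ne_zero.2 hne'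
  field_simp

/-- The converse chain rule, by dividing the slope of `H` by the slope of `Z`. It converts an
antiderivative in the disc into a primitive on the surface. -/
theorem isPrimitive {B : Set ℂ} {H : ℂ → ℂ}
    (hH : ContinuousOn H B)
    (hH' : ∀ u ∈ B, ¬ (c.e u).1.IsInfinite → ¬ (c.e u).1.IsBranch →
      HasDerivAt H (c.form i q u) u) :
    IsPrimitive i q (c.e.target ∩ c.e.symm ⁻¹' B) (fun Q => H (c.e.symm Q)) := by
  refine ⟨hH.comp (c.e.continuousOn_symm.mono Set.inter_subset_left) fun Q hQ => hQ.2, ?_⟩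
  rintro Q ⟨hQ, hQB⟩ h1 h2
  set u := c.e.symm Q with hu
  have hQu : c.e u = Q := c.e.right_inv hQ
  have hub : u ∈ Metric.ball 0 c.ε := c.symm_mem hQ
  rw [← hQu] at h1 h2
  obtain ⟨hZ, hZ0⟩ := c.deriv u hub h1 h2
  have hd := hH' u hQB h1 h2
  have hz : Q.1.z = c.Z u := by rw [← hQu, c.z_eq u hub h1]
  have hw : Q.1.w = c.W u := by rw [← hQu, c.w_eq u hub h1]
  have hs : Tendsto c.e.symm (𝓝[≠] Q) (𝓝[≠] u) := by
    refine tendsto_nhdsWithin_iff.2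
      ⟨(c.e.symm.continuousAt hQ).tendsto.mono_left nhdsWithin_le_nhds, ?_⟩
    filter_upwards [nhdsWithin_le_nhds (c.e.open_target.mem_nhds hQ), self_mem_nhdsWithin]
      with Q' hQ' hne
    exact fun h => hne (c.e.symm.injOn hQ' hQ h)
  have h3 := ((hasDerivAt_iff_tendsto_slope.1 hd).div (hasDerivAt_iff_tendsto_slope.1 hZ)
      hZ0).comp hs
  rw [hz, hw]
  have e1 : c.form i q u / c.Z' u = c.W u ^ q / (c.Z u - a i) := by
    rw [form, mul_div_cancel_right₀ _ hZ0]
  rw [e1] at h3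
  refine h3.congr' ?_
  have hfin : ∀ᶠ Q' in 𝓝[≠] Q, ¬ Q'.1.IsInfinite := by
    by_cases hQP : Q = P
    · filter_upwards [nhdsWithin_le_nhds (c.e.open_target.mem_nhds hQ), self_mem_nhdsWithin]
        with Q' hQ' hne
      exact (c.good_of_mem hQ' (by rw [← hQP]; exact hne)).1
    · have : ∀ᶠ Q' in 𝓝 Q, Q' ≠ P := isOpen_ne.mem_nhds hQP
      filter_upwards [nhdsWithin_le_nhds (c.e.open_target.mem_nhds hQ), nhdsWithin_le_nhds this]
        with Q' hQ' hne
      exact (c.good_of_mem hQ' hne).1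
  filter_upwards [hfin, nhdsWithin_le_nhds (c.e.open_target.mem_nhds hQ), self_mem_nhdsWithin]
    with Q' hfin hQ' hne
  have hz' : Q'.1.z = c.Z (c.e.symm Q') := by
    rw [← c.z_eq _ (c.symm_mem hQ') (by rwa [c.e.right_inv hQ']), c.e.right_inv hQ']
  have hne' : c.e.symm Q' - u ≠ 0 := sub_ne_zero.2 fun h => hne (c.e.symm.injOn hQ' hQ h)
  simp only [Function.comp_apply, Pi.div_apply, slope_def_field, hz']
  rw [div_div_div_cancel_right₀ hne']

/-- Two primitives of the same differential differ by a locally constant function. -/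
theorem eventually_sub_eq (c : PointChart P) {U : Set (Surface m a)} (hU : IsOpen U) (hP : P ∈ U)
    {h h' : Surface m a → ℂ} (hh : IsPrimitive i q U h) (hh' : IsPrimitive i q U h') :
    ∀ᶠ Q in 𝓝 P, h Q - h' Q = h P - h' P := by
  have hsrc : (0 : ℂ) ∈ c.e.source := by rw [c.source_eq]; exact c.zero_mem
  have hev : ∀ᶠ u in 𝓝 (0 : ℂ), u ∈ c.e.source ∧ c.e u ∈ U :=
    (c.e.open_source.mem_nhds hsrc |> Filter.Eventually.and <| (c.e.continuousAt hsrc).eventually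
      (by rw [c.map_zero]; exact hU.mem_nhds hP))
  obtain ⟨ρ, hρ, hball⟩ := Metric.eventually_nhds_iff_ball.1 hev
  have hconst : ∀ u ∈ Metric.ball (0 : ℂ) ρ, h (c.e u) - h' (c.e u) = h P - h' P := by
    intro u hu
    by_cases hu0 : u = 0
    · rw [hu0, c.map_zero]
    have hmem (t : ℝ) (ht : t ∈ Set.Icc (0 : ℝ) 1) :
        ((1 - t : ℝ) : ℂ) * u ∈ Metric.ball (0 : ℂ) ρ := by
      rw [mem_ball_zero_iff] at hu ⊢
      rw [norm_mul, Complex.norm_real, Real.norm_of_nonneg (by linarith [ht.2])]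
      exact (mul_le_of_le_one_left (norm_nonneg _) (by linarith [ht.1])).trans_lt hu
    -- Along the radius the derivative of the difference is known to vanish except at the centre.
    -- The parametrization `(1 - t) u` puts the centre at the right end `t = 1`, where continuity
    -- suffices.
    have key := constant_of_has_deriv_right_zero (a := 0) (b := 1)
      (f := fun t : ℝ => h (c.e (((1 - t : ℝ) : ℂ) * u)) - h' (c.e (((1 - t : ℝ) : ℂ) * u))) ?_ ?_
      1 (by simp)
    · simp only [sub_self, Complex.ofReal_zero, zero_mul, c.map_zero, sub_zero, Complex.ofReal_one,
        one_mul] at key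
      exact key.symm
    · have hc : ContinuousOn (fun t : ℝ => c.e (((1 - t : ℝ) : ℂ) * u)) (Set.Icc 0 1) :=
        c.e.continuousOn.comp (by fun_prop) fun t ht => (hball _ (hmem t ht)).1
      exact (hh.1.comp hc fun t ht => (hball _ (hmem t ht)).2).sub
        (hh'.1.comp hc fun t ht => (hball _ (hmem t ht)).2)
    · intro t ht
      have ht' : t ∈ Set.Icc (0 : ℝ) 1 := ⟨ht.1, ht.2.le⟩
      set v := ((1 - t : ℝ) : ℂ) * u with hv
      have hv0 : v ≠ 0 := mul_ne_zero (Complex.ofReal_ne_zero.2 (by linarith [ht.2])) hu0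
      obtain ⟨hvs, hvU⟩ := hball _ (hmem t ht')
      have hvb : v ∈ Metric.ball 0 c.ε := by rwa [← c.source_eq]
      obtain ⟨g1, g2⟩ := c.good v hvb hv0
      have d := (c.hasDerivAt_comp hh hvb hvU g1 g2).sub (c.hasDerivAt_comp hh' hvb hvU g1 g2)
      rw [sub_self] at d
      have dl : HasDerivAt (fun t : ℝ => ((1 - t : ℝ) : ℂ) * u) (-u) t := by
        have := (((hasDerivAt_id t).const_sub 1).ofReal_comp).mul_const u
        simpa using this
      have := d.scomp t dl
      rw [smul_zero] at this
      exact this.hasDerivWithinAt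
  have hsymm : ∀ᶠ Q in 𝓝 P, c.e.symm Q ∈ Metric.ball (0 : ℂ) ρ := by
    have := c.e.symm.continuousAt (x := P) c.mem_target
    refine this.eventually ?_
    rw [c.symm_self]
    exact Metric.ball_mem_nhds _ hρ
  filter_upwards [hsymm, c.e.open_target.mem_nhds c.mem_target] with Q hQ hQt
  have := hconst _ hQ
  rwa [c.e.right_inv hQt] at this

/-- If the differential is unbounded at `P`, then it has no primitive near `P`. -/
theorem not_isPrimitive (hpole : Tendsto (fun u => ‖c.form i q u‖) (𝓝[≠] 0) atTop)
    {U : Set (Surface m a)} (hU : IsOpen U) (hP : P ∈ U) {h : Surface m a → ℂ} :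
    ¬ IsPrimitive i q U h := by
  intro hh
  have hsrc : (0 : ℂ) ∈ c.e.source := by rw [c.source_eq]; exact c.zero_mem
  have hev : ∀ᶠ u in 𝓝 (0 : ℂ), u ∈ c.e.source ∧ c.e u ∈ U :=
    (c.e.open_source.mem_nhds hsrc |> Filter.Eventually.and <| (c.e.continuousAt hsrc).eventually
      (by rw [c.map_zero]; exact hU.mem_nhds hP))
  obtain ⟨ρ, hρ, hball⟩ := Metric.eventually_nhds_iff_ball.1 hev
  have hd (u) (hu : u ∈ Metric.ball (0 : ℂ) ρ) (hu0 : u ≠ 0) :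
      HasDerivAt (fun u => h (c.e u)) (c.form i q u) u := by
    obtain ⟨hvs, hvU⟩ := hball u hu
    have hvb : u ∈ Metric.ball 0 c.ε := by rwa [← c.source_eq]
    obtain ⟨g1, g2⟩ := c.good u hvb hu0
    exact c.hasDerivAt_comp hh hvb hvU g1 g2
  have hc : ContinuousAt (fun u => h (c.e u)) 0 := by
    have : ContinuousOn (fun u => h (c.e u)) (Metric.ball 0 ρ) :=
      hh.1.comp (c.e.continuousOn.mono fun u hu => (hball u hu).1) fun u hu => (hball u hu).2
    exact this.continuousAt (Metric.ball_mem_nhds _ hρ)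
  -- A primitive is continuous at the centre, so the singularity is removable and its derivative,
  -- which is the form off the centre, has a finite limit.
  have hdiff : DifferentiableOn ℂ (fun u => h (c.e u)) (Metric.ball 0 ρ) :=
    (Complex.differentiableOn_compl_singleton_and_continuousAt_iff
      (Metric.ball_mem_nhds _ hρ)).1 ⟨fun u hu => (hd u hu.1
          hu.2).differentiableAt.differentiableWithinAt, hc⟩
  have hderiv : ContinuousAt (_root_.deriv fun u => h (c.e u)) 0 :=
    (hdiff.deriv Metric.isOpen_ball).continuousOn.continuousAt (Metric.ball_mem_nhds _ hρ)
  have h1 : Tendsto (fun u => ‖_root_.deriv (fun u => h (c.e u)) u‖) (𝓝[≠] 0) atTop := by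
    refine hpole.congr' ?_
    filter_upwards [nhdsWithin_le_nhds (Metric.ball_mem_nhds _ hρ), self_mem_nhdsWithin]
      with u hu hu0
    rw [(hd u hu hu0).deriv]
  exact not_tendsto_nhds_of_tendsto_atTop h1 _ (hderiv.norm.tendsto.mono_left nhdsWithin_le_nhds)

end PointChart

end Charts

/-! ### Points of the affine curve, local roots and isolated roots of unity -/

section Points

variable {m N : ℕ} {a : Fin N → ℂ}

open Classical in
/-- The point `(z, w)` of the affine curve (a point at infinity if the equation does not hold). -/
def mkPoint (m : ℕ) (a : Fin N → ℂ) (z w : ℂ) : Surface m a :=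
  if h : w ^ m = ∏ i, (z - a i) then ⟨.aff ⟨(a, z, w), h⟩, rfl⟩
  else ⟨.inf a ⟨1, one_pow _⟩, rfl⟩

theorem mkPoint_eq {z w : ℂ} (h : w ^ m = ∏ i, (z - a i)) :
    mkPoint m a z w = ⟨.aff ⟨(a, z, w), h⟩, rfl⟩ := dif_pos h

theorem z_mkPoint {z w : ℂ} (h : w ^ m = ∏ i, (z - a i)) : (mkPoint m a z w).1.z = z := by
  rw [mkPoint_eq h]; rfl

theorem w_mkPoint {z w : ℂ} (h : w ^ m = ∏ i, (z - a i)) : (mkPoint m a z w).1.w = w := by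
  rw [mkPoint_eq h]; rfl

theorem not_isInfinite_mkPoint {z w : ℂ} (h : w ^ m = ∏ i, (z - a i)) :
    ¬ (mkPoint m a z w).1.IsInfinite := by
  rw [mkPoint_eq h]; exact Family.not_isInfinite_aff _

theorem isBranch_mkPoint_iff {z w : ℂ} (h : w ^ m = ∏ i, (z - a i)) :
    (mkPoint m a z w).1.IsBranch ↔ w = 0 := by
  rw [mkPoint_eq h]; exact Family.isBranch_aff_iff

theorem w_pow_eq {Q : Surface m a} (h : ¬ Q.1.IsInfinite) :
    Q.1.w ^ m = ∏ i, (Q.1.z - a i) := by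
  obtain ⟨x | ⟨b, ζ⟩, rfl⟩ := Q
  · exact x.2
  · exact absurd ⟨_, _, rfl⟩ h

theorem mkPoint_z_w {Q : Surface m a} (h : ¬ Q.1.IsInfinite) : mkPoint m a Q.1.z Q.1.w = Q := by
  rw [mkPoint_eq (w_pow_eq h)]
  obtain ⟨x | ⟨b, ζ⟩, rfl⟩ := Q
  · rfl
  · exact absurd ⟨_, _, rfl⟩ h

theorem isBranch_iff {Q : Surface m a} (h : ¬ Q.1.IsInfinite) : Q.1.IsBranch ↔ Q.1.w = 0 := by
  rw [← isBranch_mkPoint_iff (w_pow_eq h), mkPoint_z_w h]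

theorem isOpen_not_isInfinite : IsOpen {Q : Surface m a | ¬ Q.1.IsInfinite} := by
  have : {Q : Surface m a | ¬ Q.1.IsInfinite} = Subtype.val ⁻¹' (Set.range Family.aff) := by
    ext ⟨x | ⟨b, ζ⟩, h⟩
    · simpa using Family.not_isInfinite_aff x
    · exact iff_of_false (fun h' => h' ⟨b, ζ, rfl⟩) (by rintro ⟨x, hx⟩; cases hx)
  rw [this]
  exact Family.isOpenEmbedding_aff.isOpen_range.preimage continuous_subtype_val

theorem continuousAt_z {Q : Surface m a} (h : ¬ Q.1.IsInfinite) :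
    ContinuousAt (fun Q : Surface m a => Q.1.z) Q := by
  refine ContinuousAt.comp (f := fun Q : Surface m a => Q.1) (g := Family.z) ?_
    continuous_subtype_val.continuousAt
  obtain ⟨x | ⟨b, ζ⟩, rfl⟩ := Q
  · rw [← Family.isOpenEmbedding_aff.continuousAt_iff]
    have : Continuous fun x : AffineFamily m N => x.1.2.1 := by fun_prop
    exact this.continuousAt
  · exact absurd ⟨_, _, rfl⟩ h

theorem continuousAt_w {Q : Surface m a} (h : ¬ Q.1.IsInfinite) :
    ContinuousAt (fun Q : Surface m a => Q.1.w) Q := by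
  refine ContinuousAt.comp (f := fun Q : Surface m a => Q.1) (g := Family.w) ?_
    continuous_subtype_val.continuousAt
  obtain ⟨x | ⟨b, ζ⟩, rfl⟩ := Q
  · rw [← Family.isOpenEmbedding_aff.continuousAt_iff]
    have : Continuous fun x : AffineFamily m N => x.1.2.2 := by fun_prop
    exact this.continuousAt
  · exact absurd ⟨_, _, rfl⟩ h

theorem continuousOn_mkPoint : ContinuousOn (fun x : ℂ × ℂ => mkPoint m a x.1 x.2)
    {x | x.2 ^ m = ∏ i, (x.1 - a i)} := by
  rw [continuousOn_iff_continuous_domRestrict]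
  have e : Set.domRestrict {x : ℂ × ℂ | x.2 ^ m = ∏ i, (x.1 - a i)}
      (fun x : ℂ × ℂ => mkPoint m a x.1 x.2) =
      fun x => ⟨.aff ⟨(a, x.1.1, x.1.2), x.2⟩, rfl⟩ := by
    funext x
    exact mkPoint_eq x.2
  rw [e]
  refine Continuous.subtype_mk (Family.isOpenEmbedding_aff.continuous.comp (Continuous.subtype_mk
      ?_ _)) _
  fun_prop

/-- The root is `c (g / g z₀) ^ (1 / m)` with the principal power, on a disc where `g / g z₀` stays
in the slit plane. -/
theorem exists_root (hm : 0 < m) {g : ℂ → ℂ} (hg : Differentiable ℂ g) {z₀ c : ℂ}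
    (hc : c ^ m = g z₀) (h0 : g z₀ ≠ 0) : ∃ ε > 0, ∃ ρ : ℂ → ℂ,
      DifferentiableOn ℂ ρ (Metric.ball z₀ ε) ∧ ρ z₀ = c ∧
        ∀ z ∈ Metric.ball z₀ ε, ρ z ≠ 0 ∧ ρ z ^ m = g z := by
  have hc0 : c ≠ 0 := by
    rintro rfl
    exact h0 (by rw [← hc, zero_pow hm.ne'])
  have hs : ∀ᶠ z in 𝓝 z₀, g z / g z₀ ∈ Complex.slitPlane := by
    have : ContinuousAt (fun z => g z / g z₀) z₀ := (hg.continuous.div_const _).continuousAt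
    refine this.eventually (Complex.isOpen_slitPlane.mem_nhds ?_)
    simpa only [div_self h0] using Complex.one_mem_slitPlane
  obtain ⟨ε, hε, hball⟩ := Metric.eventually_nhds_iff_ball.1 hs
  refine ⟨ε, hε, fun z => c * (g z / g z₀) ^ ((m : ℂ)⁻¹), ?_, ?_, fun z hz => ⟨?_, ?_⟩⟩
  · refine DifferentiableOn.const_mul (fun z hz => ?_) c
    exact ((hg.differentiableAt.div_const _).cpow_const (hball z hz)).differentiableWithinAt
  · simp [div_self h0]
  · refine mul_ne_zero hc0 ?_
    rw [Ne, Complex.cpow_eq_zero_iff]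
    exact fun h => Complex.slitPlane_ne_zero (hball z hz) h.1
  · rw [mul_pow, Complex.cpow_nat_inv_pow _ hm.ne', hc, mul_div_cancel₀ _ h0]

/-- There are finitely many `s`-th roots of unity, so `1` is isolated among them. This is how a
branch of the curve is shown to be open. -/
theorem eventually_eq_one_of_pow_eq_one {X : Type*} {l : Filter X} {ξ : X → ℂ} {s : ℕ} (hs : 0 < s)
    (hξ : Tendsto ξ l (𝓝 1)) (h : ∀ᶠ x in l, ξ x ^ s = 1) : ∀ᶠ x in l, ξ x = 1 := by
  have hfin : {ξ : ℂ | ξ ^ s = 1 ∧ ξ ≠ 1}.Finite := by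
    refine (Polynomial.nthRoots s (1 : ℂ)).toFinset.finite_toSet.subset fun ξ hξ => ?_
    simpa [Polynomial.mem_nthRoots hs] using hξ.1
  have : ∀ᶠ y in 𝓝 (1 : ℂ), y ∉ {ξ : ℂ | ξ ^ s = 1 ∧ ξ ≠ 1} :=
    hfin.isClosed.isOpen_compl.mem_nhds (by simp)
  filter_upwards [hξ.eventually this, h] with x h1 h2
  by_contra hne
  exact h1 ⟨h2, hne⟩

end Points

/-! ### Charts at the affine points -/

section AffineCharts

variable {m N : ℕ} {a : Fin N → ℂ}

theorem continuousOn_mkPoint_comp {X : Type*} [TopologicalSpace X] {B : Set X} {Z W : X → ℂ}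
    (hZ : ContinuousOn Z B) (hW : ContinuousOn W B)
    (h : ∀ x ∈ B, W x ^ m = ∏ i, (Z x - a i)) :
    ContinuousOn (fun x => mkPoint m a (Z x) (W x)) B :=
  continuousOn_mkPoint.comp (hZ.prodMk hW) h

/-- At an affine point with `w ≠ 0`, the function `z` gives a chart. -/
theorem exists_pointChart_of_not_isBranch (hm : 0 < m) (P : Surface m a) (h1 : ¬ P.1.IsInfinite)
    (h2 : ¬ P.1.IsBranch) : ∃ c : PointChart P, DifferentiableOn ℂ c.W (Metric.ball 0 c.ε) ∧
      ∀ u ∈ Metric.ball 0 c.ε, ¬ (c.e u).1.IsInfinite ∧ ¬ (c.e u).1.IsBranch ∧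
        c.Z u = P.1.z + u ∧ c.Z' u = 1 ∧ c.W u ≠ 0 ∧ ∀ i, c.Z u - a i ≠ 0 := by
  have hw0 : P.1.w ≠ 0 := fun h => h2 ((isBranch_iff h1).2 h)
  obtain ⟨ε, hε, ρ, hρ, hρ0, hρm⟩ := exists_root hm (g := fun z => ∏ i, (z - a i)) (by fun_prop)
    (w_pow_eq h1) (by rw [← w_pow_eq h1]; exact pow_ne_zero _ hw0)
  have hball {u : ℂ} (hu : u ∈ Metric.ball (0 : ℂ) ε) : P.1.z + u ∈ Metric.ball P.1.z ε := by
    simpa using hu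
  have heq (u : ℂ) (hu : u ∈ Metric.ball (0 : ℂ) ε) :
      ρ (P.1.z + u) ^ m = ∏ i, (P.1.z + u - a i) := (hρm _ (hball hu)).2
  -- The sheet on which `w` is the chosen root `ρ z`.
  let T : Set (Surface m a) := {Q | ¬ Q.1.IsInfinite ∧ Q.1.z ∈ Metric.ball P.1.z ε ∧
    Q.1.w = ρ Q.1.z}
  have hT : IsOpen T := by
    refine isOpen_iff_mem_nhds.2 fun Q ⟨hQ1, hQ2, hQ3⟩ => ?_
    have ev1 : ∀ᶠ Q' in 𝓝 Q, ¬ Q'.1.IsInfinite := isOpen_not_isInfinite.mem_nhds hQ1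
    have ev2 : ∀ᶠ Q' in 𝓝 Q, Q'.1.z ∈ Metric.ball P.1.z ε :=
      (continuousAt_z hQ1).eventually (Metric.isOpen_ball.mem_nhds hQ2)
    -- The quotient `w / ρ z` is an `m`-th root of unity near `Q` and tends to `1`, so it equals `1`
    -- nearby and the sheet is open.
    have hlim : Tendsto (fun Q' : Surface m a => Q'.1.w / ρ Q'.1.z) (𝓝 Q) (𝓝 1) := by
      have hρc : ContinuousAt ρ Q.1.z :=
        (hρ.differentiableAt (Metric.isOpen_ball.mem_nhds hQ2)).continuousAt
      have := (continuousAt_w hQ1).div (ContinuousAt.comp (g := ρ) hρc (continuousAt_z hQ1))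
        (hρm _ hQ2).1
      have e1 : Q.1.w / ρ Q.1.z = 1 := by rw [hQ3, div_self (hρm _ hQ2).1]
      rw [← e1]
      exact this
    have hone := eventually_eq_one_of_pow_eq_one hm hlim (by
      filter_upwards [ev1, ev2] with Q' h1 h2
      rw [div_pow, w_pow_eq h1, (hρm _ h2).2, div_self]
      rw [← (hρm _ h2).2]
      exact pow_ne_zero _ (hρm _ h2).1)
    filter_upwards [ev1, ev2, hone] with Q' h1 h2 h3
    exact ⟨h1, h2, by rwa [div_eq_one_iff_eq (hρm _ h2).1] at h3⟩
  let e : OpenPartialHomeomorph ℂ (Surface m a) :=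
    { toFun := fun u => mkPoint m a (P.1.z + u) (ρ (P.1.z + u))
      invFun := fun Q => Q.1.z - P.1.z
      source := Metric.ball 0 ε
      target := T
      map_source' := fun u hu => by
        refine ⟨not_isInfinite_mkPoint (heq u hu), ?_, ?_⟩
        · rw [z_mkPoint (heq u hu)]; exact hball hu
        · rw [z_mkPoint (heq u hu), w_mkPoint (heq u hu)]
      map_target' := fun Q hQ => by simpa [dist_eq_norm] using hQ.2.1
      left_inv' := fun u hu => by rw [z_mkPoint (heq u hu), add_sub_cancel_left]
      right_inv' := fun Q hQ => by
        rw [add_sub_cancel, ← hQ.2.2, mkPoint_z_w hQ.1]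
      open_source := Metric.isOpen_ball
      open_target := hT
      continuousOn_toFun := continuousOn_mkPoint_comp (by fun_prop)
        (hρ.continuousOn.comp (by fun_prop) fun u hu => hball hu) heq
      continuousOn_invFun := fun Q hQ =>
        ((continuousAt_z hQ.1).sub continuousAt_const).continuousWithinAt }
  have hgood (u) (hu : u ∈ Metric.ball (0 : ℂ) ε) :
      ¬ (e u).1.IsInfinite ∧ ¬ (e u).1.IsBranch :=
    ⟨not_isInfinite_mkPoint (heq u hu),
      fun h => (hρm _ (hball hu)).1 ((isBranch_mkPoint_iff (heq u hu)).1 h)⟩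
  refine ⟨⟨ε, e, fun u => P.1.z + u, fun u => ρ (P.1.z + u), fun _ => 1, hε, rfl, ?_,
    fun u hu _ => hgood u hu, fun u hu _ => z_mkPoint (heq u hu),
    fun u hu _ => w_mkPoint (heq u hu), fun u _ _ _ =>
      ⟨(hasDerivAt_id u).const_add _, one_ne_zero⟩⟩, ?_, fun u hu =>
        ⟨(hgood u hu).1, (hgood u hu).2, rfl, rfl, (hρm _ (hball hu)).1, fun i hi => ?_⟩⟩
  · change mkPoint m a (P.1.z + 0) (ρ (P.1.z + 0)) = P
    rw [add_zero, hρ0, mkPoint_z_w h1]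
  · exact hρ.comp (by fun_prop) fun u hu => hball hu
  · refine pow_ne_zero m (hρm _ (hball hu)).1 ?_
    rw [(hρm _ (hball hu)).2]
    exact Finset.prod_eq_zero (Finset.mem_univ i) hi

/-- At a branch point `(a_k, 0)`, an `m`-th root of `z - a_k` gives a chart. -/
theorem exists_pointChart_of_isBranch (hm : 0 < m) (ha : Function.Injective a) (P : Surface m a)
    (h2 : P.1.IsBranch) : ∃ (c : PointChart P) (k : Fin N) (ρ : ℂ → ℂ),
      DifferentiableOn ℂ ρ (Metric.ball 0 c.ε) ∧
      ∀ u ∈ Metric.ball 0 c.ε, c.Z u = a k + u ^ m ∧ c.Z' u = m * u ^ (m - 1) ∧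
        c.W u = u * ρ u ∧ ρ u ≠ 0 ∧ ∀ i ≠ k, c.Z u - a i ≠ 0 := by
  have h1 : ¬ P.1.IsInfinite := by
    rintro ⟨b, ζ, hb⟩
    obtain ⟨x, hx, -⟩ := h2
    rw [hb] at hx
    cases hx
  have hw0 : P.1.w = 0 := (isBranch_iff h1).1 h2
  obtain ⟨k, hk⟩ : ∃ k, P.1.z = a k := by
    have := w_pow_eq h1
    rw [hw0, zero_pow hm.ne'] at this
    obtain ⟨k, -, hk⟩ := Finset.prod_eq_zero_iff.1 this.symm
    exact ⟨k, sub_eq_zero.1 hk⟩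
  have hg0 : ∏ j ∈ Finset.univ.erase k, (a k - a j) ≠ 0 :=
    Finset.prod_ne_zero_iff.2 fun j hj => sub_ne_zero.2 fun h =>
      (Finset.ne_of_mem_erase hj) (ha h).symm
  obtain ⟨ε₀, hε₀, ρ, hρ, -, hρm⟩ := exists_root hm
    (g := fun z => ∏ j ∈ Finset.univ.erase k, (z - a j)) (z₀ := a k) (by fun_prop)
    (Complex.cpow_nat_inv_pow _ hm.ne') hg0
  have hprod (z : ℂ) : ∏ i, (z - a i) = (z - a k) * ∏ j ∈ Finset.univ.erase k, (z - a j) :=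
    (Finset.mul_prod_erase _ _ (Finset.mem_univ k)).symm
  -- The bound `ε ≤ 1` gives `ε ^ m ≤ ε ≤ ε₀`, so `a k + u ^ m` stays in the domain of `ρ`.
  let ε := min 1 ε₀
  have hε : 0 < ε := lt_min one_pos hε₀
  have hεm : ε ^ m ≤ ε₀ := (pow_le_of_le_one hε.le (min_le_left _ _) hm.ne').trans (min_le_right
      _ _)
  have hball {u : ℂ} (hu : u ∈ Metric.ball (0 : ℂ) ε) :
      a k + u ^ m ∈ Metric.ball (a k) (ε ^ m) := by
    simpa using pow_lt_pow_left₀ (mem_ball_zero_iff.1 hu) (norm_nonneg _) hm.ne'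
  have hsub : Metric.ball (a k) (ε ^ m) ⊆ Metric.ball (a k) ε₀ := Metric.ball_subset_ball hεm
  have heq (u : ℂ) (hu : u ∈ Metric.ball (0 : ℂ) ε) :
      (u * ρ (a k + u ^ m)) ^ m = ∏ i, (a k + u ^ m - a i) := by
    rw [hprod, mul_pow, (hρm _ (hsub (hball hu))).2, add_sub_cancel_left]
  let T : Set (Surface m a) := {Q | ¬ Q.1.IsInfinite ∧ Q.1.z ∈ Metric.ball (a k) (ε ^ m)}
  have hT : IsOpen T := by
    refine isOpen_iff_mem_nhds.2 fun Q ⟨hQ1, hQ2⟩ => ?_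
    exact Filter.inter_mem (isOpen_not_isInfinite.mem_nhds hQ1)
      ((continuousAt_z hQ1).eventually (Metric.isOpen_ball.mem_nhds hQ2))
  -- With `ρ ^ m` the product of the other factors, `u = w / ρ z` satisfies `u ^ m = z - a k`; it is
  -- the inverse coordinate, on all sheets at once.
  have hinv (Q) (hQ : Q ∈ T) : (Q.1.w / ρ Q.1.z) ^ m = Q.1.z - a k := by
    have := (hρm _ (hsub hQ.2))
    rw [div_pow, w_pow_eq hQ.1, hprod, ← this.2, mul_div_cancel_right₀ _ (pow_ne_zero _ this.1)]
  let e : OpenPartialHomeomorph ℂ (Surface m a) :=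
    { toFun := fun u => mkPoint m a (a k + u ^ m) (u * ρ (a k + u ^ m))
      invFun := fun Q => Q.1.w / ρ Q.1.z
      source := Metric.ball 0 ε
      target := T
      map_source' := fun u hu => by
        refine ⟨not_isInfinite_mkPoint (heq u hu), ?_⟩
        rw [z_mkPoint (heq u hu)]; exact hball hu
      map_target' := fun Q hQ => by
        rw [mem_ball_zero_iff]
        refine lt_of_pow_lt_pow_left₀ m hε.le ?_
        rw [← norm_pow, hinv Q hQ]
        exact mem_ball_iff_norm.1 hQ.2
      left_inv' := fun u hu => by
        rw [z_mkPoint (heq u hu), w_mkPoint (heq u hu),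
          mul_div_cancel_right₀ _ (hρm _ (hsub (hball hu))).1]
      right_inv' := fun Q hQ => by
        rw [hinv Q hQ, add_sub_cancel, div_mul_cancel₀ _ (hρm _ (hsub hQ.2)).1, mkPoint_z_w hQ.1]
      open_source := Metric.isOpen_ball
      open_target := hT
      continuousOn_toFun := continuousOn_mkPoint_comp (by fun_prop)
        (continuousOn_id.mul (hρ.continuousOn.comp (by fun_prop) fun u hu => hsub (hball hu))) heq
      continuousOn_invFun := fun Q hQ => by
        have hρc : ContinuousAt ρ Q.1.z :=
          (hρ.differentiableAt (Metric.isOpen_ball.mem_nhds (hsub hQ.2))).continuousAt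
        exact ((continuousAt_w hQ.1).div (ContinuousAt.comp (g := ρ) hρc (continuousAt_z hQ.1))
          (hρm _ (hsub hQ.2)).1).continuousWithinAt }
  have hgood (u) (hu : u ∈ Metric.ball (0 : ℂ) ε) (hu0 : ¬ (e u).1.IsBranch) : u ≠ 0 := by
    rintro rfl
    exact hu0 ((isBranch_mkPoint_iff (heq 0 hu)).2 (zero_mul _))
  refine ⟨⟨ε, e, fun u => a k + u ^ m, fun u => u * ρ (a k + u ^ m), fun u => m * u ^ (m - 1),
    hε, rfl, ?_, fun u hu hu0 => ⟨not_isInfinite_mkPoint (heq u hu), fun h => ?_⟩,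
    fun u hu _ => z_mkPoint (heq u hu), fun u hu _ => w_mkPoint (heq u hu), fun u hu _ hb =>
      ⟨(hasDerivAt_pow m u).const_add _, ?_⟩⟩, k, fun u => ρ (a k + u ^ m), ?_, fun u hu =>
        ⟨rfl, rfl, rfl, (hρm _ (hsub (hball hu))).1, fun i hik hi => ?_⟩⟩
  · change mkPoint m a (a k + 0 ^ m) (0 * ρ (a k + 0 ^ m)) = P
    rw [zero_pow hm.ne', add_zero, zero_mul, ← hk, ← hw0, mkPoint_z_w h1]
  · exact mul_ne_zero hu0 (hρm _ (hsub (hball hu))).1 ((isBranch_mkPoint_iff (heq u hu)).1 h)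
  · exact mul_ne_zero (Nat.cast_ne_zero.2 hm.ne') (pow_ne_zero _ (hgood u hu hb))
  · exact hρ.comp (by fun_prop) fun u hu => hsub (hball hu)
  · refine pow_ne_zero m (hρm _ (hsub (hball hu))).1 ?_
    rw [(hρm _ (hsub (hball hu))).2]
    exact Finset.prod_eq_zero (Finset.mem_erase.2 ⟨hik, Finset.mem_univ i⟩) hi

end AffineCharts

/-! ### Charts at the points at infinity -/

section InfiniteCharts

variable {m N : ℕ} {a : Fin N → ℂ} {ζ : {ζ : ℂ // ζ ^ Nat.gcd m N = 1}}

/-- The point at infinity with label `ζ`. -/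
def infPoint (a : Fin N → ℂ) (ζ : {ζ : ℂ // ζ ^ Nat.gcd m N = 1}) : Surface m a := ⟨.inf a ζ, rfl⟩

theorem exists_eq_infPoint {P : Surface m a} (h : P.1.IsInfinite) : ∃ ζ, P = infPoint a ζ := by
  obtain ⟨P, rfl⟩ := P
  obtain ⟨b, ζ, rfl⟩ := h
  exact ⟨ζ, rfl⟩

theorem isInfinite_infPoint : (infPoint a ζ : Surface m a).1.IsInfinite := ⟨_, _, rfl⟩

theorem nhds_infPoint_hasBasis : (𝓝 (infPoint a ζ : Surface m a)).HasBasis (fun ε : ℝ => 0 < ε)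
    (fun ε => Subtype.val ⁻¹' Family.nhdInf a ζ ε) := by
  rw [nhds_subtype_eq_comap]
  exact (Family.nhds_inf_hasBasis a ζ).comap _

theorem mem_nhdInf_iff {Q : Surface m a} {ε : ℝ} (hε : 0 < ε) (hQ : ¬ Q.1.IsInfinite) :
    Q.1 ∈ Family.nhdInf a ζ ε ↔ 1 / ε < ‖Q.1.z‖ ∧
      ‖Q.1.w ^ (m / Nat.gcd m N) / Q.1.z ^ (N / Nat.gcd m N) - (ζ : ℂ)‖ < ε := by
  obtain ⟨x | ⟨b, ξ⟩, rfl⟩ := Q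
  · refine ⟨?_, fun h => ⟨by simpa using hε, .inr ⟨x, rfl, h⟩⟩⟩
    rintro ⟨-, ⟨b, hb⟩ | ⟨y, hy, h⟩⟩
    · cases hb
    · cases hy
      exact h
  · exact absurd ⟨_, _, rfl⟩ hQ

theorem eq_of_mem_nhdInf {Q : Surface m a} {ε : ℝ} (hQ : Q.1.IsInfinite)
    (h : Q.1 ∈ Family.nhdInf a ζ ε) : Q = infPoint a ζ := by
  obtain ⟨ξ, rfl⟩ := exists_eq_infPoint hQ
  obtain ⟨-, ⟨b, hb⟩ | ⟨y, hy, -⟩⟩ := h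
  · cases hb
    rfl
  · cases hy

theorem z_infPoint : (infPoint a ζ : Surface m a).1.z = 0 := rfl

theorem tendsto_inv_z : Tendsto (fun Q : Surface m a => Q.1.z⁻¹) (𝓝 (infPoint a ζ)) (𝓝 0) := by
  rw [nhds_infPoint_hasBasis.tendsto_iff Metric.nhds_basis_ball]
  refine fun ε hε => ⟨ε, hε, fun Q hQ => ?_⟩
  rw [mem_ball_zero_iff]
  by_cases h : Q.1.IsInfinite
  · rw [eq_of_mem_nhdInf h hQ, z_infPoint, inv_zero, norm_zero]
    exact hε
  · have := ((mem_nhdInf_iff hε h).1 hQ).1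
    rw [norm_inv]
    rw [one_div] at this
    exact inv_lt_of_inv_lt₀ hε this

theorem eventually_not_isInfinite :
    ∀ᶠ Q : Surface m a in 𝓝[≠] (infPoint a ζ), ¬ Q.1.IsInfinite ∧ Q.1.z ≠ 0 := by
  filter_upwards [nhdsWithin_le_nhds (nhds_infPoint_hasBasis.mem_of_mem (one_pos (α := ℝ))),
      self_mem_nhdsWithin] with Q hQ hne
  have h : ¬ Q.1.IsInfinite := fun h => hne (eq_of_mem_nhdInf h hQ)
  refine ⟨h, fun h0 => ?_⟩
  have := ((mem_nhdInf_iff one_pos h).1 hQ).1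
  rw [h0] at this
  norm_num at this

theorem tendsto_quotient : Tendsto
    (fun Q : Surface m a => Q.1.w ^ (m / Nat.gcd m N) / Q.1.z ^ (N / Nat.gcd m N))
    (𝓝[≠] (infPoint a ζ)) (𝓝 ζ) := by
  refine Metric.tendsto_nhds.2 fun ε hε => ?_
  filter_upwards [nhdsWithin_le_nhds (nhds_infPoint_hasBasis.mem_of_mem hε),
    eventually_not_isInfinite] with Q hQ h
  rw [dist_eq_norm]
  exact ((mem_nhdInf_iff hε h.1).1 hQ).2

/-- At a point at infinity, a suitable root of `1 / z` gives a chart. -/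
theorem exists_pointChart_of_isInfinite (hm : 0 < m) (P : Surface m a) (hP : P.1.IsInfinite) :
    ∃ (c : PointChart P) (ρ : ℂ → ℂ), DifferentiableOn ℂ ρ (Metric.ball 0 (c.ε ^ (m / Nat.gcd m
        N))) ∧
      (∀ v ∈ Metric.ball 0 (c.ε ^ (m / Nat.gcd m N)), ρ v ≠ 0 ∧ ∀ i, 1 - a i * v ≠ 0) ∧
      ∀ u ∈ Metric.ball 0 c.ε, u ≠ 0 →
        c.Z u = (u ^ (m / Nat.gcd m N))⁻¹ ∧
        c.Z' u = - (m / Nat.gcd m N : ℕ) * (u ^ (m / Nat.gcd m N + 1))⁻¹ ∧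
        c.W u = ρ (u ^ (m / Nat.gcd m N)) * (u ^ (N / Nat.gcd m N))⁻¹ := by
  set s := Nat.gcd m N with hs
  set M := m / s with hM
  set L := N / s with hL
  obtain ⟨ζ, rfl⟩ := exists_eq_infPoint hP
  have hs0 : 0 < s := Nat.gcd_pos_of_pos_left _ hm
  have hmM : M * s = m := Nat.div_mul_cancel (Nat.gcd_dvd_left m N)
  have hNL : L * s = N := Nat.div_mul_cancel (Nat.gcd_dvd_right m N)
  have hM0 : 0 < M := Nat.pos_of_ne_zero fun h => by simp [h] at hmM; omega
  have hcop : IsCoprime (M : ℤ) (L : ℤ) := Nat.isCoprime_iff_coprime.2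
    (Nat.coprime_div_gcd_div_gcd hs0)
  -- In the coordinate to be built, `u ^ M = 1 / z` and `u ^ L = ρ / w`. Since `α M + β L = 1`, the
  -- inverse must be `(1 / z) ^ α (ρ / w) ^ β`.
  obtain ⟨α, β, hαβ⟩ := hcop
  have hmL : L * m = M * N := by
    rw [← hmM, ← hNL]; ring
  -- The root `ρ` of `∏ (1 - a_i v)` is normalized by `ρ 0 ^ M = ζ`; this selects the point at
  -- infinity with label `ζ`.
  obtain ⟨ε₀, hε₀, ρ, hρ, hρ0, hρm⟩ := exists_root hm (g := fun v => ∏ i, (1 - a i * v)) (z₀ := 0)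
    (c := (ζ : ℂ) ^ ((M : ℂ)⁻¹)) (by fun_prop)
    (by
      have h (c : ℂ) : c ^ m = (c ^ M) ^ s := by rw [← pow_mul, hmM]
      rw [h, Complex.cpow_nat_inv_pow _ hM0.ne', ζ.2]
      simp) (by simp)
  let ε := min 1 ε₀
  have hε : 0 < ε := lt_min one_pos hε₀
  have hεm : ε ^ M ≤ ε₀ := (pow_le_of_le_one hε.le (min_le_left _ _) hM0.ne').trans
    (min_le_right _ _)
  have hsub : Metric.ball (0 : ℂ) (ε ^ M) ⊆ Metric.ball 0 ε₀ := Metric.ball_subset_ball hεm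
  have hball {u : ℂ} (hu : u ∈ Metric.ball (0 : ℂ) ε) : u ^ M ∈ Metric.ball (0 : ℂ) (ε ^ M) := by
    simpa using pow_lt_pow_left₀ (mem_ball_zero_iff.1 hu) (norm_nonneg _) hM0.ne'
  have hρ0M : ρ 0 ^ M = ζ := by rw [hρ0, Complex.cpow_nat_inv_pow _ hM0.ne']
  have hρc : ContinuousAt ρ 0 :=
    (hρ.differentiableAt (Metric.ball_mem_nhds _ hε₀)).continuousAt
  have hprod {z : ℂ} (hz : z ≠ 0) : ∏ i, (z - a i) = z ^ N * ∏ i, (1 - a i * z⁻¹) := by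
    have : z ^ N = ∏ _i : Fin N, z := by simp
    rw [this, ← Finset.prod_mul_distrib]
    refine Finset.prod_congr rfl fun i _ => ?_
    field_simp
  have heq (u : ℂ) (hu : u ∈ Metric.ball (0 : ℂ) ε \ {0}) :
      (ρ (u ^ M) * (u ^ L)⁻¹) ^ m = ∏ i, ((u ^ M)⁻¹ - a i) := by
    rw [hprod (inv_ne_zero (pow_ne_zero _ hu.2)), inv_inv, mul_pow,
      (hρm _ (hsub (hball hu.1))).2, inv_pow, inv_pow, ← pow_mul, ← pow_mul, hmL, mul_comm]
  let A : Set (Surface m a) := {Q | ¬ Q.1.IsInfinite ∧ Q.1.z ≠ 0 ∧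
    Q.1.z⁻¹ ∈ Metric.ball 0 (ε ^ M) ∧ Q.1.w ^ M = ρ Q.1.z⁻¹ ^ M * Q.1.z ^ L}
  -- The `s`-th power of this quotient is `w ^ m / ∏ (z - a_i)`. So the quotient is a root of unity,
  -- and the condition that it be `1`, which defines `A`, is open.
  have hξ {Q : Surface m a} (h1 : ¬ Q.1.IsInfinite) (h2 : Q.1.z ≠ 0)
      (h3 : Q.1.z⁻¹ ∈ Metric.ball 0 (ε ^ M)) :
      (Q.1.w ^ M / (ρ Q.1.z⁻¹ ^ M * Q.1.z ^ L)) ^ s = 1 := by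
    have h4 : ρ Q.1.z⁻¹ ^ m ≠ 0 := pow_ne_zero _ (hρm _ (hsub h3)).1
    rw [div_pow, mul_pow, ← pow_mul, ← pow_mul, ← pow_mul, hmM, hNL, w_pow_eq h1, hprod h2,
      ← (hρm _ (hsub h3)).2, mul_comm, div_self (mul_ne_zero h4 (pow_ne_zero _ h2))]
  have hAopen : IsOpen A := by
    refine isOpen_iff_mem_nhds.2 fun Q ⟨hQ1, hQ2, hQ3, hQ4⟩ => ?_
    have hz := continuousAt_z hQ1
    have ev1 : ∀ᶠ Q' in 𝓝 Q, ¬ Q'.1.IsInfinite := isOpen_not_isInfinite.mem_nhds hQ1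
    have ev2 : ∀ᶠ Q' in 𝓝 Q, Q'.1.z ≠ 0 := hz.eventually (isOpen_ne.mem_nhds hQ2)
    have ev3 : ∀ᶠ Q' in 𝓝 Q, Q'.1.z⁻¹ ∈ Metric.ball 0 (ε ^ M) :=
      (hz.inv₀ hQ2).eventually (Metric.isOpen_ball.mem_nhds hQ3)
    have h0 : ρ Q.1.z⁻¹ ^ M * Q.1.z ^ L ≠ 0 :=
      mul_ne_zero (pow_ne_zero _ (hρm _ (hsub hQ3)).1) (pow_ne_zero _ hQ2)
    have hlim : Tendsto (fun Q' : Surface m a => Q'.1.w ^ M / (ρ Q'.1.z⁻¹ ^ M * Q'.1.z ^ L)) (𝓝 Q)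
        (𝓝 1) := by
      have hρc : ContinuousAt ρ Q.1.z⁻¹ :=
        (hρ.differentiableAt (Metric.isOpen_ball.mem_nhds (hsub hQ3))).continuousAt
      have := ((continuousAt_w hQ1).pow M).div
        (((ContinuousAt.comp (g := ρ) (f := fun Q' : Surface m a => Q'.1.z⁻¹) hρc
          (hz.inv₀ hQ2)).pow M).mul (hz.pow L)) h0
      have e1 : Q.1.w ^ M / (ρ Q.1.z⁻¹ ^ M * Q.1.z ^ L) = 1 := by rw [hQ4, div_self h0]
      rw [← e1]
      exact this
    filter_upwards [ev1, ev2, ev3, eventually_eq_one_of_pow_eq_one hs0 hlim (by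
      filter_upwards [ev1, ev2, ev3] with Q' h1 h2 h3 using hξ h1 h2 h3)] with Q' h1 h2 h3 h4
    refine ⟨h1, h2, h3, ?_⟩
    rwa [div_eq_one_iff_eq
      (mul_ne_zero (pow_ne_zero _ (hρm _ (hsub h3)).1) (pow_ne_zero _ h2))] at h4
  -- Near the point at infinity the same root of unity tends to `ζ / ρ 0 ^ M = 1`, so `A` together
  -- with this point is a neighbourhood of it.
  have hAinf : ∀ᶠ Q in 𝓝[≠] (infPoint a ζ), Q ∈ A := by
    have ev3 : ∀ᶠ Q' in 𝓝[≠] (infPoint a ζ : Surface m a), Q'.1.z⁻¹ ∈ Metric.ball 0 (ε ^ M) :=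
      nhdsWithin_le_nhds (tendsto_inv_z.eventually (Metric.ball_mem_nhds _ (pow_pos hε M)))
    have hlim : Tendsto (fun Q' : Surface m a => Q'.1.w ^ M / (ρ Q'.1.z⁻¹ ^ M * Q'.1.z ^ L))
        (𝓝[≠] (infPoint a ζ)) (𝓝 1) := by
      have h0 : ρ 0 ^ M ≠ 0 := pow_ne_zero _ (hρm _ (Metric.mem_ball_self hε₀)).1
      have h1 := (hρc.tendsto.comp
        ((tendsto_inv_z (a := a) (ζ := ζ)).mono_left
          (nhdsWithin_le_nhds (s := {infPoint a ζ}ᶜ)))).pow M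
      have h2 := (tendsto_quotient (a := a) (ζ := ζ)).div h1 h0
      rw [← hρ0M, div_self h0] at h2
      refine h2.congr fun Q => ?_
      simp only [Pi.div_apply, Function.comp_apply]
      rw [div_div, mul_comm]
    filter_upwards [eventually_not_isInfinite, ev3, eventually_eq_one_of_pow_eq_one hs0 hlim (by
      filter_upwards [eventually_not_isInfinite, ev3] with Q' h1 h3 using hξ h1.1 h1.2 h3)]
      with Q' h1 h3 h4
    refine ⟨h1.1, h1.2, h3, ?_⟩
    rwa [div_eq_one_iff_eq
      (mul_ne_zero (pow_ne_zero _ (hρm _ (hsub h3)).1) (pow_ne_zero _ h1.2))] at h4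
  have hTopen : IsOpen (insert (infPoint a ζ) A) := by
    refine isOpen_iff_mem_nhds.2 fun Q hQ => ?_
    obtain rfl | hQ := hQ
    · rw [eventually_nhdsWithin_iff] at hAinf
      filter_upwards [hAinf] with Q hQ
      by_cases h : Q = infPoint a ζ
      · exact .inl h
      · exact .inr (hQ h)
    · exact mem_of_superset (hAopen.mem_nhds hQ) (Set.subset_insert _ _)
  have hneA {Q} (hQ : Q ∈ A) : Q ≠ infPoint a ζ := fun h => hQ.1 (h ▸ isInfinite_infPoint)
  let κ : ℂ → Surface m a := fun u =>
    if u = 0 then infPoint a ζ else mkPoint m a (u ^ M)⁻¹ (ρ (u ^ M) * (u ^ L)⁻¹)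
  have hκ {u : ℂ} (hu : u ≠ 0) : κ u = mkPoint m a (u ^ M)⁻¹ (ρ (u ^ M) * (u ^ L)⁻¹) := if_neg hu
  have hκ0 : κ 0 = infPoint a ζ := if_pos rfl
  have hκA (u) (hu : u ∈ Metric.ball (0 : ℂ) ε \ {0}) : κ u ∈ A := by
    rw [hκ hu.2]
    refine ⟨not_isInfinite_mkPoint (heq u hu), ?_⟩
    rw [z_mkPoint (heq u hu), w_mkPoint (heq u hu), inv_inv]
    refine ⟨inv_ne_zero (pow_ne_zero _ hu.2), hball hu.1, ?_⟩
    rw [mul_pow, inv_pow, inv_pow, ← pow_mul, ← pow_mul, mul_comm L M]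
  let η : Surface m a → ℂ := fun Q => (Q.1.z⁻¹) ^ α * (ρ Q.1.z⁻¹ / Q.1.w) ^ β
  have hηpow {Q} (hQ : Q ∈ A) : η Q ^ M = Q.1.z⁻¹ ∧ η Q ^ L = ρ Q.1.z⁻¹ / Q.1.w ∧ η Q ≠ 0 := by
    obtain ⟨h1, h2, h3, h4⟩ := hQ
    have hρ1 := (hρm _ (hsub h3)).1
    have hw : Q.1.w ≠ 0 := fun h => by
      rw [h, zero_pow hM0.ne'] at h4
      exact mul_ne_zero (pow_ne_zero _ hρ1) (pow_ne_zero _ h2) h4.symm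
    have hX : Q.1.z⁻¹ ≠ 0 := inv_ne_zero h2
    have hY : ρ Q.1.z⁻¹ / Q.1.w ≠ 0 := div_ne_zero hρ1 hw
    have hXY : (ρ Q.1.z⁻¹ / Q.1.w) ^ M = (Q.1.z⁻¹) ^ L := by
      rw [div_pow, h4, inv_pow, div_mul_cancel_left₀ (pow_ne_zero _ hρ1)]
    have hXY' : (ρ Q.1.z⁻¹ / Q.1.w) ^ (M : ℤ) = (Q.1.z⁻¹) ^ (L : ℤ) := by exact_mod_cast hXY
    refine ⟨?_, ?_, mul_ne_zero (zpow_ne_zero _ hX) (zpow_ne_zero _ hY)⟩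
    · simp only [η]
      rw [← zpow_natCast, mul_zpow, ← zpow_mul, ← zpow_mul, mul_comm β, zpow_mul _ (M : ℤ), hXY',
        ← zpow_mul, ← zpow_add₀ hX, mul_comm (L : ℤ), hαβ, zpow_one]
    · simp only [η]
      rw [← zpow_natCast, mul_zpow, ← zpow_mul, ← zpow_mul, mul_comm α, zpow_mul _ (L : ℤ), ← hXY',
        ← zpow_mul, ← zpow_add₀ hY, mul_comm (M : ℤ), hαβ, zpow_one]
  let θ : Surface m a → ℂ := fun Q => open Classical in if Q = infPoint a ζ then 0 else η Q
  have hθ0 : θ (infPoint a ζ) = 0 := if_pos rfl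
  have hθ {Q} (hQ : Q ∈ A) : θ Q = η Q := if_neg (hneA hQ)
  have hθmem {Q} (hQ : Q ∈ A) : θ Q ∈ Metric.ball (0 : ℂ) ε := by
    rw [mem_ball_zero_iff]
    refine lt_of_pow_lt_pow_left₀ M hε.le ?_
    rw [← norm_pow, hθ hQ, (hηpow hQ).1]
    exact mem_ball_zero_iff.1 hQ.2.2.1
  let e : OpenPartialHomeomorph ℂ (Surface m a) :=
    { toFun := κ
      invFun := θ
      source := Metric.ball 0 ε
      target := insert (infPoint a ζ) A
      map_source' := fun u hu => by
        by_cases hu0 : u = 0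
        · rw [hu0, hκ0]; exact Set.mem_insert _ _
        · exact .inr (hκA u ⟨hu, hu0⟩)
      map_target' := fun Q hQ => by
        obtain rfl | hQ := hQ
        · rw [hθ0]; exact Metric.mem_ball_self hε
        · exact hθmem hQ
      left_inv' := fun u hu => by
        by_cases hu0 : u = 0
        · rw [hu0, hκ0, hθ0]
        · have hu' : u ∈ Metric.ball (0 : ℂ) ε \ {0} := ⟨hu, hu0⟩
          rw [hθ (hκA u hu'), hκ hu0]
          simp only [η]
          rw [z_mkPoint (heq u hu'), w_mkPoint (heq u hu'), inv_inv,
            div_mul_cancel_left₀ (hρm _ (hsub (hball hu))).1, inv_inv, ← zpow_natCast,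
            ← zpow_natCast, ← zpow_mul, ← zpow_mul, ← zpow_add₀ hu0, mul_comm (M : ℤ),
            mul_comm (L : ℤ), hαβ, zpow_one]
      right_inv' := fun Q hQ => by
        obtain rfl | hQ := hQ
        · rw [hθ0, hκ0]
        · obtain ⟨h1, h2, h3⟩ := hηpow hQ
          rw [hθ hQ, hκ h3, h1, h2, inv_inv, inv_div,
            mul_div_cancel₀ _ (hρm _ (hsub hQ.2.2.1)).1, mkPoint_z_w hQ.1]
      open_source := Metric.isOpen_ball
      open_target := hTopen
      continuousOn_toFun := fun u hu => by
        by_cases hu0 : u = 0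
        · refine ContinuousAt.continuousWithinAt ?_
          rw [hu0, ContinuousAt, hκ0, nhds_infPoint_hasBasis.tendsto_right_iff]
          intro ε' hε'
          have ev1 : ∀ᶠ u in 𝓝 (0 : ℂ), ‖u ^ M‖ < ε' := by
            have : ContinuousAt (fun u : ℂ => ‖u ^ M‖) 0 := by fun_prop
            exact this.eventually (gt_mem_nhds (by simpa [hM0.ne'] using hε'))
          have ev2 : ∀ᶠ u in 𝓝 (0 : ℂ), ‖ρ (u ^ M) ^ M - ζ‖ < ε' := by
            have h1 : Tendsto (fun u : ℂ => u ^ M) (𝓝 0) (𝓝 0) := by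
              have : ContinuousAt (fun u : ℂ => u ^ M) 0 := by fun_prop
              simpa [ContinuousAt, hM0.ne'] using this
            have h2 := (((hρc.tendsto.comp h1).pow M).sub_const (ζ : ℂ)).norm
            refine h2.eventually (gt_mem_nhds ?_)
            rw [hρ0M, sub_self, norm_zero]
            exact hε'
          filter_upwards [ev1, ev2, Metric.ball_mem_nhds (0 : ℂ) hε] with u h1 h2 h3
          change (κ u).1 ∈ Family.nhdInf a ζ ε'
          by_cases hu0 : u = 0
          · rw [hu0, hκ0]
            exact Family.inf_mem_nhdInf a ζ hε'
          · have hu' : u ∈ Metric.ball (0 : ℂ) ε \ {0} := ⟨h3, hu0⟩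
            rw [hκ hu0, mem_nhdInf_iff hε' (not_isInfinite_mkPoint (heq u hu')),
              z_mkPoint (heq u hu'), w_mkPoint (heq u hu')]
            constructor
            · rw [norm_inv, one_div]
              exact inv_strictAnti₀ (norm_pos_iff.2 (pow_ne_zero _ hu0)) h1
            · change ‖(ρ (u ^ M) * (u ^ L)⁻¹) ^ M / ((u ^ M)⁻¹) ^ L - _‖ < ε'
              rw [mul_pow, inv_pow, inv_pow, ← pow_mul, ← pow_mul, mul_comm L M,
                mul_div_cancel_right₀ _ (inv_ne_zero (pow_ne_zero _ hu0))]
              exact h2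
        · have hc : ContinuousOn (fun u => mkPoint m a (u ^ M)⁻¹ (ρ (u ^ M) * (u ^ L)⁻¹))
              (Metric.ball (0 : ℂ) ε \ {0}) := by
            have hinv (k : ℕ) : ContinuousOn (fun u : ℂ => (u ^ k)⁻¹) (Metric.ball (0 : ℂ) ε \
                {0}) :=
              ContinuousOn.inv₀ (by fun_prop) fun u hu => pow_ne_zero _ hu.2
            exact continuousOn_mkPoint_comp (hinv M)
              ((hρ.continuousOn.comp (by fun_prop) fun u hu => hsub (hball hu.1)).mul (hinv L)) heq
          have hopen : IsOpen (Metric.ball (0 : ℂ) ε \ {0}) :=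
            Metric.isOpen_ball.sdiff isClosed_singleton
          have := hc.continuousAt (hopen.mem_nhds ⟨hu, hu0⟩)
          refine (this.congr ?_).continuousWithinAt
          filter_upwards [isOpen_ne.mem_nhds hu0] with v hv
          exact (hκ hv).symm
      continuousOn_invFun := fun Q hQ => by
        refine ContinuousAt.continuousWithinAt ?_
        obtain rfl | hQ := hQ
        · rw [ContinuousAt, hθ0, Metric.tendsto_nhds]
          intro ε' hε'
          have ev := (tendsto_inv_z (a := a) (ζ := ζ)).eventually
            (Metric.ball_mem_nhds (0 : ℂ) (pow_pos hε' M))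
          filter_upwards [ev, hTopen.mem_nhds (Set.mem_insert _ _)] with Q h1 h2
          obtain rfl | hQ := h2
          · rw [hθ0, dist_self]; exact hε'
          · rw [dist_zero_right]
            -- At infinity continuity of the inverse needs only the modulus, and `‖u‖ ^ M = ‖1 /
            -- z‖`.
            refine lt_of_pow_lt_pow_left₀ M hε'.le ?_
            rw [← norm_pow, hθ hQ, (hηpow hQ).1]
            exact mem_ball_zero_iff.1 h1
        · have hz := continuousAt_z hQ.1
          have hρc : ContinuousAt ρ Q.1.z⁻¹ :=
            (hρ.differentiableAt (Metric.isOpen_ball.mem_nhds (hsub hQ.2.2.1))).continuousAt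
          have hw : Q.1.w ≠ 0 := fun h => by
            have := hQ.2.2.2
            rw [h, zero_pow hM0.ne'] at this
            exact mul_ne_zero (pow_ne_zero _ (hρm _ (hsub hQ.2.2.1)).1) (pow_ne_zero _ hQ.2.1)
              this.symm
          have : ContinuousAt η Q :=
            ((hz.inv₀ hQ.2.1).zpow₀ α (.inl (inv_ne_zero hQ.2.1))).mul
              (((ContinuousAt.comp (g := ρ) (f := fun Q' : Surface m a => Q'.1.z⁻¹) hρc
                (hz.inv₀ hQ.2.1)).div (continuousAt_w hQ.1) hw).zpow₀ β
                (.inl (div_ne_zero (hρm _ (hsub hQ.2.2.1)).1 hw)))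
          refine this.congr ?_
          filter_upwards [hAopen.mem_nhds hQ] with Q' hQ'
          exact (hθ hQ').symm }
  have hu0 {u} (hu : ¬ (κ u).1.IsInfinite) : u ≠ 0 := by
    rintro rfl
    rw [hκ0] at hu
    exact hu isInfinite_infPoint
  refine ⟨⟨ε, e, fun u => (u ^ M)⁻¹, fun u => ρ (u ^ M) * (u ^ L)⁻¹,
    fun u => -(M : ℂ) * (u ^ (M + 1))⁻¹, hε, rfl, hκ0, fun u hu hu0 => ⟨(hκA u ⟨hu, hu0⟩).1, ?_⟩,
    fun u hu h => ?_, fun u hu h => ?_, fun u hu h _ => ⟨?_, ?_⟩⟩, ρ, hρ.mono hsub,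
    fun v hv => ⟨(hρm _ (hsub hv)).1, fun i hi => ?_⟩, fun u hu hu0 => ⟨rfl, rfl, rfl⟩⟩
  · change ¬ (κ u).1.IsBranch
    rw [hκ hu0, isBranch_mkPoint_iff (heq u ⟨hu, hu0⟩)]
    exact mul_ne_zero (hρm _ (hsub (hball hu))).1 (inv_ne_zero (pow_ne_zero _ hu0))
  · change (κ u).1.z = _
    rw [hκ (hu0 h), z_mkPoint (heq u ⟨hu, hu0 h⟩)]
  · change (κ u).1.w = _
    rw [hκ (hu0 h), w_mkPoint (heq u ⟨hu, hu0 h⟩)]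
  · have hu0 := hu0 h
    refine ((hasDerivAt_pow M u).inv (pow_ne_zero _ hu0)).congr_deriv ?_
    obtain ⟨M', hM'⟩ := Nat.exists_eq_succ_of_ne_zero hM0.ne'
    simp only [hM', Nat.succ_eq_add_one, Nat.add_sub_cancel]
    field_simp
    try ring
  · exact mul_ne_zero (neg_ne_zero.2 (Nat.cast_ne_zero.2 hM0.ne'))
      (inv_ne_zero (pow_ne_zero _ (hu0 h)))
  · refine pow_ne_zero m (hρm _ (hsub hv)).1 ?_
    rw [(hρm _ (hsub hv)).2]
    exact Finset.prod_eq_zero (Finset.mem_univ i) hi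

end InfiniteCharts

/-! ### Existence of primitives near each kind of point -/

section Primitives

variable {m N : ℕ} {a : Fin N → ℂ} {i : Fin N} {q : ℤ}

theorem IsPrimitive.mono {U V : Set (Surface m a)} {h : Surface m a → ℂ} (hh : IsPrimitive i q V h)
    (hUV : U ⊆ V) : IsPrimitive i q U h :=
  ⟨hh.1.mono hUV, fun P hP => hh.2 P (hUV hP)⟩

theorem exists_pointChart (hm : 0 < m) (ha : Function.Injective a) (P : Surface m a) :
    Nonempty (PointChart P) := by
  by_cases h1 : P.1.IsInfinite
  · exact (exists_pointChart_of_isInfinite hm P h1).nonempty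
  by_cases h2 : P.1.IsBranch
  · exact (exists_pointChart_of_isBranch hm ha P h2).nonempty
  · exact (exists_pointChart_of_not_isBranch hm P h1 h2).nonempty

/-- Holomorphic functions on a disc have primitives. Agreement with `f` is asked only at the good
points because the formula for the form may be a default value at the centre. -/
theorem PointChart.exists_isPrimitive {P : Surface m a} (c : PointChart P) {f : ℂ → ℂ}
    (hf : DifferentiableOn ℂ f (Metric.ball 0 c.ε))
    (hform : ∀ u ∈ Metric.ball 0 c.ε, ¬ (c.e u).1.IsInfinite → ¬ (c.e u).1.IsBranch →
      c.form i q u = f u) : ∃ h, IsPrimitive i q c.e.target h := by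
  obtain ⟨H, hH⟩ := hf.isExactOn_ball
  refine ⟨_, (c.isPrimitive (B := Metric.ball 0 c.ε) (H := H)
    (fun u hu => (hH u hu).continuousAt.continuousWithinAt) fun u hu h1 h2 => ?_).mono
      fun Q hQ => ⟨hQ, c.symm_mem hQ⟩⟩
  rw [hform u hu h1 h2]
  exact hH u hu

theorem exists_isPrimitive_of_not_isBranch (hm : 0 < m) (P : Surface m a) (h1 : ¬ P.1.IsInfinite)
    (h2 : ¬ P.1.IsBranch) (i : Fin N) (q : ℤ) :
    ∃ (c : PointChart P) (h : _), IsPrimitive i q c.e.target h := by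
  obtain ⟨c, hW, hc⟩ := exists_pointChart_of_not_isBranch hm P h1 h2
  refine ⟨c, c.exists_isPrimitive (f := fun u => c.W u ^ q / (P.1.z + u - a i)) ?_
    fun u hu _ _ => ?_⟩
  · refine DifferentiableOn.div (fun u hu => ?_) (by fun_prop) fun u hu => ?_
    · exact (hW u hu).zpow (.inl (hc u hu).2.2.2.2.1)
    · rw [← (hc u hu).2.2.1]
      exact (hc u hu).2.2.2.2.2 i
  · rw [PointChart.form, (hc u hu).2.2.1, (hc u hu).2.2.2.1, mul_one]

/-- For `i = k` one has `dz / (z - a_k) = m du / u`, and `w ^ q` with `q ≥ 1` supplies at least one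
factor `u`. For `i ≠ k` the denominator does not vanish. -/
theorem exists_isPrimitive_of_isBranch (hm : 0 < m) (ha : Function.Injective a) (P : Surface m a)
    (h2 : P.1.IsBranch) (i : Fin N) (hq : 0 < q) :
    ∃ (c : PointChart P) (h : _), IsPrimitive i q c.e.target h := by
  obtain ⟨c, k, ρ, hρ, hc⟩ := exists_pointChart_of_isBranch hm ha P h2
  obtain ⟨K, rfl⟩ : ∃ K : ℕ, q = ((K + 1 : ℕ) : ℤ) := ⟨(q - 1).toNat, by omega⟩
  by_cases hik : i = k
  · subst hik
    refine ⟨c, c.exists_isPrimitive (f := fun u => m * ρ u ^ (K + 1) * u ^ K) (by fun_prop)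
      fun u hu h1 hb => ?_⟩
    obtain ⟨e1, e2, e3, e4, -⟩ := hc u hu
    have hu0 : u ≠ 0 := by
      rintro rfl
      rw [c.map_zero] at hb
      exact hb h2
    rw [PointChart.form, e1, e2, e3, zpow_natCast, add_sub_cancel_left]
    obtain ⟨m', rfl⟩ := Nat.exists_eq_succ_of_ne_zero hm.ne'
    simp only [Nat.succ_eq_add_one, Nat.add_sub_cancel]
    field_simp
    ring
  · refine ⟨c, c.exists_isPrimitive
      (f := fun u => (u * ρ u) ^ (K + 1) / (a k + u ^ m - a i) * (m * u ^ (m - 1))) ?_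
      fun u hu h1 hb => ?_⟩
    · refine DifferentiableOn.mul (DifferentiableOn.div (by fun_prop) (by fun_prop)
        fun u hu => ?_) (by fun_prop)
      rw [← (hc u hu).1]
      exact (hc u hu).2.2.2.2 i hik
    · obtain ⟨e1, e2, e3, -⟩ := hc u hu
      rw [PointChart.form, e1, e2, e3, zpow_natCast]

/-- At infinity `dz / (z - a_i)` has a simple pole in `u`, and `w ^ q` with `q < 0` vanishes to
order `L |q| ≥ 1`, so the product is holomorphic. -/
theorem exists_isPrimitive_of_isInfinite (hm : 0 < m) (P : Surface m a)
    (hP : P.1.IsInfinite) (i : Fin N) (hq : q < 0) :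
    ∃ (c : PointChart P) (h : _), IsPrimitive i q c.e.target h := by
  obtain ⟨c, ρ, hρ, hρ0, hc⟩ := exists_pointChart_of_isInfinite hm P hP
  set M := m / Nat.gcd m N with hM
  set L := N / Nat.gcd m N with hL
  have hL0 : 0 < L := Nat.div_pos (Nat.gcd_le_right _ i.pos) (Nat.gcd_pos_of_pos_left _ hm)
  have hM0 : 0 < M := Nat.div_pos (Nat.gcd_le_left _ hm) (Nat.gcd_pos_of_pos_left _ hm)
  obtain ⟨K, rfl⟩ : ∃ K : ℕ, q = -((K + 1 : ℕ) : ℤ) := ⟨(-q - 1).toNat, by omega⟩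
  obtain ⟨L', hL'⟩ := Nat.exists_eq_succ_of_ne_zero hL0.ne'
  have hball {u : ℂ} (hu : u ∈ Metric.ball (0 : ℂ) c.ε) :
      u ^ M ∈ Metric.ball (0 : ℂ) (c.ε ^ M) := by
    simpa using pow_lt_pow_left₀ (mem_ball_zero_iff.1 hu) (norm_nonneg _) hM0.ne'
  have hρu : DifferentiableOn ℂ (fun u => ρ (u ^ M)) (Metric.ball 0 c.ε) :=
    hρ.comp (by fun_prop) fun u hu => hball hu
  refine ⟨c, c.exists_isPrimitive (f := fun u => -(M : ℂ) * u ^ (L' * (K + 1) + K) /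
    (ρ (u ^ M) ^ (K + 1) * (1 - a i * u ^ M))) ?_ fun u hu h1 hb => ?_⟩
  · refine DifferentiableOn.div (by fun_prop) ((hρu.pow _).mul (by fun_prop)) fun u hu => ?_
    exact mul_ne_zero (pow_ne_zero _ (hρ0 _ (hball hu)).1) ((hρ0 _ (hball hu)).2 i)
  · have hu0 : u ≠ 0 := by
      rintro rfl
      rw [c.map_zero] at h1
      exact h1 hP
    obtain ⟨e1, e2, e3⟩ := hc u hu hu0
    have h1 := (hρ0 _ (hball hu)).1
    have h2 := (hρ0 _ (hball hu)).2 i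
    have h3 : (u ^ M)⁻¹ - a i = (1 - a i * u ^ M) * (u ^ M)⁻¹ := by field_simp
    have h4 : u ^ ((L' + 1) * (K + 1)) = u * u ^ (L' * (K + 1) + K) := by ring
    rw [PointChart.form, e1, e2, e3, h3, zpow_neg, zpow_natCast, hL', Nat.succ_eq_add_one, mul_pow,
      inv_pow, ← pow_mul, h4, pow_succ u M]
    have h5 : u ^ M ≠ 0 := pow_ne_zero _ hu0
    have h6 : u ^ (L' * (K + 1) + K) ≠ 0 := pow_ne_zero _ hu0
    generalize u ^ M = v at *
    generalize u ^ (L' * (K + 1) + K) = x at *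
    field_simp

/-- All exponents of `u` in the Laurent expansion are congruent to `-K - 1` modulo `m`, so none
equals `-1`. The proof splits `φ(v) = φ(0) + v ψ(v)`: the first term is integrated directly, the
second lowers `K` by `m`, until it is holomorphic. -/
theorem exists_primitive_punctured {φ : ℂ → ℂ} {r : ℝ} (hr : 0 < r) (hm : 0 < m)
    (hφ : DifferentiableOn ℂ φ (Metric.ball 0 (r ^ m))) (K : ℕ) (hK : ¬ m ∣ K) :
    ∃ H : ℂ → ℂ, ∀ u ∈ Metric.ball 0 r, u ≠ 0 →
      HasDerivAt H (φ (u ^ m) * (u ^ (K + 1))⁻¹) u := by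
  induction K using Nat.strong_induction_on generalizing φ with
  | _ K ih =>
  have hball {u : ℂ} (hu : u ∈ Metric.ball (0 : ℂ) r) :
      u ^ m ∈ Metric.ball (0 : ℂ) (r ^ m) := by
    simpa using pow_lt_pow_left₀ (mem_ball_zero_iff.1 hu) (norm_nonneg _) hm.ne'
  have hψ : DifferentiableOn ℂ (dslope φ 0) (Metric.ball 0 (r ^ m)) :=
    (Complex.differentiableOn_dslope (Metric.ball_mem_nhds _ (pow_pos hr m))).2 hφ
  have hsplit (v : ℂ) : φ v = φ 0 + v * dslope φ 0 v := by
    have := sub_smul_dslope φ 0 v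
    rw [sub_zero, smul_eq_mul] at this
    rw [this]; ring
  have hK0 : K ≠ 0 := by rintro rfl; exact hK (dvd_zero _)
  obtain ⟨H, hH⟩ : ∃ H : ℂ → ℂ, ∀ u ∈ Metric.ball 0 r, u ≠ 0 →
      HasDerivAt H (u ^ m * dslope φ 0 (u ^ m) * (u ^ (K + 1))⁻¹) u := by
    obtain h | h := lt_or_ge K m
    · have : DifferentiableOn ℂ (fun u => u ^ (m - K - 1) * dslope φ 0 (u ^ m))
          (Metric.ball 0 r) :=
        DifferentiableOn.mul (by fun_prop) (hψ.comp (by fun_prop) fun u hu => hball hu)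
      obtain ⟨H, hH⟩ := this.isExactOn_ball
      refine ⟨H, fun u hu hu0 => (hH u hu).congr_deriv ?_⟩
      have : u ^ m = u ^ (m - K - 1) * u ^ (K + 1) := by
        rw [← pow_add]; congr 1; omega
      field_simp
      rw [mul_right_comm, ← this]
    · obtain ⟨H, hH⟩ := ih (K - m) (by omega) hψ fun h' => hK (by
        have := Nat.dvd_add h' dvd_rfl
        rwa [Nat.sub_add_cancel h] at this)
      refine ⟨H, fun u hu hu0 => (hH u hu hu0).congr_deriv ?_⟩
      have : u ^ (K + 1) = u ^ m * u ^ (K - m + 1) := by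
        rw [← pow_add]; congr 1; omega
      rw [this]
      field_simp
  refine ⟨fun u => -(φ 0 / K) * (u ^ K)⁻¹ + H u, fun u hu hu0 => ?_⟩
  refine ((((hasDerivAt_pow K u).inv (pow_ne_zero _ hu0)).const_mul _).add
    (hH u hu hu0)).congr_deriv ?_
  obtain ⟨K', rfl⟩ := Nat.exists_eq_succ_of_ne_zero hK0
  have hK' : ((K'.succ : ℕ) : ℂ) ≠ 0 := Nat.cast_ne_zero.2 hK0
  rw [hsplit (u ^ m)]
  simp only [Nat.succ_eq_add_one, Nat.add_sub_cancel] at hK' ⊢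
  field_simp
  ring

/-- The residue at infinity vanishes in the coprime case. The growth `u ^ (-N k - 1)` of the form
shows that no primitive extends over the point, so paths in the sense of `IsPathIntegral` must avoid
it. -/
theorem exists_isPrimitive_punctured (hm : 0 < m) (hcop : Nat.Coprime m N) (P : Surface m a)
    (hP : P.1.IsInfinite) (i : Fin N) (hq : 0 < q) :
    ∃ (c : PointChart P) (h : _), IsPrimitive i q (c.e.target \ {P}) h ∧
      Tendsto (fun u => ‖c.form i q u‖) (𝓝[≠] 0) atTop := by
  obtain ⟨c, ρ, hρ, hρ0, hc⟩ := exists_pointChart_of_isInfinite hm P hP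
  rw [hcop, Nat.div_one] at hρ hρ0
  simp only [hcop.gcd_eq_one, Nat.div_one] at hc
  obtain ⟨k, rfl⟩ : ∃ k : ℕ, q = (k : ℤ) := ⟨q.toNat, by omega⟩
  have hk0 : 0 < k := by exact_mod_cast hq
  have hball {u : ℂ} (hu : u ∈ Metric.ball (0 : ℂ) c.ε) :
      u ^ m ∈ Metric.ball (0 : ℂ) (c.ε ^ m) := by
    simpa using pow_lt_pow_left₀ (mem_ball_zero_iff.1 hu) (norm_nonneg _) hm.ne'
  let φ : ℂ → ℂ := fun v => -(m : ℂ) * ρ v ^ k / (1 - a i * v)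
  have hφ : DifferentiableOn ℂ φ (Metric.ball 0 (c.ε ^ m)) :=
    DifferentiableOn.div (by fun_prop) (by fun_prop) fun v hv => (hρ0 v hv).2 i
  have hform (u) (hu : u ∈ Metric.ball 0 c.ε) (hu0 : u ≠ 0) :
      c.form i k u = φ (u ^ m) * (u ^ (N * k + 1))⁻¹ := by
    obtain ⟨e1, e2, e3⟩ := hc u hu hu0
    have h2 := (hρ0 _ (hball hu)).2 i
    have h3 : (u ^ m)⁻¹ - a i = (1 - a i * u ^ m) * (u ^ m)⁻¹ := by field_simp
    simp only [PointChart.form, φ, e1, e2, e3, h3, zpow_natCast]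
    rw [mul_pow, inv_pow, ← pow_mul, pow_succ, pow_succ]
    have h5 : u ^ m ≠ 0 := pow_ne_zero _ hu0
    have h6 : u ^ (N * k) ≠ 0 := pow_ne_zero _ hu0
    generalize u ^ m = v at *
    generalize u ^ (N * k) = x at *
    field_simp
  have hprim : ∃ H : ℂ → ℂ, ∀ u ∈ Metric.ball 0 c.ε, u ≠ 0 → HasDerivAt H (c.form i k u) u := by
    -- If `m` divides `k`, then `w ^ k / (z - a_i)` is a polynomial in `z`. Otherwise `m` does not
    -- divide `N k`, by coprimality.
    by_cases hd : m ∣ k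
    · obtain ⟨t, rfl⟩ := hd
      obtain ⟨t, rfl⟩ : ∃ t', t = t' + 1 := ⟨t - 1, by
        have := Nat.pos_of_mul_pos_left hk0; omega⟩
      have hR : Differentiable ℂ fun z : ℂ =>
          (∏ j, (z - a j)) ^ t * ∏ j ∈ Finset.univ.erase i, (z - a j) := by fun_prop
      obtain ⟨S, hS⟩ := hR.isExactOn_univ
      refine ⟨fun u => S (c.Z u), fun u hu hu0 => ?_⟩
      obtain ⟨g1, g2⟩ := c.good u hu hu0
      refine ((hS (c.Z u) trivial).comp u (c.deriv u hu g1 g2).1).congr_deriv ?_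
      have hw := w_pow_eq g1
      have hW0 : c.W u ≠ 0 := by
        rw [← c.w_eq u hu g1]
        exact fun h => g2 ((isBranch_iff g1).2 h)
      rw [c.w_eq u hu g1, c.z_eq u hu g1] at hw
      have hZ : c.Z u - a i ≠ 0 := fun h => by
        rw [Finset.prod_eq_zero (Finset.mem_univ i) h] at hw
        exact pow_ne_zero _ hW0 hw
      rw [PointChart.form, zpow_natCast, pow_mul, hw, pow_succ]
      congr 1
      rw [eq_div_iff hZ, mul_assoc, Finset.prod_erase_mul _ _ (Finset.mem_univ i)]
    · obtain ⟨H, hH⟩ := exists_primitive_punctured c.pos hm hφ (N * k)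
        fun h => hd (hcop.dvd_of_dvd_mul_left h)
      exact ⟨H, fun u hu hu0 => by rw [hform u hu hu0]; exact hH u hu hu0⟩
  obtain ⟨H, hH⟩ := hprim
  refine ⟨c, _, (c.isPrimitive (B := Metric.ball 0 c.ε \ {0}) (H := H)
    (fun u hu => (hH u hu.1 hu.2).continuousAt.continuousWithinAt)
    fun u hu _ _ => hH u hu.1 hu.2).mono fun Q hQ => ⟨hQ.1, c.symm_mem hQ.1, fun h => hQ.2 ?_⟩, ?_⟩
  · rw [Set.mem_singleton_iff] at h ⊢
    rw [← c.e.right_inv hQ.1, h, c.map_zero]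
  · have hφ0 : φ 0 ≠ 0 := by
      have := (hρ0 0 (Metric.mem_ball_self (pow_pos c.pos m))).1
      simp only [φ, mul_zero, sub_zero, div_one]
      exact mul_ne_zero (neg_ne_zero.2 (Nat.cast_ne_zero.2 hm.ne')) (pow_ne_zero _ this)
    have hlim : Tendsto (fun u : ℂ => ‖φ (u ^ m)‖) (𝓝[≠] 0) (𝓝 ‖φ 0‖) := by
      have h1 : Tendsto (fun u : ℂ => u ^ m) (𝓝 0) (𝓝 0) := by
        have : ContinuousAt (fun u : ℂ => u ^ m) 0 := by fun_prop
        simpa [ContinuousAt, hm.ne'] using this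
      have h2 : ContinuousAt φ 0 :=
        (hφ.differentiableAt (Metric.ball_mem_nhds _ (pow_pos c.pos m))).continuousAt
      exact (h2.tendsto.comp (h1.mono_left nhdsWithin_le_nhds)).norm
    have hinv : Tendsto (fun u : ℂ => ‖(u ^ (N * k + 1))⁻¹‖) (𝓝[≠] 0) atTop := by
      have h1 : Tendsto (fun u : ℂ => u ^ (N * k + 1)) (𝓝[≠] 0) (𝓝[≠] 0) := by
        refine tendsto_nhdsWithin_iff.2 ⟨?_, ?_⟩
        · have : ContinuousAt (fun u : ℂ => u ^ (N * k + 1)) 0 := by fun_prop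
          have := this.tendsto.mono_left (nhdsWithin_le_nhds (s := {0}ᶜ))
          simpa using this
        · filter_upwards [self_mem_nhdsWithin] with u hu using pow_ne_zero _ hu
      exact (tendsto_norm_cobounded_atTop.comp tendsto_inv₀_nhdsNE_zero).comp h1
    refine (Tendsto.pos_mul_atTop (norm_pos_iff.2 hφ0) hlim hinv).congr' ?_
    filter_upwards [nhdsWithin_le_nhds (Metric.ball_mem_nhds _ c.pos), self_mem_nhdsWithin]
      with u hu hu0
    rw [hform u hu hu0, norm_mul]

end Primitives

/-! ### Integrals over homology classes are well defined -/

section Periods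

variable {m N : ℕ} {n : ℤ} {a : Fin N → ℂ} {i : Fin N} {q : ℤ}

/-- The poles of the differentials in the domain of the cycles. -/
def IsPole (n : ℤ) (P : Surface m a) : Prop := 0 < n ∧ P.1.IsInfinite

theorem coprime_of_mem_cycleDomain (hn : 0 < n) {P : Family m N} (hP : P ∈ cycleDomain m N n)
    (hinf : P.IsInfinite) : Nat.Coprime m N := by
  by_contra h
  rw [cycleDomain, if_neg hn.not_gt, if_neg h] at hP
  exact hP hinf

theorem not_isBranch_of_mem_cycleDomain (hn : n < 0) {P : Family m N}
    (hP : P ∈ cycleDomain m N n) : ¬ P.IsBranch := by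
  rwa [cycleDomain, if_pos hn] at hP

/-- The points removed in `cycleDomain` are exactly such that one of the previous cases applies at
each remaining point. Keeping other special points out of `U` makes the poles isolated in the cover.
-/
theorem exists_local_primitive (hm : 0 < m) (ha : Function.Injective a) (hn : n ≠ 0) (i : Fin N)
    {j : ℕ} (hj : 0 < j) (P : Surface m a) (hP : P.1 ∈ cycleDomain m N n) :
    ∃ (U : Set (Surface m a)) (h : Surface m a → ℂ), IsOpen U ∧ P ∈ U ∧
      (∀ Q ∈ U, Q ≠ P → ¬ Q.1.IsInfinite ∧ ¬ Q.1.IsBranch) ∧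
      IsPrimitive i (j * n) (U \ {Q | IsPole n Q}) h := by
  have hj' : (0 : ℤ) < j := by exact_mod_cast hj
  suffices H : ∃ (c : PointChart P) (h : _), IsPrimitive i (j * n) (c.e.target \ {Q | IsPole n
      Q}) h by
    obtain ⟨c, h, hh⟩ := H
    exact ⟨c.e.target, h, c.e.open_target, c.mem_target, fun Q => c.good_of_mem, hh⟩
  by_cases h1 : P.1.IsInfinite
  · obtain hn | hn := lt_or_gt_of_ne hn
    · obtain ⟨c, h, hh⟩ := exists_isPrimitive_of_isInfinite hm P h1 i (mul_neg_of_pos_of_neg hj' hn)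
      exact ⟨c, h, hh.mono Set.sdiff_subset⟩
    · obtain ⟨c, h, hh, -⟩ := exists_isPrimitive_punctured hm (coprime_of_mem_cycleDomain hn hP h1)
        P h1 i (mul_pos hj' hn)
      refine ⟨c, h, hh.mono fun Q hQ => ⟨hQ.1, ?_⟩⟩
      rintro rfl
      exact hQ.2 ⟨hn, h1⟩
  by_cases h2 : P.1.IsBranch
  · obtain hn | hn := lt_or_gt_of_ne hn
    · exact absurd h2 (not_isBranch_of_mem_cycleDomain hn hP)
    · obtain ⟨c, h, hh⟩ := exists_isPrimitive_of_isBranch hm ha P h2 i (mul_pos hj' hn)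
      exact ⟨c, h, hh.mono Set.sdiff_subset⟩
  · obtain ⟨c, h, hh⟩ := exists_isPrimitive_of_not_isBranch hm P h1 h2 i (j * n)
    exact ⟨c, h, hh.mono Set.sdiff_subset⟩

theorem not_isPrimitive_of_isPole (hm : 0 < m) (i : Fin N)
    {j : ℕ} (hj : 0 < j) {P : Surface m a} (hP : P.1 ∈ cycleDomain m N n) (hpole : IsPole n P)
    {U : Set (Surface m a)} (hU : IsOpen U) (hPU : P ∈ U) {h : Surface m a → ℂ} :
    ¬ IsPrimitive i (j * n) U h := by
  have hj' : (0 : ℤ) < j := by exact_mod_cast hj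
  obtain ⟨c, -, -, hc⟩ := exists_isPrimitive_punctured hm
    (coprime_of_mem_cycleDomain hpole.1 hP hpole.2) P hpole.2 i (mul_pos hj' hpole.1)
  exact c.not_isPrimitive hc hU hPU

theorem IsPrimitive.add_const {U : Set (Surface m a)} {h : Surface m a → ℂ}
    (hh : IsPrimitive i q U h) (v : ℂ) : IsPrimitive i q U fun Q => h Q + v :=
  ⟨hh.1.add continuousOn_const, fun P hP h1 h2 => by simpa using hh.2 P hP h1 h2⟩

theorem isClosed_isInfinite : IsClosed {Q : Surface m a | Q.1.IsInfinite} :=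
  ⟨isOpen_not_isInfinite⟩

/-- Integration of the differential along paths in the domain of the cycles. -/
theorem exists_localPrimitives (hm : 0 < m) (ha : Function.Injective a) (hn : n ≠ 0) (i : Fin N)
    {j : ℕ} (hj : 0 < j) : ∃ T : LocalPrimitives (CycleSurface m n a),
      (∀ (σ : C(unitInterval, CycleSurface m n a)) (v : ℂ), IsPathIntegral i (j * n)
        ((ContinuousMap.mk Subtype.val continuous_subtype_val).comp σ) v → T.integral σ = v) ∧
      ∀ σ : C(unitInterval, CycleSurface m n a), (∀ t, ¬ IsPole n (σ t).1) →
        IsPathIntegral i (j * n)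
          ((ContinuousMap.mk Subtype.val continuous_subtype_val).comp σ) (T.integral σ) := by
  choose U h hU hPU hgood hprim using fun y : CycleSurface m n a =>
    exists_local_primitive hm ha hn i hj y.1 y.2
  have hopen (y) : IsOpen (U y \ {Q | IsPole n Q}) := by
    by_cases hn' : 0 < n
    · have : {Q : Surface m a | IsPole n Q} = {Q | Q.1.IsInfinite} := by
        ext Q; exact and_iff_right hn'
      rw [this]
      exact (hU y).sdiff isClosed_isInfinite
    · have : {Q : Surface m a | IsPole n Q} = ∅ := by
        ext Q; exact iff_of_false (fun h => hn' h.1) id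
      rw [this, Set.sdiff_empty]
      exact hU y
  have huniq (y x : CycleSurface m n a) (hx : x.1 ∈ U y) (V : Set (Surface m a)) (hV : IsOpen V)
      (hxV : x.1 ∈ V) (h' : Surface m a → ℂ) (hh' : IsPrimitive i (j * n) V h')
      (hpole : ¬ IsPole n x.1) :
      ∀ᶠ x' : CycleSurface m n a in 𝓝 x, h y x'.1 - h' x'.1 = h y x.1 - h' x.1 := by
    obtain ⟨c⟩ := exists_pointChart hm ha x.1
    exact continuous_subtype_val.continuousAt.eventually
      (c.eventually_sub_eq ((hopen y).inter hV) ⟨⟨hx, hpole⟩, hxV⟩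
        ((hprim y).mono Set.inter_subset_left) (hh'.mono Set.inter_subset_right))
  let T : LocalPrimitives (CycleSurface m n a) :=
    { U := fun y => Subtype.val ⁻¹' U y
      h := fun y x => h y x.1
      isOpen_U := fun y => (hU y).preimage continuous_subtype_val
      mem_U := hPU
      eventually_sub_eq := fun y y' x hx hx' => by
        -- A pole lies only in the member of the cover indexed by itself, so no compatibility is
        -- required there, and the value of the primitive at the pole does not matter.
        by_cases hpole : IsPole n x.1
        · have e1 : x = y := by
            by_contra hne
            exact (hgood y x.1 hx fun h => hne (Subtype.ext h)).1 hpole.2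
          have e2 : x = y' := by
            by_contra hne
            exact (hgood y' x.1 hx' fun h => hne (Subtype.ext h)).1 hpole.2
          subst e1 e2
          simp
        · exact huniq y x hx _ (hopen y') ⟨hx', hpole⟩ _ (hprim y') hpole }
  refine ⟨T, fun σ v => ?_, fun σ hσ => ?_⟩
  · rintro ⟨F, hF, rfl⟩
    refine LocalPrimitives.IsAlong.integral_eq fun t₀ y hy => ?_
    obtain ⟨V, h', hV, hmem, hh', hFh⟩ := hF t₀
    -- A path with an integral carries a primitive on a full neighbourhood of each of its points,
    -- which is impossible at a pole.
    have hpole : ¬ IsPole n (σ t₀).1 := fun hp =>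
      not_isPrimitive_of_isPole hm i hj (σ t₀).2 hp hV hmem hh'
    have h0 := hFh.self_of_nhds
    filter_upwards [hFh, σ.continuous.continuousAt.eventually
      (huniq y (σ t₀) hy V hV hmem h' hh' hpole)] with t h1 h2
    rw [h1, h0]
    simp only [ContinuousMap.comp_apply, ContinuousMap.coe_mk, T]
    linear_combination -h2
  · obtain ⟨F, hF⟩ := T.exists_isAlong σ
    refine ⟨F, fun t₀ => ?_, LocalPrimitives.IsAlong.integral_eq hF⟩
    -- The added constant makes the primitive equal to `F` along `σ`, not only up to a constant.
    refine ⟨U (σ t₀) \ {Q | IsPole n Q}, _, hopen _, ⟨hPU _, hσ t₀⟩,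
      (hprim (σ t₀)).add_const (F t₀ - h (σ t₀) (σ t₀).1), ?_⟩
    filter_upwards [hF t₀ (σ t₀) (T.mem_U _)] with t ht
    simp only [T] at ht
    simp only [ContinuousMap.comp_apply, ContinuousMap.coe_mk]
    linear_combination ht

theorem exists_openPartialHomeomorph_subtype {X : Type*} [TopologicalSpace X] {p : X → Prop}
    (x₀ : {x // p x}) (e : OpenPartialHomeomorph ℂ X) (hp : ∀ u ∈ e.source, p (e u)) :
    ∃ e' : OpenPartialHomeomorph ℂ {x // p x}, e'.source = e.source ∧
      ∀ u ∈ e.source, (e' u).1 = e u := by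
  classical
  have he {u : ℂ} (hu : u ∈ e.source) :
      (if h : p (e u) then (⟨e u, h⟩ : {x // p x}) else x₀).1 = e u := by rw [dif_pos (hp u hu)]
  refine ⟨{ toFun := fun u => if h : p (e u) then ⟨e u, h⟩ else x₀
            invFun := fun x => e.symm x.1
            source := e.source
            target := Subtype.val ⁻¹' e.target
            map_source' := fun u hu => by
              rw [Set.mem_preimage, he hu]; exact e.map_source hu
            map_target' := fun x hx => e.map_target hx
            left_inv' := fun u hu => by rw [he hu, e.left_inv hu]
            right_inv' := fun x hx => Subtype.ext (by
              rw [he (e.map_target hx), e.right_inv hx])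
            open_source := e.open_source
            open_target := e.open_target.preimage continuous_subtype_val
            continuousOn_toFun := ?_
            continuousOn_invFun := e.continuousOn_symm.comp continuous_subtype_val.continuousOn
              fun x hx => hx }, rfl, fun u hu => he hu⟩
  refine (Topology.IsInducing.continuousOn_iff (g := (Subtype.val : {x // p x} → X)) ⟨rfl⟩).2 ?_
  exact e.continuousOn.congr fun u hu => he hu

/-- Every class is represented by a cycle of paths along which `z` is affine, in the affine part
and away from the branch points. -/
theorem exists_represents_segments (hm : 0 < m) (ha : Function.Injective a)
    (γ : H1 (CycleSurface m n a)) :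
    ∃ (R : ℕ) (c : Fin R → ℤ) (σ : Fin R → C(unitInterval, CycleSurface m n a)),
      (∀ r, (∀ t, ¬ (σ r t).1.1.IsInfinite ∧ ¬ (σ r t).1.1.IsBranch) ∧
        ∃ δ ≠ 0, ∀ t : unitInterval, (σ r t).1.1.z = (σ r 0).1.1.z + t * δ) ∧
        Represents c σ γ := by
  refine exists_represents_affine {x | ¬ x.1.1.IsInfinite ∧ ¬ x.1.1.IsBranch} (fun x => x.1.1.z)
    (fun y => ?_) (fun y hy => ?_) γ
  · obtain ⟨c⟩ := exists_pointChart hm ha y.1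
    obtain ⟨e, he, he'⟩ := exists_openPartialHomeomorph_subtype y c.e fun u hu => by
      rw [c.source_eq] at hu
      by_cases hu0 : u = 0
      · rw [hu0, c.map_zero]; exact y.2
      · exact mem_cycleDomain n (c.good u hu hu0).1 (c.good u hu hu0).2
    rw [c.source_eq] at he he'
    refine ⟨c.ε, c.pos, e, he, Subtype.ext ?_, fun u hu hu0 => ?_⟩
    · rw [he' 0 c.zero_mem, c.map_zero]
    · rw [Set.mem_ofPred_eq, he' u hu]
      exact c.good u hu hu0
  · obtain ⟨c, -, hc⟩ := exists_pointChart_of_not_isBranch hm y.1 hy.1 hy.2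
    obtain ⟨e, he, he'⟩ := exists_openPartialHomeomorph_subtype y c.e fun u hu => by
      rw [c.source_eq] at hu
      exact mem_cycleDomain n (hc u hu).1 (hc u hu).2.1
    rw [c.source_eq] at he he'
    refine ⟨c.ε, c.pos, e, he, Subtype.ext ?_, fun u hu => ?_⟩
    · rw [he' 0 c.zero_mem, c.map_zero]
    · rw [Set.mem_ofPred_eq, he' u hu]
      exact ⟨⟨(hc u hu).1, (hc u hu).2.1⟩, by rw [c.z_eq u hu (hc u hu).1, (hc u hu).2.2.1]⟩

/-- The integral over a homology class is well defined. -/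
theorem existsUnique_isPeriod (hm : 0 < m) (ha : Function.Injective a) (hn : n ≠ 0) (i : Fin N)
    {j : ℕ} (hj : 0 < j) (γ : H1 (CycleSurface m n a)) : ∃! v : ℂ, IsPeriod n i j γ v := by
  obtain ⟨T, hT1, hT2⟩ := exists_localPrimitives (n := n) hm ha hn i hj
  obtain ⟨R, c, σ, hσ, hrep⟩ := exists_represents_segments hm ha γ
  -- Segments in the affine part avoid the poles and give existence; uniqueness holds because every
  -- admissible representative has the same integral with respect to `T`.
  refine ⟨∑ r, (c r : ℂ) * T.integral (σ r), ⟨R, c, σ, _, hrep, fun r =>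
    hT2 _ fun t h => ((hσ r).1 t).1 h.2, rfl⟩, ?_⟩
  rintro v ⟨R', c', σ', u, hrep', hu, rfl⟩
  rw [T.sum_integral_eq hrep hrep']
  exact Finset.sum_congr rfl fun r _ => by rw [hT1 _ _ (hu r)]

end Periods

/-! ### Periods of a family independent of the parameter, via a transported cycle -/

section Variation

variable {m N : ℕ} {n : ℤ}

/-- The integral over a class of a family that does not depend on the parameter can be computed
with the transport of a fixed cycle. -/
theorem eventually_sum_integral_eq (hm : 0 < m) {a₁ : Fin N → ℂ} {δ r : ℝ}
    (hadm : Admissible a₁ δ r) {D : Set (Fin N → ℂ)} (hD : IsOpen D)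
    {γ : ∀ a : Fin N → ℂ, H1 (CycleSurface m n a)} (hγ : IsFlat D γ) (ha₁ : a₁ ∈ D) {R : ℕ}
    {c : Fin R → ℤ} {τ : Fin R → C(unitInterval, CycleSurface m n a₁)}
    (hτ : Represents c τ (γ a₁)) :
    ∀ᶠ a in 𝓝 a₁, ∃ ha : a ∈ Metric.ball a₁ r, ∀ (T : LocalPrimitives (CycleSurface m n a))
      (R' : ℕ) (c' : Fin R' → ℤ) (σ' : Fin R' → C(unitInterval, CycleSurface m n a)),
      Represents c' σ' (γ a) → ∑ s, (c' s : ℂ) * T.integral (σ' s) =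
        ∑ s, (c s : ℂ) * T.integral
          ((hadm.transportMap hm n (Metric.mem_ball_self hadm.pos_r) ha).comp (τ s)) := by
  obtain ⟨V, hV, R₀, c₀, σ, hσ, hrep⟩ := hγ a₁ ha₁
  have hnhds : V ∩ D ∩ Metric.ball a₁ r ∈ 𝓝 a₁ :=
    inter_mem (inter_mem hV (hD.mem_nhds ha₁)) (Metric.ball_mem_nhds _ hadm.pos_r)
  obtain ⟨ε, hε, hball⟩ := Metric.mem_nhds_iff.1 hnhds
  filter_upwards [Metric.ball_mem_nhds a₁ hε] with a ha
  have h0 : a₁ ∈ Metric.ball a₁ r := Metric.mem_ball_self hadm.pos_r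
  refine ⟨(hball ha).2, fun T R' c' σ' hrep' => ?_⟩
  -- The straight line of parameters from `a₁` to `a`.
  let A : unitInterval → (Fin N → ℂ) := fun s => a₁ + ((s : ℝ) : ℂ) • (a - a₁)
  have hA : Continuous A := by fun_prop
  have hA0 : A 0 = a₁ := by simp [A]
  have hA1 : A 1 = a := by simp [A]
  have hAball (s) : A s ∈ Metric.ball a₁ ε := by
    rw [mem_ball_iff_norm] at ha ⊢
    simp only [A, add_sub_cancel_left, norm_smul, Complex.norm_real, Real.norm_of_nonneg s.2.1]
    exact (mul_le_of_le_one_left (norm_nonneg _) s.2.2).trans_lt ha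
  have hbase (s k t) : (σ k (A s) t).1.1.base ∈ Metric.ball a₁ r := by
    rw [(σ k (A s) t).1.2]
    exact (hball (hAball s)).2
  -- The cycle over `A s`, transported to the fixed surface with parameter `a`. As `s` varies it is
  -- a homotopy through cycles from the transport of the cycle over `a₁` to the cycle over `a`;
  -- single paths may have moving ends, but these cancel at each time.
  let K (k : Fin R₀) : C(unitInterval × unitInterval, CycleSurface m n a) :=
    { toFun := fun x => ⟨⟨transport δ a (σ k (A x.1) x.2).1.1, base_transport _ _ _⟩,
        hadm.transport_mem_cycleDomain hm (hbase _ _ _) (hball ha).2 (σ k (A x.1) x.2).2⟩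
      continuous_toFun := by
        refine Continuous.subtype_mk (Continuous.subtype_mk ?_ _) _
        refine (hadm.continuousOn_transport hm).comp_continuous
          (f := fun x : unitInterval × unitInterval => ((σ k (A x.1) x.2).1.1, a)) ?_
          fun x => ⟨hbase _ _ _, (hball ha).2⟩
        refine Continuous.prodMk_left a |>.comp ?_
        exact (hσ k).comp_continuous (f := fun x : unitInterval × unitInterval => (A x.1, x.2))
          (by fun_prop) fun x => ⟨(hball (hAball x.1)).1, trivial⟩ }
  have hK := T.sum_integral_eq_of_homotopy c₀ K fun s f =>
    ((hrep (A s) (hball (hAball s)).1).comp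
      (hadm.transportMap hm n (hball (hAball s)).2 (hball ha).2)).sum_eq_zero f
  have e0 (k) : (K k).comp ⟨fun t => (0, t), by fun_prop⟩ =
      (hadm.transportMap hm n h0 (hball ha).2).comp (σ k a₁) := by
    ext t
    change transport δ a (σ k (A 0) t).1.1 = transport δ a (σ k a₁ t).1.1
    rw [hA0]
  have e1 (k) : (K k).comp ⟨fun t => (1, t), by fun_prop⟩ = σ k a := by
    ext t
    change transport δ a (σ k (A 1) t).1.1 = (σ k a t).1.1
    rw [hA1]
    have := hadm.transport_self hm (σ k a t).1.1
    rw [(σ k a t).1.2] at this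
    exact this (hball ha).2
  simp only [e0, e1] at hK
  rw [T.sum_integral_eq hrep' (hrep a (hball ha).1), ← hK]
  exact T.sum_integral_eq ((hrep a₁ ⟨mem_of_mem_nhds hV, ha₁⟩).comp _) (hτ.comp _)

/-- The integral along a path on which `z` is affine. -/
theorem IsPathIntegral.eq_integral {a : Fin N → ℂ} {i : Fin N} {q : ℤ}
    {σ : C(unitInterval, Surface m a)} {v : ℂ} (hv : IsPathIntegral i q σ v)
    (hgood : ∀ t, ¬ (σ t).1.IsInfinite ∧ ¬ (σ t).1.IsBranch) {d : ℂ} (hd : d ≠ 0)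
    (hz : ∀ t : unitInterval, (σ t).1.z = (σ 0).1.z + t * d) :
    v = ∫ t in (0 : ℝ)..1, (σ (Set.projIcc 0 1 zero_le_one t)).1.w ^ q /
      ((σ (Set.projIcc 0 1 zero_le_one t)).1.z - a i) * d := by
  obtain ⟨F, hF, rfl⟩ := hv
  have hw0 (t) : (σ t).1.w ≠ 0 := fun h => (hgood t).2 ((isBranch_iff (hgood t).1).2 h)
  have hz0 (t) : (σ t).1.z - a i ≠ 0 := fun h => by
    have := w_pow_eq (hgood t).1
    rw [Finset.prod_eq_zero (Finset.mem_univ i) h] at this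
    exact pow_ne_zero _ (hw0 t) this
  have hFc : Continuous F := by
    refine continuous_iff_continuousAt.2 fun t₀ => ?_
    obtain ⟨U, h, hU, hmem, hh, hFh⟩ := hF t₀
    have : ContinuousAt (fun t => h (σ t)) t₀ :=
      (hh.1.continuousAt (hU.mem_nhds hmem)).comp σ.continuous.continuousAt
    exact this.congr (hFh.mono fun _ h => h.symm)
  have hwc : Continuous fun t => (σ t).1.w := continuous_iff_continuousAt.2 fun t =>
    ContinuousAt.comp (g := fun Q : Surface m a => Q.1.w) (continuousAt_w (hgood t).1)
      σ.continuous.continuousAt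
  have hzc : Continuous fun t => (σ t).1.z := continuous_iff_continuousAt.2 fun t =>
    ContinuousAt.comp (g := fun Q : Surface m a => Q.1.z) (continuousAt_z (hgood t).1)
      σ.continuous.continuousAt
  have hint : Continuous fun t => (σ t).1.w ^ q / ((σ t).1.z - a i) * d :=
    ((hwc.zpow₀ q fun t => .inl (hw0 t)).div (hzc.sub continuous_const) hz0).mul continuous_const
  -- Projection to the unit interval extends the functions to the real line; the derivative is
  -- needed only inside the interval, where the projection is the identity.
  have key := intervalIntegral.integral_eq_sub_of_hasDerivAt_of_le (zero_le_one (α := ℝ))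
    (f := fun t => F (Set.projIcc 0 1 zero_le_one t))
    (f' := fun t => (σ (Set.projIcc 0 1 zero_le_one t)).1.w ^ q /
      ((σ (Set.projIcc 0 1 zero_le_one t)).1.z - a i) * d)
    (hFc.comp continuous_projIcc).continuousOn (fun t ht => ?_)
    ((hint.comp continuous_projIcc).intervalIntegrable _ _)
  · rw [key, Set.projIcc_right, Set.projIcc_left]
    rfl
  set p : ℝ → unitInterval := Set.projIcc 0 1 zero_le_one with hp
  have hpc : Continuous p := continuous_projIcc
  obtain ⟨U, h, hU, hmem, hh, hFh⟩ := hF (p t)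
  have hval {s : ℝ} (hs : s ∈ Set.Ioo (0 : ℝ) 1) : ((p s : unitInterval) : ℝ) = s := by
    rw [hp, Set.projIcc_of_mem zero_le_one (Set.Ioo_subset_Icc_self hs)]
  have hev : ∀ᶠ s in 𝓝 t, s ∈ Set.Ioo (0 : ℝ) 1 := isOpen_Ioo.mem_nhds ht
  have hzs {s : ℝ} (hs : s ∈ Set.Ioo (0 : ℝ) 1) :
      (σ (p s)).1.z - (σ (p t)).1.z = (s - t) * d := by
    rw [hz, hz (p t), hval hs, hval ht]; ring
  -- Since `d ≠ 0`, the path is injective in `z`. It thus stays off `σ (p t)` for `s ≠ t` in the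
  -- open interval, and the limit defining `dh/dz` may be taken along it.
  have hσlim : Tendsto (fun s => σ (p s)) (𝓝[≠] t) (𝓝[≠] (σ (p t))) := by
    refine tendsto_nhdsWithin_iff.2 ⟨((σ.continuous.comp hpc).continuousAt (x :=
        t)).tendsto.mono_left
      nhdsWithin_le_nhds, ?_⟩
    filter_upwards [nhdsWithin_le_nhds hev, self_mem_nhdsWithin] with s hs hne h
    have := hzs hs
    rw [h, sub_self, eq_comm, mul_eq_zero] at this
    refine this.elim (fun h => hne ?_) hd
    exact_mod_cast sub_eq_zero.1 h
  have hlim := ((hh.2 _ hmem (hgood _).1 (hgood _).2).comp hσlim).mul_const d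
  rw [hasDerivAt_iff_tendsto_slope]
  refine hlim.congr' ?_
  filter_upwards [nhdsWithin_le_nhds hev, self_mem_nhdsWithin,
    nhdsWithin_le_nhds (hpc.continuousAt.eventually hFh)] with s hs hne hFs
  have hst : ((s : ℂ) - t) ≠ 0 := by exact_mod_cast sub_ne_zero.2 hne
  simp only [Function.comp_apply]
  rw [hzs hs, slope, hFs, hFh.self_of_nhds, vsub_eq_sub, Complex.real_smul, Complex.ofReal_inv,
    Complex.ofReal_sub]
  field_simp

theorem Admissible.z_transport {a₁ : Fin N → ℂ} {δ r : ℝ} (hadm : Admissible a₁ δ r) (hm : 0 < m)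
    (a : Fin N → ℂ) {P : Surface m a₁} (hP : ¬ P.1.IsInfinite)
    (hz : ∀ k, 2 * δ ≤ ‖P.1.z - a₁ k‖) : (transport δ a P.1).z = P.1.z := by
  obtain ⟨x | ⟨b, ζ⟩, rfl⟩ := P
  · rw [hadm.transport_aff hm x (Metric.mem_ball_self hadm.pos_r)]
    change x.1.2.1 + displacement δ x.1.1 a x.1.2.1 = x.1.2.1
    have : displacement δ x.1.1 a x.1.2.1 = 0 := Admissible.displacement_eq_zero hadm.pos_δ hz
    rw [this, add_zero]
  · exact absurd ⟨_, _, rfl⟩ hP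

theorem Admissible.w_transport {a₁ : Fin N → ℂ} {δ r : ℝ} (hadm : Admissible a₁ δ r) (hm : 0 < m)
    (a : Fin N → ℂ) {P : Surface m a₁} (hP : ¬ P.1.IsInfinite) :
    (transport δ a P.1).w = P.1.w * rootFactor m δ a₁ a P.1.z := by
  obtain ⟨x | ⟨b, ζ⟩, rfl⟩ := P
  · rw [hadm.transport_aff hm x (Metric.mem_ball_self hadm.pos_r)]
    rfl
  · exact absurd ⟨_, _, rfl⟩ hP

theorem Admissible.ratio_eq {a₁ : Fin N → ℂ} {δ r : ℝ} (hadm : Admissible a₁ δ r)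
    (a : Fin N → ℂ) {z : ℂ} (hz : ∀ k, 2 * δ ≤ ‖z - a₁ k‖) (k : Fin N) :
    ratio δ k a₁ a z = (z - a k) / (z - a₁ k) := by
  have h0 : z - a₁ k ≠ 0 := norm_pos_iff.1 ((mul_pos two_pos hadm.pos_δ).trans_le (hz k))
  rw [ratio, Admissible.displacement_eq_zero hadm.pos_δ hz]
  field_simp
  ring

/-- Away from the branch points the displacement is zero and `ratio` is `(z - a_k) / (z - b_k)`.
Writing the power as an exponential of logarithms makes the dependence on `a` visibly holomorphic.
-/
theorem Admissible.rootFactor_zpow {a₁ : Fin N → ℂ} {δ r : ℝ} (hadm : Admissible a₁ δ r)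
    {a : Fin N → ℂ} (ha : a ∈ Metric.ball a₁ r) {z : ℂ} (hz : ∀ k, 2 * δ ≤ ‖z - a₁ k‖) (q : ℤ) :
    rootFactor m δ a₁ a z ^ q =
      Complex.exp ((q / m : ℂ) * ∑ k, Complex.log ((z - a k) / (z - a₁ k))) := by
  have h (k) : ratio δ k a₁ a z ^ ((m : ℂ)⁻¹) =
      Complex.exp (Complex.log ((z - a k) / (z - a₁ k)) * (m : ℂ)⁻¹) := by
    have hne : ratio δ k a₁ a z ≠ 0 := Complex.slitPlane_ne_zero
      (hadm.ratio_mem_slitPlane (Metric.mem_ball_self hadm.pos_r) ha k z)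
    rw [Complex.cpow_def_of_ne_zero hne, hadm.ratio_eq a hz]
  rw [rootFactor, Finset.prod_congr rfl fun k _ => h k, ← Complex.exp_sum, ← Complex.exp_int_mul,
    ← Finset.sum_mul]
  congr 1
  ring

end Variation

/-! ### Differentiation under the integral sign with respect to the parameter -/

section Calculus

variable {N : ℕ} (κ : ℂ) (b : Fin N → ℂ) (ζ C : ℝ → ℂ) (i : Fin N)

/-- The differential, along a fixed path in the `z`-plane, as a function of the parameter. -/
def periodIntegrand (a : Fin N → ℂ) (t : ℝ) : ℂ :=
  C t * Complex.exp (κ * ∑ k, Complex.log ((ζ t - a k) / (ζ t - b k))) / (ζ t - a i)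

/-- The logarithmic derivative of `w ^ q / (z - a_i)` with respect to the parameter, for
`κ = q / m`. -/
def logDifferential (a : Fin N → ℂ) (z : ℂ) : (Fin N → ℂ) →L[ℂ] ℂ :=
  (z - a i)⁻¹ • ContinuousLinearMap.proj (R := ℂ) (φ := fun _ : Fin N => ℂ) i -
    ∑ k, (κ * (z - a k)⁻¹) • ContinuousLinearMap.proj (R := ℂ) (φ := fun _ : Fin N => ℂ) k

theorem logDifferential_single_of_ne (a : Fin N → ℂ) (z : ℂ) {j : Fin N} (h : i ≠ j) :
    logDifferential κ i a z (Pi.single j 1) = -(κ * (z - a j)⁻¹) := by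
  simp [logDifferential, Pi.single_apply, h]

theorem logDifferential_single_self (a : Fin N → ℂ) (z : ℂ) :
    logDifferential κ i a z (Pi.single i 1) = (z - a i)⁻¹ - κ * (z - a i)⁻¹ := by
  simp [logDifferential, Pi.single_apply]

variable {κ b ζ C i}

theorem periodIntegrand_self {t : ℝ} (h : ∀ k, ζ t - b k ≠ 0) :
    periodIntegrand κ b ζ C i b t = C t / (ζ t - b i) := by
  simp [periodIntegrand, div_self (h _)]

theorem hasFDerivAt_periodIntegrand {a : Fin N → ℂ} {t : ℝ}
    (h : ∀ k, (ζ t - a k) / (ζ t - b k) ∈ Complex.slitPlane) :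
    HasFDerivAt (fun a => periodIntegrand κ b ζ C i a t)
      (periodIntegrand κ b ζ C i a t • logDifferential κ i a (ζ t)) a := by
  have hne (k) : ζ t - a k ≠ 0 ∧ ζ t - b k ≠ 0 := by
    have := Complex.slitPlane_ne_zero (h k)
    exact ⟨fun h => this (by rw [h, zero_div]), fun h => this (by rw [h, div_zero])⟩
  have hsub (k) : HasFDerivAt (fun a : Fin N → ℂ => ζ t - a k)
      (-ContinuousLinearMap.proj (R := ℂ) (φ := fun _ : Fin N => ℂ) k) a :=
    (ContinuousLinearMap.proj (R := ℂ) (φ := fun _ : Fin N => ℂ) k).hasFDerivAt.const_sub _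
  have hlog (k) : HasFDerivAt (fun a : Fin N → ℂ => Complex.log ((ζ t - a k) / (ζ t - b k)))
      (-((ζ t - a k)⁻¹ • ContinuousLinearMap.proj (R := ℂ) (φ := fun _ : Fin N => ℂ) k)) a := by
    have h1 : HasFDerivAt (fun a : Fin N → ℂ => (ζ t - a k) / (ζ t - b k))
        ((ζ t - b k)⁻¹ • -ContinuousLinearMap.proj (R := ℂ) (φ := fun _ : Fin N => ℂ) k) a := by
      simpa only [div_eq_mul_inv] using (hsub k).mul_const ((ζ t - b k)⁻¹)
    refine (h1.clog (h k)).congr_fderiv ?_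
    obtain ⟨h2, h3⟩ := hne k
    ext v
    simp
    field_simp
  have hexp := ((HasFDerivAt.fun_sum (u := Finset.univ) fun k _ => hlog k).const_mul κ).cexp
  have hinv : HasFDerivAt (fun a : Fin N → ℂ => (ζ t - a i)⁻¹)
      (-((ζ t - a i) ^ 2)⁻¹ • -ContinuousLinearMap.proj (R := ℂ) (φ := fun _ : Fin N => ℂ) i) a :=
    (hasDerivAt_inv (hne i).1).comp_hasFDerivAt a (hsub i)
  have := (hexp.const_mul (C t)).mul hinv
  simp only [periodIntegrand, div_eq_mul_inv] at this ⊢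
  refine this.congr_fderiv ?_
  ext v
  simp [logDifferential, Finset.mul_sum]
  rw [mul_sub, Finset.mul_sum, ← sub_eq_add_neg]
  congr 1
  · rw [pow_two, mul_inv]
    ring
  · exact Finset.sum_congr rfl fun k _ => by ring

theorem continuousOn_periodIntegrand (hζ : Continuous ζ) (hC : Continuous C)
    {V : Set (Fin N → ℂ)} (hV : ∀ a ∈ V, ∀ t k, (ζ t - a k) / (ζ t - b k) ∈ Complex.slitPlane) :
    ContinuousOn (fun x : (Fin N → ℂ) × ℝ => periodIntegrand κ b ζ C i x.1 x.2)
      (V ×ˢ Set.univ) ∧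
    ContinuousOn (fun x : (Fin N → ℂ) × ℝ => logDifferential κ i x.1 (ζ x.2)) (V ×ˢ Set.univ) := by
  have hne (x : (Fin N → ℂ) × ℝ) (hx : x ∈ V ×ˢ Set.univ) (k) :
      ζ x.2 - x.1 k ≠ 0 ∧ ζ x.2 - b k ≠ 0 := by
    have := Complex.slitPlane_ne_zero (hV x.1 hx.1 x.2 k)
    exact ⟨fun h => this (by rw [h, zero_div]), fun h => this (by rw [h, div_zero])⟩
  have hsub (k) : ContinuousOn (fun x : (Fin N → ℂ) × ℝ => ζ x.2 - x.1 k) (V ×ˢ Set.univ) := by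
    fun_prop
  have hinv (k) : ContinuousOn (fun x : (Fin N → ℂ) × ℝ => (ζ x.2 - x.1 k)⁻¹) (V ×ˢ Set.univ) :=
    (hsub k).inv₀ fun x hx => (hne x hx k).1
  constructor
  · refine ContinuousOn.div (ContinuousOn.mul (by fun_prop) (ContinuousOn.cexp
      (continuousOn_const.mul (continuousOn_finsetSum _ fun k _ => ContinuousOn.clog
        ((hsub k).div (by fun_prop) fun x hx => (hne x hx k).2) fun x hx => hV x.1 hx.1 x.2 k))))
      (hsub i) fun x hx => (hne x hx i).1
  · exact ((hinv i).smul continuousOn_const).sub (continuousOn_finsetSum _ fun k _ =>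
      (continuousOn_const.mul (hinv k)).smul continuousOn_const)

theorem hasFDerivAt_integral_periodIntegrand (hζ : Continuous ζ) (hC : Continuous C)
    {V : Set (Fin N → ℂ)} (hVo : V ∈ 𝓝 b)
    (hV : ∀ a ∈ V, ∀ t k, (ζ t - a k) / (ζ t - b k) ∈ Complex.slitPlane) :
    HasFDerivAt (fun a => ∫ t in (0 : ℝ)..1, periodIntegrand κ b ζ C i a t)
      (∫ t in (0 : ℝ)..1, periodIntegrand κ b ζ C i b t • logDifferential κ i b (ζ t)) b := by
  obtain ⟨ρ, hρ, hball⟩ := Metric.nhds_basis_closedBall.mem_iff.1 hVo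
  obtain ⟨h1, h2⟩ := continuousOn_periodIntegrand (κ := κ) (i := i) hζ hC hV
  have h3 := h1.smul h2
  have hbV : b ∈ V := mem_of_mem_nhds hVo
  have hslice (a) (ha : a ∈ V) : Continuous (fun t => periodIntegrand κ b ζ C i a t) :=
    h1.comp_continuous (f := fun t : ℝ => (a, t)) (by fun_prop) fun t => ⟨ha, trivial⟩
  have hslice' : Continuous (fun t => periodIntegrand κ b ζ C i b t • logDifferential κ i b (ζ
      t)) :=
    h3.comp_continuous (f := fun t : ℝ => (b, t)) (by fun_prop) fun t => ⟨hbV, trivial⟩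
  -- The dominating function is a constant, by compactness of a closed ball of parameters times the
  -- unit interval.
  obtain ⟨M, hM⟩ := ((isCompact_closedBall b ρ).prod
    (isCompact_Icc (a := (0 : ℝ)) (b := 1))).exists_bound_of_continuousOn
    (h3.mono (Set.prod_mono hball (Set.subset_univ _)))
  refine intervalIntegral.hasFDerivAt_integral_of_dominated_of_fderiv_le
    (F' := fun a t => periodIntegrand κ b ζ C i a t • logDifferential κ i a (ζ t))
    (bound := fun _ => M) (Metric.ball_mem_nhds b hρ) ?_ ((hslice b hbV).intervalIntegrable _ _)
    hslice'.aestronglyMeasurable ?_ intervalIntegrable_const ?_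
  · filter_upwards [hVo] with a ha using (hslice a ha).aestronglyMeasurable
  · refine .of_forall fun t ht a ha => hM (a, t) ⟨Metric.ball_subset_closedBall ha, ?_⟩
    rw [Set.uIoc_of_le zero_le_one] at ht
    exact Set.Ioc_subset_Icc_self ht
  · exact .of_forall fun t _ a ha =>
      hasFDerivAt_periodIntegrand (hV a (hball (Metric.ball_subset_closedBall ha)) t)

/-- Factor `f(s) ^ m - f(t) ^ m` as `f(s) - f(t)` times a sum tending to `m f(t) ^ (m - 1) ≠ 0`, and
divide. This gives the derivative of `w` along a path from the equation of the curve. -/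
theorem hasDerivAt_of_pow_eq {m : ℕ} (hm : 0 < m) {f p : ℝ → ℂ} {p' : ℂ} {t : ℝ}
    (hf : ContinuousAt f t) (h0 : f t ≠ 0) (hp : HasDerivAt p p' t) (h : ∀ s, f s ^ m = p s) :
    HasDerivAt f (p' / (m * f t ^ (m - 1))) t := by
  rw [hasDerivAt_iff_tendsto_slope] at hp ⊢
  have hS : Tendsto (fun s => ∑ k ∈ Finset.range m, f s ^ k * f t ^ (m - 1 - k)) (𝓝[≠] t)
      (𝓝 (m * f t ^ (m - 1))) := by
    have e : ∑ k ∈ Finset.range m, f t ^ k * f t ^ (m - 1 - k) = m * f t ^ (m - 1) := by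
      rw [Finset.sum_congr rfl (g := fun _ => f t ^ (m - 1)), Finset.sum_const, Finset.card_range,
        nsmul_eq_mul]
      intro k hk
      rw [← pow_add, Nat.add_sub_cancel' (by have := Finset.mem_range.1 hk; omega)]
    rw [← e]
    exact tendsto_finsetSum _ fun k _ =>
      ((hf.tendsto.mono_left nhdsWithin_le_nhds).pow k).mul_const _
  have h1 : (m : ℂ) * f t ^ (m - 1) ≠ 0 :=
    mul_ne_zero (Nat.cast_ne_zero.2 hm.ne') (pow_ne_zero _ h0)
  refine (hp.div hS h1).congr' ?_
  filter_upwards [hS.eventually_ne h1] with s hs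
  simp only [slope, vsub_eq_sub, Complex.real_smul, Pi.div_apply, ← h]
  rw [div_eq_iff hs, ← (Commute.all _ _).geom_sum₂_mul]
  ring

end Calculus

/-! ### Partial derivatives of the integral over a cycle of segments -/

section Variation

variable {m N : ℕ} {n : ℤ}

/-- A cycle in the surface with parameter `b`, given by the functions `z`, `w` on its paths. The
functions `z` have a constant derivative on `(0, 1)`. -/
structure SegmentCycle (m : ℕ) (b : Fin N → ℂ) where
  /-- The number of paths. -/
  R : ℕ
  /-- The multiplicities. -/
  c : Fin R → ℤ
  /-- The function `z` on the paths. -/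
  ζ : Fin R → ℝ → ℂ
  /-- The function `w` on the paths. -/
  w : Fin R → ℝ → ℂ
  /-- The derivative of `z`. -/
  d : Fin R → ℂ
  continuous_ζ : ∀ s, Continuous (ζ s)
  continuous_w : ∀ s, Continuous (w s)
  w_pow : ∀ s t, w s t ^ m = ∏ k, (ζ s t - b k)
  w_ne : ∀ s t, w s t ≠ 0
  hasDerivAt : ∀ s, ∀ t ∈ Set.Ioo (0 : ℝ) 1, HasDerivAt (ζ s) (d s) t
  closed : ∀ f : ℂ → ℂ → ℂ, ∑ s, (c s : ℂ) * (f (ζ s 1) (w s 1) - f (ζ s 0) (w s 0)) = 0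

namespace SegmentCycle

variable {b : Fin N → ℂ} (S : SegmentCycle m b)

theorem sub_ne_zero (s : Fin S.R) (t : ℝ) (k : Fin N) : S.ζ s t - b k ≠ 0 := fun h => by
  have := S.w_pow s t
  rw [Finset.prod_eq_zero (Finset.mem_univ k) h] at this
  exact pow_ne_zero _ (S.w_ne s t) this

/-- The integral over the cycle, transported to the surface with parameter `a`. -/
def period (q : ℤ) (i : Fin N) (a : Fin N → ℂ) : ℂ :=
  ∑ s, (S.c s : ℂ) * ∫ t in (0 : ℝ)..1,
    periodIntegrand (q / m) b (S.ζ s) (fun t => S.w s t ^ q * S.d s) i a t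

variable {S} {V : Set (Fin N → ℂ)} (hVo : V ∈ 𝓝 b)
  (hV : ∀ a ∈ V, ∀ s t k, (S.ζ s t - a k) / (S.ζ s t - b k) ∈ Complex.slitPlane)

variable (S) in
theorem continuous_coeff (q : ℤ) (s : Fin S.R) : Continuous fun t => S.w s t ^ q * S.d s :=
  ((S.continuous_w s).zpow₀ q fun t => .inl (S.w_ne s t)).mul continuous_const

variable (S) in
theorem continuous_div (q : ℤ) (s : Fin S.R) (i : Fin N) :
    Continuous fun t => S.w s t ^ q * S.d s / (S.ζ s t - b i) :=
  (S.continuous_coeff q s).div ((S.continuous_ζ s).sub continuous_const) fun t => S.sub_ne_zero s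
      t i

variable (S) in
theorem continuous_div_div (q : ℤ) (s : Fin S.R) (i j : Fin N) :
    Continuous fun t => S.w s t ^ q * S.d s / (S.ζ s t - b i) / (S.ζ s t - b j) :=
  (S.continuous_div q s i).div ((S.continuous_ζ s).sub continuous_const) fun t => S.sub_ne_zero s
      t j

variable (S) in
theorem period_self (q : ℤ) (i : Fin N) : S.period q i b =
    ∑ s, (S.c s : ℂ) * ∫ t in (0 : ℝ)..1, S.w s t ^ q * S.d s / (S.ζ s t - b i) := by
  refine Finset.sum_congr rfl fun s _ => ?_
  congr 2
  funext t
  exact periodIntegrand_self fun k => S.sub_ne_zero s t k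

include hVo hV

theorem hasFDerivAt_period (q : ℤ) (i : Fin N) :
    HasFDerivAt (S.period q i) (∑ s, (S.c s : ℂ) • ∫ t in (0 : ℝ)..1,
      (S.w s t ^ q * S.d s / (S.ζ s t - b i)) • logDifferential (q / m) i b (S.ζ s t)) b := by
  have := HasFDerivAt.fun_sum (u := Finset.univ) fun s _ =>
    (hasFDerivAt_integral_periodIntegrand (κ := (q / m : ℂ)) (i := i) (S.continuous_ζ s)
      (S.continuous_coeff q s) hVo fun a ha t k => hV a ha s t k).const_mul (S.c s : ℂ)
  refine this.congr_fderiv (Finset.sum_congr rfl fun s _ => ?_)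
  congr 2
  funext t
  rw [periodIntegrand_self fun k => S.sub_ne_zero s t k]

theorem fderiv_period_apply (q : ℤ) (i : Fin N) (v : Fin N → ℂ) :
    fderiv ℂ (S.period q i) b v = ∑ s, (S.c s : ℂ) * ∫ t in (0 : ℝ)..1,
      (S.w s t ^ q * S.d s / (S.ζ s t - b i)) * logDifferential (q / m) i b (S.ζ s t) v := by
  rw [(hasFDerivAt_period hVo hV q i).fderiv, _root_.sum_apply]
  refine Finset.sum_congr rfl fun s _ => ?_
  rw [_root_.smul_apply, smul_eq_mul, ContinuousLinearMap.intervalIntegral_apply]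
  · rfl
  · refine Continuous.intervalIntegrable ?_ _ _
    refine (S.continuous_div q s i).smul ?_
    exact (continuousOn_periodIntegrand (κ := (q / m : ℂ)) (i := i) (S.continuous_ζ s)
      (S.continuous_coeff q s) fun a ha t k => hV a ha s t k).2.comp_continuous
      (f := fun t : ℝ => (b, t)) (by fun_prop) fun t => ⟨mem_of_mem_nhds hVo, trivial⟩

/-- For `j ≠ i` only `w` contributes, giving `-(q / m) w ^ q / ((z - b_i) (z - b_j))`; partial
fractions express it through the integrands of `Ω_i` and `Ω_j`. -/
theorem fderiv_period_single (hb : Function.Injective b) (q : ℤ) {i j : Fin N} (hij : i ≠ j) :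
    fderiv ℂ (S.period q i) b (Pi.single j 1) =
      (q / m) * (S.period q j b - S.period q i b) / (b i - b j) := by
  have hbij : b i - b j ≠ 0 := _root_.sub_ne_zero.2 fun h => hij (hb h)
  rw [fderiv_period_apply hVo hV, period_self, period_self, ← Finset.sum_sub_distrib,
    Finset.mul_sum, Finset.sum_div]
  refine Finset.sum_congr rfl fun s _ => ?_
  rw [← mul_sub, ← intervalIntegral.integral_sub ((S.continuous_div q s j).intervalIntegrable _ _)
    ((S.continuous_div q s i).intervalIntegrable _ _), mul_left_comm, mul_div_assoc]
  congr 1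
  rw [← intervalIntegral.integral_const_mul, ← intervalIntegral.integral_div]
  congr 1
  funext t
  rw [logDifferential_single_of_ne _ _ _ _ hij]
  have h1 := S.sub_ne_zero s t i
  have h2 := S.sub_ne_zero s t j
  field_simp
  ring

/-- Moving all branch points together is a translation: the sum of all partial derivatives of the
integrand is that of `-d(w ^ q / (z - b_i))`, whose integral over a cycle is zero. -/
theorem fderiv_period_single_self (hm : 0 < m) (q : ℤ) (i : Fin N) :
    fderiv ℂ (S.period q i) b (Pi.single i 1) =
      - ∑ j ∈ Finset.univ.erase i, fderiv ℂ (S.period q i) b (Pi.single j 1) := by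
  rw [eq_neg_iff_add_eq_zero, Finset.add_sum_erase _
    (fun j => fderiv ℂ (S.period q i) b (Pi.single j 1)) (Finset.mem_univ i)]
  have hmC : (m : ℂ) ≠ 0 := Nat.cast_ne_zero.2 hm.ne'
  -- the sum of the partial derivatives is the integral of an exact differential
  have hexact (s) : ∫ t in (0 : ℝ)..1, ((q / m : ℂ) * ∑ k, S.w s t ^ q * S.d s / (S.ζ s t - b i) /
      (S.ζ s t - b k) - S.w s t ^ q * S.d s / (S.ζ s t - b i) / (S.ζ s t - b i)) =
      S.w s 1 ^ q / (S.ζ s 1 - b i) - S.w s 0 ^ q / (S.ζ s 0 - b i) := by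
    refine intervalIntegral.integral_eq_sub_of_hasDerivAt_of_le zero_le_one
      (f := fun t => S.w s t ^ q / (S.ζ s t - b i)) ?_ (fun t ht => ?_) ?_
    · exact (((S.continuous_w s).zpow₀ q fun t => .inl (S.w_ne s t)).div
        ((S.continuous_ζ s).sub continuous_const) fun t => S.sub_ne_zero s t i).continuousOn
    · have hζ := S.hasDerivAt s t ht
      have hsub (k) : HasDerivAt (fun t => S.ζ s t - b k) (S.d s) t := hζ.sub_const _
      have hprod : HasDerivAt (fun t => ∏ k, (S.ζ s t - b k))
          (S.w s t ^ m * S.d s * ∑ k, (S.ζ s t - b k)⁻¹) t := by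
        refine (HasDerivAt.fun_finsetProd (u := Finset.univ) fun k _ => hsub k).congr_deriv ?_
        rw [Finset.mul_sum]
        refine Finset.sum_congr rfl fun k _ => ?_
        rw [S.w_pow, ← Finset.mul_prod_erase _ _ (Finset.mem_univ k), smul_eq_mul]
        have := S.sub_ne_zero s t k
        field_simp
      have hw := hasDerivAt_of_pow_eq hm (S.continuous_w s).continuousAt (S.w_ne s t) hprod
          (S.w_pow s)
      have hwq := (hasDerivAt_zpow q (S.w s t) (.inl (S.w_ne s t))).comp t hw
      refine (hwq.div (hsub i) (S.sub_ne_zero s t i)).congr_deriv ?_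
      have h1 := S.sub_ne_zero s t i
      have h2 := S.w_ne s t
      have h3 : S.w s t ^ (q - 1) = S.w s t ^ q / S.w s t := zpow_sub_one₀ h2 q
      obtain ⟨m', rfl⟩ := Nat.exists_eq_succ_of_ne_zero hm.ne'
      simp only [h3, Function.comp_apply, Nat.succ_eq_add_one, Nat.add_sub_cancel,
        div_eq_mul_inv _ (S.ζ s t - b _), ← Finset.mul_sum]
      generalize ∑ k, (S.ζ s t - b k)⁻¹ = X
      field_simp
      ring
    · refine Continuous.intervalIntegrable ?_ _ _
      exact (continuous_const.mul (continuous_finsetSum _ fun k _ => S.continuous_div_div q s i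
          k)).sub
        (S.continuous_div_div q s i i)
  -- On a closed cycle the boundary values of `w ^ q / (z - b_i)` cancel.
  have hclosed := S.closed fun z w => w ^ q / (z - b i)
  simp only [← hexact] at hclosed
  rw [← neg_eq_zero, ← hclosed]
  simp only [fderiv_period_apply hVo hV]
  rw [Finset.sum_comm, ← Finset.sum_neg_distrib]
  refine Finset.sum_congr rfl fun s _ => ?_
  rw [← Finset.mul_sum, ← mul_neg]
  congr 1
  have hlog (k t) : S.w s t ^ q * S.d s / (S.ζ s t - b i) *
      logDifferential (q / m) i b (S.ζ s t) (Pi.single k 1) =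
      (if k = i then S.w s t ^ q * S.d s / (S.ζ s t - b i) / (S.ζ s t - b i) else 0) -
        (q / m) * (S.w s t ^ q * S.d s / (S.ζ s t - b i) / (S.ζ s t - b k)) := by
    split_ifs with h
    · subst h
      rw [logDifferential_single_self]; ring
    · rw [logDifferential_single_of_ne _ _ _ _ (Ne.symm h)]; ring
  rw [← intervalIntegral.integral_finsetSum, ← intervalIntegral.integral_neg]
  · congr 1
    funext t
    simp only [hlog]
    rw [Finset.sum_sub_distrib, Finset.mul_sum]
    simp
  · intro k _
    simp only [hlog]
    refine Continuous.intervalIntegrable (Continuous.sub ?_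
      (continuous_const.mul (S.continuous_div_div q s i k))) _ _
    split_ifs
    · exact S.continuous_div_div q s i i
    · exact continuous_const

end SegmentCycle

end Variation

/-! ### Derivatives of the periods of families independent of the parameter -/

section Schlesinger

variable {m N : ℕ} {n : ℤ}

theorem IsPeriod.eq_sum_integral {a : Fin N → ℂ} {i : Fin N} {j : ℕ} {γ : H1 (CycleSurface m n a)}
    {v : ℂ} (hv : IsPeriod n i j γ v) {T : LocalPrimitives (CycleSurface m n a)}
    (hT : ∀ (σ : C(unitInterval, CycleSurface m n a)) (v : ℂ), IsPathIntegral i (j * n)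
      ((ContinuousMap.mk Subtype.val continuous_subtype_val).comp σ) v → T.integral σ = v) :
    ∃ (R : ℕ) (c : Fin R → ℤ) (σ : Fin R → C(unitInterval, CycleSurface m n a)),
      Represents c σ γ ∧ v = ∑ r, (c r : ℂ) * T.integral (σ r) := by
  obtain ⟨R, c, σ, u, hrep, hu, rfl⟩ := hv
  exact ⟨R, c, σ, hrep, Finset.sum_congr rfl fun r _ => by rw [hT _ _ (hu r)]⟩

/-- Near a given parameter, the periods over a class that does not depend on the parameter are the
integrals over a cycle of segments. -/
theorem exists_segmentCycle (hm : 0 < m) (hn : n ≠ 0) {D : Set (Fin N → ℂ)} (hD : IsOpen D)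
    (hinj : ∀ a ∈ D, Function.Injective a) {γ : ∀ a : Fin N → ℂ, H1 (CycleSurface m n a)}
    (hγ : IsFlat D γ) {b : Fin N → ℂ} (hb : b ∈ D) :
    ∃ S : SegmentCycle m b,
      (∀ᶠ a in 𝓝 b, ∀ s t k, (S.ζ s t - a k) / (S.ζ s t - b k) ∈ Complex.slitPlane) ∧
      ∀ (i : Fin N) (j : ℕ), 0 < j → ∀ᶠ a in 𝓝 b, ∀ v, IsPeriod n i j (γ a) v →
        v = S.period (j * n) i a := by
  obtain ⟨R, c, τ, hτ, hrep⟩ := exists_represents_segments hm (hinj b hb) (γ b)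
  have hgood (s t) := (hτ s).1 t
  choose d hd hz using fun s => (hτ s).2
  let p : ℝ → unitInterval := Set.projIcc 0 1 zero_le_one
  have hpc : Continuous p := continuous_projIcc
  have hp0 : p 0 = 0 := Set.projIcc_left _
  have hp1 : p 1 = 1 := Set.projIcc_right _
  have hzc (s) : Continuous fun t => (τ s t).1.1.z := continuous_iff_continuousAt.2 fun t =>
    ContinuousAt.comp (g := fun Q : Surface m b => Q.1.z) (f := fun t => (τ s t).1)
      (continuousAt_z (hgood s t).1) (by fun_prop)
  have hwc (s) : Continuous fun t => (τ s t).1.1.w := continuous_iff_continuousAt.2 fun t =>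
    ContinuousAt.comp (g := fun Q : Surface m b => Q.1.w) (f := fun t => (τ s t).1)
      (continuousAt_w (hgood s t).1) (by fun_prop)
  have hw0 (s t) : (τ s t).1.1.w ≠ 0 := fun h =>
    (hgood s t).2 ((isBranch_iff (hgood s t).1).2 h)
  let S : SegmentCycle m b :=
    { R := R
      c := c
      ζ := fun s t => (τ s (p t)).1.1.z
      w := fun s t => (τ s (p t)).1.1.w
      d := d
      continuous_ζ := fun s => (hzc s).comp hpc
      continuous_w := fun s => (hwc s).comp hpc
      w_pow := fun s t => w_pow_eq (hgood s (p t)).1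
      w_ne := fun s t => hw0 s (p t)
      hasDerivAt := fun s t ht => by
        have h1 : HasDerivAt (fun t : ℝ => (τ s 0).1.1.z + t * d s) (d s) t := by
          simpa using (((hasDerivAt_id t).ofReal_comp).mul_const (d s)).const_add (τ s 0).1.1.z
        refine h1.congr_of_eventuallyEq ?_
        filter_upwards [isOpen_Ioo.mem_nhds ht] with t' ht'
        rw [hz s (p t')]
        simp only [p, Set.projIcc_of_mem zero_le_one (Set.Ioo_subset_Icc_self ht')]
      closed := fun f => by
        simp only [hp0, hp1]
        exact hrep.sum_eq_zero fun y => f y.1.1.z y.1.1.w }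
  -- A positive distance, by compactness, between the cycle in the `z`-plane and the branch points.
  obtain ⟨η, hη, hfar⟩ : ∃ η > 0, ∀ k s t, η ≤ ‖(τ s t).1.1.z - b k‖ := by
    have hpos : ∀ᶠ η in 𝓝[>] (0 : ℝ), ∀ k s, ∀ t, η ≤ ‖(τ s t).1.1.z - b k‖ := by
      refine eventually_all.2 fun k => eventually_all.2 fun s => ?_
      obtain ⟨t₀, -, ht₀⟩ := isCompact_univ.exists_isMinOn Set.univ_nonempty
        (f := fun t => ‖(τ s t).1.1.z - b k‖) ((hzc s).sub continuous_const).norm.continuousOn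
      have h0 : 0 < ‖(τ s t₀).1.1.z - b k‖ := norm_pos_iff.2 fun h => by
        have := w_pow_eq (hgood s t₀).1
        rw [Finset.prod_eq_zero (Finset.mem_univ k) h] at this
        exact pow_ne_zero _ (hw0 s t₀) this
      filter_upwards [mem_nhdsWithin_of_mem_nhds (Iic_mem_nhds h0)] with η hη t
      exact (Set.mem_Iic.1 hη).trans (ht₀ (Set.mem_univ t))
    obtain ⟨η, h1, h2⟩ := (hpos.and self_mem_nhdsWithin).exists
    exact ⟨η, h2, h1⟩
  -- With `δ ≤ η / 2` the cycle lies outside the discs in which transport moves `z`.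
  obtain ⟨δ, r, hδ, hadm⟩ := exists_admissible b (hinj b hb) (half_pos hη)
  have hfar' (s t k) : 2 * δ ≤ ‖(τ s t).1.1.z - b k‖ := by linarith [hfar k s t]
  have h0 : b ∈ Metric.ball b r := Metric.mem_ball_self hadm.pos_r
  refine ⟨S, ?_, fun i j hj => ?_⟩
  · filter_upwards [Metric.ball_mem_nhds b hadm.pos_r] with a ha s t k
    have := hadm.ratio_mem_slitPlane h0 ha k (τ s (p t)).1.1.z
    rwa [hadm.ratio_eq a (hfar' s (p t))] at this
  · filter_upwards [eventually_sum_integral_eq hm hadm hD hγ hb hrep, hD.mem_nhds hb]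
      with a ⟨ha, hper⟩ haD v hv
    obtain ⟨T, hT1, hT2⟩ := exists_localPrimitives (n := n) hm (hinj a haD) hn i hj
    obtain ⟨R', c', σ', hrep', rfl⟩ := hv.eq_sum_integral hT1
    rw [hper T R' c' σ' hrep']
    refine Finset.sum_congr rfl fun s _ => ?_
    congr 1
    have hbase (t) : (τ s t).1.1.base ∈ Metric.ball b r := by rw [(τ s t).1.2]; exact h0
    have hgood' (t) : ¬ (transport δ a (τ s t).1.1).IsInfinite ∧
        ¬ (transport δ a (τ s t).1.1).IsBranch := by
      rw [hadm.isInfinite_transport_iff hm _ (hbase t),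
        hadm.isBranch_transport_iff hm _ (hbase t) a ha]
      exact hgood s t
    have hzt (t) : (transport δ a (τ s t).1.1).z = (τ s t).1.1.z :=
      hadm.z_transport hm a (hgood s t).1 (hfar' s t)
    have hint := (hT2 ((hadm.transportMap hm n h0 ha).comp (τ s))
      fun t h => (hgood' t).1 h.2).eq_integral hgood' (hd s) fun t => by
        change (transport δ a (τ s t).1.1).z = (transport δ a (τ s 0).1.1).z + _
        rw [hzt, hzt]
        exact hz s t
    rw [hint]
    congr 1
    funext t
    change (transport δ a (τ s (p t)).1.1).w ^ ((j : ℤ) * n) /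
      ((transport δ a (τ s (p t)).1.1).z - a i) * d s =
      (τ s (p t)).1.1.w ^ ((j : ℤ) * n) * d s * Complex.exp _ / ((τ s (p t)).1.1.z - a i)
    rw [hzt, hadm.w_transport hm a (hgood s (p t)).1, mul_zpow,
      hadm.rootFactor_zpow ha (hfar' s (p t))]
    ring

/-- The partial derivatives of the periods. -/
theorem fderiv_of_isPeriod (hm : 0 < m) (hn : n ≠ 0) {D : Set (Fin N → ℂ)} (hD : IsOpen D)
    (hinj : ∀ a ∈ D, Function.Injective a) {γ : ∀ a : Fin N → ℂ, H1 (CycleSurface m n a)}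
    (hγ : IsFlat D γ) {j : ℕ} (hj : 0 < j) {v : Fin N → (Fin N → ℂ) → ℂ}
    (hv : ∀ i, ∀ a ∈ D, IsPeriod n i j (γ a) (v i a)) {b : Fin N → ℂ} (hb : b ∈ D) :
    (∀ i, DifferentiableAt ℂ (v i) b) ∧
    (∀ i k, i ≠ k → fderiv ℂ (v i) b (Pi.single k 1) =
      (j * n / m : ℂ) * (v k b - v i b) / (b i - b k)) ∧
    ∀ i, fderiv ℂ (v i) b (Pi.single i 1) =
      - ∑ k ∈ Finset.univ.erase i, (j * n / m : ℂ) * (v k b - v i b) / (b i - b k) := by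
  obtain ⟨S, hV, hS⟩ := exists_segmentCycle hm hn hD hinj hγ hb
  have hev (i) : v i =ᶠ[𝓝 b] S.period (j * n) i := by
    filter_upwards [hS i j hj, hD.mem_nhds hb] with a ha haD
    exact ha _ (hv i a haD)
  have hsingle (i k) (hik : i ≠ k) : fderiv ℂ (S.period (j * n) i) b (Pi.single k 1) =
      (j * n / m : ℂ) * (v k b - v i b) / (b i - b k) := by
    rw [SegmentCycle.fderiv_period_single hV (fun a ha => ha) (hinj b hb) _ hik,
      (hev i).eq_of_nhds, (hev k).eq_of_nhds]
    push_cast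
    rfl
  refine ⟨fun i => ?_, fun i k hik => ?_, fun i => ?_⟩
  · exact ((SegmentCycle.hasFDerivAt_period hV (fun a ha => ha) _
        i).differentiableAt).congr_of_eventuallyEq
      (hev i)
  · rw [(hev i).fderiv_eq, hsingle i k hik]
  · rw [(hev i).fderiv_eq, SegmentCycle.fderiv_period_single_self hV (fun a ha => ha) hm]
    exact congrArg _ (Finset.sum_congr rfl fun k hk => hsingle i k (Finset.ne_of_mem_erase hk).symm)

end Schlesinger

/-! ### Commutators of the triangular matrices -/

section Matrices

variable {p N : ℕ} {β : Fin N → Fin p → ℂ} {κ : ℂ}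

theorem sub_eq_of_forall_succ
    (hβ : ∀ (i : Fin N) (k l : Fin p), (l : ℕ) = (k : ℕ) + 1 → β i k - β i l = κ) (i : Fin N) (d
        : ℕ)
    (k l : Fin p) (h : (l : ℕ) = k + d) : β i k - β i l = d * κ := by
  induction d generalizing l with
  | zero =>
    have : l = k := Fin.ext h
    simp [this]
  | succ d ih =>
    have := ih ⟨k + d, by omega⟩ rfl
    have h2 := hβ i ⟨k + d, by omega⟩ l h
    push_cast
    linear_combination this + h2

/-- The reflection `r ↦ k + l - r` exchanges the two products. This is the commutativity of strictly
upper triangular matrices that are constant along diagonals. -/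
theorem sum_Ioo_comm (k l : Fin p) (x y : ℕ → ℂ) :
    ∑ r : Fin p, (if k < r ∧ r < l then x (r - k) * y (l - r) - y (r - k) * x (l - r) else 0) = 0
        := by
  have h : ∑ r : Fin p, (if k < r ∧ r < l then x (r - k) * y (l - r) else 0) =
      ∑ r : Fin p, (if k < r ∧ r < l then y (r - k) * x (l - r) else 0) := by
    rw [← Finset.sum_filter, ← Finset.sum_filter]
    refine Finset.sum_bij' (fun r hr => ⟨k + l - r, ?_⟩) (fun r hr => ⟨k + l - r, ?_⟩)
      (fun r hr => ?_) (fun r hr => ?_) (fun r hr => ?_) (fun r hr => ?_) (fun r hr => ?_)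
    all_goals
      simp only [Finset.mem_filter, Finset.mem_univ, true_and, Fin.lt_def] at hr
      have := l.2
    · omega
    · omega
    · simp only [Finset.mem_filter, Finset.mem_univ, true_and, Fin.lt_def]; omega
    · simp only [Finset.mem_filter, Finset.mem_univ, true_and, Fin.lt_def]; omega
    · ext; simp only; omega
    · ext; simp only; omega
    · have e1 : (k : ℕ) + l - r - k = l - r := by omega
      have e2 : (l : ℕ) - (k + l - r) = r - k := by omega
      simp only [e1, e2]
      ring
  rw [← sub_eq_zero, ← Finset.sum_sub_distrib] at h
  refine (Finset.sum_congr rfl fun r _ => ?_).trans h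
  split_ifs <;> simp

/-- The commutators of upper triangular matrices that are constant along the diagonals, except
that the main diagonals are arithmetic progressions with the same difference. -/
theorem commutator_apply
    (hβ : ∀ (i : Fin N) (k l : Fin p), (l : ℕ) = (k : ℕ) + 1 → β i k - β i l = κ)
    {B : Fin N → Matrix (Fin p) (Fin p) ℂ} {x : ℕ → Fin N → ℂ}
    (hdiag : ∀ i k, B i k k = β i k) (hlow : ∀ i k l, l < k → B i k l = 0)
    (hup : ∀ i k l, k < l → B i k l = x (l - k) i) (i j : Fin N) (k l : Fin p) :
    (B i * B j - B j * B i) k l =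
      if k < l then ((l - k : ℕ) : ℂ) * κ * (x (l - k) j - x (l - k) i) else 0 := by
  rw [Matrix.sub_apply, Matrix.mul_apply, Matrix.mul_apply, ← Finset.sum_sub_distrib]
  split_ifs with hkl
  · have hterm (r : Fin p) : B i k r * B j r l - B j k r * B i r l =
        (if r = k then β i k * x (l - k) j - β j k * x (l - k) i else 0) +
        (if r = l then x (l - k) i * β j l - x (l - k) j * β i l else 0) +
        (if k < r ∧ r < l then x (r - k) i * x (l - r) j - x (r - k) j * x (l - r) i else 0) := by
      obtain h | rfl | h := lt_trichotomy r k
      · rw [hlow i k r h, hlow j k r h, if_neg h.ne, if_neg (h.trans hkl).ne,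
          if_neg fun h' => h.not_gt h'.1]
        ring
      · rw [hdiag, hdiag, hup _ _ _ hkl, hup _ _ _ hkl, if_pos rfl, if_neg hkl.ne,
          if_neg fun h' => h'.1.false]
        ring
      obtain h' | rfl | h' := lt_trichotomy r l
      · rw [hup _ _ _ h, hup _ _ _ h, hup _ _ _ h', hup _ _ _ h', if_neg h.ne', if_neg h'.ne,
          if_pos ⟨h, h'⟩]
        ring
      · rw [hdiag, hdiag, hup _ _ _ h, hup _ _ _ h, if_neg h.ne', if_pos rfl,
          if_neg fun h' => h'.2.false]
        ring
      · rw [hlow i r l h', hlow j r l h', if_neg h.ne', if_neg h'.ne', if_neg fun h'' =>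
            h'.not_gt h''.2]
        ring
    simp only [hterm]
    rw [Finset.sum_add_distrib, Finset.sum_add_distrib,
      sum_Ioo_comm k l (fun d => x d i) (fun d => x d j)]
    simp only [Finset.sum_ite_eq', Finset.mem_univ, if_true]
    have e (i) := sub_eq_of_forall_succ hβ i (l - k) k l
      (by have := Fin.lt_def.1 hkl; omega)
    linear_combination x (l - k) j * e i - x (l - k) i * e j
  · refine Finset.sum_eq_zero fun r _ => ?_
    obtain h | rfl | h := lt_trichotomy r k
    · rw [hlow i k r h, hlow j k r h]; ring
    · obtain h | h := (not_lt.1 hkl).lt_or_eq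
      · rw [hlow i _ _ h, hlow j _ _ h]; ring
      · rw [h]; ring
    · have h' := (not_lt.1 hkl).trans_lt h
      rw [hlow i r l h', hlow j r l h']; ring

end Matrices

/-! ### The Schlesinger system -/

section Solution

variable {p m N : ℕ} {n : ℤ} {β : Fin N → Fin p → ℂ}

/-- The triangular matrices made of the periods solve the Schlesinger system. -/
theorem solvesSchlesinger_of_isPeriod (hm : 0 < m) (hn : n ≠ 0)
    (hβ : ∀ (i : Fin N) (k l : Fin p), (l : ℕ) = (k : ℕ) + 1 → β i k - β i l = (n : ℂ) / (m : ℂ))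
    {D : Set (Fin N → ℂ)} (hD : IsOpen D) (hinj : ∀ a ∈ D, Function.Injective a)
    {γ : ℕ → ∀ a : Fin N → ℂ, H1 (CycleSurface m n a)}
    (hγ : ∀ j, 0 < j → j < p → IsFlat D (γ j))
    {B : Fin N → (Fin N → ℂ) → Matrix (Fin p) (Fin p) ℂ}
    (hB : ∀ a ∈ D, ∀ (i : Fin N) (k l : Fin p),
      (k = l → B i a k l = β i k) ∧ (l < k → B i a k l = 0) ∧
      (k < l → IsPeriod n i ((l : ℕ) - (k : ℕ)) (γ ((l : ℕ) - (k : ℕ)) a) (B i a k l))) :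
    SolvesSchlesinger D B := by
  classical
  -- The period depends on `k`, `l` only through `d = l - k`. One choice for each `d`, with a
  -- default off `D`, gives functions shared by all entries of a diagonal, and uniqueness of periods
  -- identifies these entries with it.
  let v : ℕ → Fin N → (Fin N → ℂ) → ℂ := fun d i a =>
    if h : ∃ v, IsPeriod n i d (γ d a) v then h.choose else 0
  have hv (d : ℕ) (hd : 0 < d) (i) (a) (ha : a ∈ D) : IsPeriod n i d (γ d a) (v d i a) := by
    have h : ∃ v, IsPeriod n i d (γ d a) v :=
      (existsUnique_isPeriod hm (hinj a ha) hn i hd (γ d a)).exists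
    simp only [v, dif_pos h]
    exact h.choose_spec
  have hup (a) (ha : a ∈ D) (i) (k l : Fin p) (hkl : k < l) : B i a k l = v (l - k) i a := by
    have hd : 0 < (l : ℕ) - k := Nat.sub_pos_of_lt hkl
    exact (existsUnique_isPeriod hm (hinj a ha) hn i hd _).unique ((hB a ha i k l).2.2 hkl)
      (hv _ hd i a ha)
  intro b hb
  have hcomm (i j k l) := commutator_apply hβ (B := fun i => B i b) (x := fun d i => v d i b)
    (fun i k => (hB b hb i k k).1 rfl) (fun i k l => (hB b hb i k l).2.1) (hup b hb) i j k l
  simp only [hcomm]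
  have hfderiv (k l : Fin p) (hkl : k < l) := fderiv_of_isPeriod hm hn hD hinj
    (hγ (l - k) (Nat.sub_pos_of_lt hkl) (by omega)) (Nat.sub_pos_of_lt hkl)
    (hv (l - k) (Nat.sub_pos_of_lt hkl)) hb
  have hev (i) (k l : Fin p) (hkl : k < l) : (fun x => B i x k l) =ᶠ[𝓝 b] v (l - k) i := by
    filter_upwards [hD.mem_nhds hb] with a ha using hup a ha i k l hkl
  have hev' (i) (k l : Fin p) (hkl : ¬ k < l) :
      (fun x => B i x k l) =ᶠ[𝓝 b] fun _ => B i b k l := by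
    filter_upwards [hD.mem_nhds hb] with a ha
    obtain h | h := (not_lt.1 hkl).lt_or_eq
    · rw [(hB a ha i k l).2.1 h, (hB b hb i k l).2.1 h]
    · rw [(hB a ha i k l).1 h.symm, (hB b hb i k l).1 h.symm]
  refine ⟨fun i k l => ?_, fun i j hij k l => ?_, fun i k l => ?_⟩
  · by_cases hkl : k < l
    · exact ((hfderiv k l hkl).1 i).congr_of_eventuallyEq (hev i k l hkl)
    · exact (differentiableAt_const _).congr_of_eventuallyEq (hev' i k l hkl)
  · by_cases hkl : k < l
    · rw [(hev i k l hkl).fderiv_eq, (hfderiv k l hkl).2.1 i j hij, if_pos hkl, mul_div_assoc (_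
          : ℂ) (n : ℂ)]
    · rw [(hev' i k l hkl).fderiv_eq, if_neg hkl]
      simp
  · by_cases hkl : k < l
    · rw [(hev i k l hkl).fderiv_eq, (hfderiv k l hkl).2.2 i]
      simp only [if_pos hkl, mul_div_assoc (_ : ℂ) (n : ℂ)]
    · rw [(hev' i k l hkl).fderiv_eq]
      simp only [if_neg hkl]
      simp

end Solution

end Superelliptic

end

theorem theorem1 (p N m : ℕ) (n : ℤ) (hN : 0 < N) (hm : 0 < m) (hn : n ≠ 0)
    (hnm : IsCoprime n (m : ℤ)) (hm1 : 0 < n → 1 < m)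
    (β : Fin N → Fin p → ℂ)
    (hβ : ∀ (i : Fin N) (k l : Fin p), (l : ℕ) = (k : ℕ) + 1 → β i k - β i l = (n : ℂ) / (m : ℂ)) :
    -- the integrals of the differentials over the homology classes are well defined
    (∀ a : Fin N → ℂ, Function.Injective a → ∀ (i : Fin N) (j : ℕ), 0 < j →
      ∀ γ : H1 (CycleSurface m n a), ∃! v : ℂ, IsPeriod n i j γ v) ∧
    -- over a sufficiently small disc, every homology class is a class that does not depend on `a`
    (∀ a₀ : Fin N → ℂ, Function.Injective a₀ → ∃ r > 0,
      (∀ a ∈ Metric.ball a₀ r, Function.Injective a) ∧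
      ∀ γ₀ : H1 (CycleSurface m n a₀), ∃ γ : ∀ a : Fin N → ℂ, H1 (CycleSurface m n a),
        γ a₀ = γ₀ ∧ IsFlat (Metric.ball a₀ r) γ) ∧
    -- the triangular matrices made of the periods solve the Schlesinger system
    (∀ D : Set (Fin N → ℂ), IsOpen D → (∀ a ∈ D, Function.Injective a) →
      ∀ γ : ℕ → ∀ a : Fin N → ℂ, H1 (CycleSurface m n a),
      (∀ j, 0 < j → j < p → IsFlat D (γ j)) →
      ∀ B : Fin N → (Fin N → ℂ) → Matrix (Fin p) (Fin p) ℂ,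
      (∀ a ∈ D, ∀ (i : Fin N) (k l : Fin p),
        (k = l → B i a k l = β i k) ∧
        (l < k → B i a k l = 0) ∧
        (k < l → IsPeriod n i ((l : ℕ) - (k : ℕ)) (γ ((l : ℕ) - (k : ℕ)) a) (B i a k l))) →
      SolvesSchlesinger D B) := by
  exact ⟨fun a ha i _ hj γ => existsUnique_isPeriod hm ha hn i hj γ,
    fun a₀ ha₀ => exists_isFlat hm n a₀ ha₀,
    fun D hD hinj γ hγ B hB => solvesSchlesinger_of_isPeriod hm hn hβ hD hinj hγ hB⟩
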